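/- Theorem 1.2. Let $k\ge 1$ and $v\ge 2$ be integers. A lattice polytope is the convex hull of a nonempty finite subset of $\mathbb{Z}^d$ in $\mathbb{R}^d$ ($d\ge 0$), and a $d$-dimensional lattice simplex is the convex hull of $d+1$ affinely independent points of $\mathbb{Z}^d$. Two lattice polytopes $P,Q\subset\mathbb{R}^d$ are unimodularly equivalent if $Q=\{xU+w : x\in P\}$ for some $U\in\mathbb{Z}^{d\times d}$ with $\det U=\pm1$ and some $w\in\mathbb{Z}^d$. The $h^*$-polynomial of a $d$-dimensional lattice polytope $P\subset\mathbb{R}^d$ is the polynomial $h^*(P,t)$ with $$1+\sum_{m\ge1}|mP\cap\mathbb{Z}^d|\,t^m=\frac{h^*(P,t)}{(1-t)^{d+1}}.$$ A lattice polytope $P\subset \mathbb{R}^{d}$ is a lattice pyramid if $d\ge1$ and $P$ is unimodularly equivalent to $\operatorname{conv}\bigl(Q\times\{0\}\cup\{(0,\dots,0,1)\}\bigr)$ for some lattice polytope $Q\subset\mathbb{R}^{d-1}$. A lattice polytope $R\subset\mathbb{R}^d$ is reflexive if the origin lies in its interior and its dual $\{y\in\mathbb{R}^d : \langle x,y\rangle\le1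 \text{ for all } x\in R\}$ is again a lattice polytope; a lattice polytope $P$ is Gorenstein if $rP$ is unimodularly equivalent to a reflexive polytope for some integer $r\ge1$. Let $N(v,k)$ be the number of unimodular equivalence classes, over all dimensions $d$, of $d$-dimensional Gorenstein lattice simplices in $\mathbb{R}^d$ that are not lattice pyramids and whose $h^*$-polynomial is $$1+t^k+t^{2k}+\cdots+t^{(v-1)k}.$$ Then $N(v,k)$ is finite and $$N(v,k)=\sum_{s\ge1}c_s(D_v)\,s!,$$ where $D_v$ is the lattice of positive divisors of $v$ ordered by divisibility and $c_s(D_v)$ is the number of strict chains $1=M_0<M_1<\cdots<M_s=v$ in $D_v$. In particular, $N(v,k)$ depends only on the divisor lattice $D_v$: if $v,v'\ge2$, $k,k'\ge1$ and $D_v\cong D_{v'}$ as lattices, then $N(v,k)=N(v',k')$. -/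

import Mathlib

open scoped Pointwise PowerSeries Nat

namespace GorensteinSimplices

/-- The inclusion of the lattice `ℤ^d` into `ℝ^d`. -/
def latticeVec {d : ℕ} (z : Fin d → ℤ) : Fin d → ℝ := fun i => (z i : ℝ)

/-- A lattice polytope: the convex hull of a nonempty finite set of lattice points. -/
def IsLatticePolytope {d : ℕ} (P : Set (Fin d → ℝ)) : Prop :=
  ∃ S : Finset (Fin d → ℤ), S.Nonempty ∧
    P = convexHull ℝ (latticeVec '' (S : Set (Fin d → ℤ)))

/-- A full-dimensional lattice simplex in `ℝ^d`: the convex hull of `d + 1` affinely independent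
lattice points. -/
def IsLatticeSimplex {d : ℕ} (P : Set (Fin d → ℝ)) : Prop :=
  ∃ p : Fin (d + 1) → (Fin d → ℤ), AffineIndependent ℝ (fun i => latticeVec (p i)) ∧
    P = convexHull ℝ (Set.range fun i => latticeVec (p i))

/-- The affine map `x ↦ x U + w` of `ℝ^d` given by an integer matrix `U` and a lattice
point `w`. -/
def affineLatticeMap {d : ℕ} (U : Matrix (Fin d) (Fin d) ℤ) (w : Fin d → ℤ)
    (x : Fin d → ℝ) : Fin d → ℝ :=
  Matrix.vecMul x (U.map (fun a : ℤ => (a : ℝ))) + latticeVec w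

/-- Unimodular equivalence: `Q = f_U(P) + w` with `U` an integer matrix of determinant `±1` and
`w` a lattice point. -/
def UnimodularlyEquivalent {d : ℕ} (P Q : Set (Fin d → ℝ)) : Prop :=
  ∃ (U : Matrix (Fin d) (Fin d) ℤ) (w : Fin d → ℤ), IsUnit U.det ∧
    Q = affineLatticeMap U w '' P

/-- `L_P(m)`, the number of lattice points in the dilate `m P`. -/
noncomputable def latticePointCount {d : ℕ} (P : Set (Fin d → ℝ)) (m : ℕ) : ℕ :=
  {z : Fin d → ℤ | latticeVec z ∈ (m : ℝ) • P}.ncard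

/-- The Ehrhart series `1 + ∑_{m ≥ 1} L_P(m) t^m`. -/
noncomputable def ehrhartSeries {d : ℕ} (P : Set (Fin d → ℝ)) : ℤ⟦X⟧ :=
  PowerSeries.mk fun m => if m = 0 then 1 else (latticePointCount P m : ℤ)

/-- `h` is the `h^*`-polynomial of the `d`-dimensional polytope `P ⊆ ℝ^d`, that is,
`Ehr_P(t) = h(t) / (1 - t)^(d+1)`, with the denominator cleared. -/
def HasHStarPolynomial {d : ℕ} (P : Set (Fin d → ℝ)) (h : Polynomial ℤ) : Prop :=
  ehrhartSeries P * (1 - PowerSeries.X) ^ (d + 1) = (h : ℤ⟦X⟧)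

/-- The lattice pyramid `conv (Q × {0}, (0, …, 0, 1)) ⊆ ℝ^(d+1)` over `Q ⊆ ℝ^d`. -/
def pyramid {d : ℕ} (Q : Set (Fin d → ℝ)) : Set (Fin (d + 1) → ℝ) :=
  convexHull ℝ ((fun x : Fin d → ℝ => (Fin.snoc x 0 : Fin (d + 1) → ℝ)) '' Q ∪
    {(Fin.snoc (0 : Fin d → ℝ) 1 : Fin (d + 1) → ℝ)})

/-- `P` is a lattice pyramid: up to unimodular equivalence it is the pyramid over a lattice
polytope of one dimension less. (Iterated pyramids are covered, since each intermediate
pyramid is itself a lattice polytope.) -/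
def IsLatticePyramid : {d : ℕ} → Set (Fin d → ℝ) → Prop
  | 0, _ => False
  | d + 1, P => ∃ Q : Set (Fin d → ℝ), IsLatticePolytope Q ∧ UnimodularlyEquivalent (pyramid Q) P

/-- The dual (polar) polytope `{y | ⟨x, y⟩ ≤ 1 for all x ∈ P}`. -/
def dualPolytope {d : ℕ} (P : Set (Fin d → ℝ)) : Set (Fin d → ℝ) :=
  {y | ∀ x ∈ P, x ⬝ᵥ y ≤ 1}

/-- A reflexive polytope: a lattice polytope with the origin in its interior whose dual is again
a lattice polytope. -/
def IsReflexive {d : ℕ} (P : Set (Fin d → ℝ)) : Prop :=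
  IsLatticePolytope P ∧ (0 : Fin d → ℝ) ∈ interior P ∧ IsLatticePolytope (dualPolytope P)

/-- A Gorenstein polytope: a lattice polytope `P` such that, for some integer `r ≥ 1` (the index),
the dilate `r P` is unimodularly equivalent to a reflexive polytope. -/
def IsGorenstein {d : ℕ} (P : Set (Fin d → ℝ)) : Prop :=
  IsLatticePolytope P ∧ ∃ r : ℕ, 1 ≤ r ∧
    ∃ R : Set (Fin d → ℝ), IsReflexive R ∧ UnimodularlyEquivalent ((r : ℝ) • P) R

/-- The polynomial `1 + t^k + t^(2k) + ⋯ + t^((v-1)k)`. -/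
noncomputable def stepPolynomial (v k : ℕ) : Polynomial ℤ :=
  ∑ j ∈ Finset.range v, Polynomial.X ^ (j * k)

/-- The `d`-dimensional Gorenstein simplices in `ℝ^d` that are not lattice pyramids and whose
`h^*`-polynomial is `1 + t^k + ⋯ + t^((v-1)k)`. -/
def StepSimplex (v k d : ℕ) : Type :=
  {P : Set (Fin d → ℝ) // IsLatticeSimplex P ∧ IsGorenstein P ∧ ¬ IsLatticePyramid P ∧
    HasHStarPolynomial P (stepPolynomial v k)}

theorem affineLatticeMap_comp {d : ℕ} (U V : Matrix (Fin d) (Fin d) ℤ) (w u : Fin d → ℤ)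
    (x : Fin d → ℝ) :
    affineLatticeMap V u (affineLatticeMap U w x) =
      affineLatticeMap (U * V) (Matrix.vecMul w V + u) x := by
  have h1 : (U * V).map (fun a : ℤ => (a : ℝ)) =
      U.map (fun a : ℤ => (a : ℝ)) * V.map (fun a : ℤ => (a : ℝ)) := by
    ext i j
    simp [Matrix.mul_apply]
  have h2 : latticeVec (Matrix.vecMul w V + u) =
      Matrix.vecMul (latticeVec w) (V.map (fun a : ℤ => (a : ℝ))) + latticeVec u := by
    ext i
    simp [latticeVec, Matrix.vecMul, dotProduct]
  simp only [affineLatticeMap, h1, h2, Matrix.add_vecMul, Matrix.vecMul_vecMul, add_assoc]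

theorem affineLatticeMap_one {d : ℕ} (x : Fin d → ℝ) :
    affineLatticeMap (1 : Matrix (Fin d) (Fin d) ℤ) 0 x = x := by
  have h : (1 : Matrix (Fin d) (Fin d) ℤ).map (fun a : ℤ => (a : ℝ)) = 1 := by
    simp [Matrix.map_one]
  ext i
  simp [affineLatticeMap, h, latticeVec]

theorem UnimodularlyEquivalent.refl {d : ℕ} (P : Set (Fin d → ℝ)) :
    UnimodularlyEquivalent P P := by
  refine ⟨1, 0, by simp, ?_⟩
  simp [affineLatticeMap_one]

theorem UnimodularlyEquivalent.trans {d : ℕ} {P Q R : Set (Fin d → ℝ)}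
    (h₁ : UnimodularlyEquivalent P Q) (h₂ : UnimodularlyEquivalent Q R) :
    UnimodularlyEquivalent P R := by
  obtain ⟨U, w, hU, rfl⟩ := h₁
  obtain ⟨V, u, hV, rfl⟩ := h₂
  refine ⟨U * V, Matrix.vecMul w V + u, by rw [Matrix.det_mul]; exact hU.mul hV, ?_⟩
  rw [Set.image_image]
  simp only [affineLatticeMap_comp]

theorem UnimodularlyEquivalent.symm {d : ℕ} {P Q : Set (Fin d → ℝ)}
    (h : UnimodularlyEquivalent P Q) : UnimodularlyEquivalent Q P := by
  obtain ⟨U, w, hU, rfl⟩ := h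
  refine ⟨U⁻¹, -Matrix.vecMul w U⁻¹, Matrix.isUnit_nonsing_inv_det U hU, ?_⟩
  rw [Set.image_image]
  simp only [affineLatticeMap_comp, Matrix.mul_nonsing_inv U hU, add_neg_cancel,
    affineLatticeMap_one, Set.image_id']

/-- Unimodular equivalence on the simplices of dimension `d` that are counted. -/
def stepSimplexSetoid (v k d : ℕ) : Setoid (StepSimplex v k d) where
  r P Q := UnimodularlyEquivalent P.1 Q.1
  iseqv := ⟨fun P => .refl P.1, fun h => h.symm, fun h₁ h₂ => h₁.trans h₂⟩

/-- The unimodular equivalence classes of these simplices, of all dimensions. -/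
def StepSimplexClass (v k : ℕ) : Type :=
  Σ d : ℕ, Quotient (stepSimplexSetoid v k d)

/-- `N(v, k)`, the number of unimodular equivalence classes. -/
noncomputable def numClasses (v k : ℕ) : ℕ := Nat.card (StepSimplexClass v k)

/-- The divisor lattice `D_v`: the positive divisors of `v` (for `v ≥ 1`), ordered by
divisibility. -/
def DivisorLattice (v : ℕ) : Type := {a : ℕ // a ∣ v}

/-- Divisibility order, with `lcm` as join and `gcd` as meet. -/
instance (v : ℕ) : Lattice (DivisorLattice v) where
  le a b := a.1 ∣ b.1
  le_refl a := dvd_refl a.1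
  le_trans _ _ _ h₁ h₂ := dvd_trans h₁ h₂
  le_antisymm _ _ h₁ h₂ := Subtype.ext (Nat.dvd_antisymm h₁ h₂)
  sup a b := ⟨Nat.lcm a.1 b.1, Nat.lcm_dvd a.2 b.2⟩
  le_sup_left a b := Nat.dvd_lcm_left a.1 b.1
  le_sup_right a b := Nat.dvd_lcm_right a.1 b.1
  sup_le _ _ _ h₁ h₂ := Nat.lcm_dvd h₁ h₂
  inf a b := ⟨Nat.gcd a.1 b.1, dvd_trans (Nat.gcd_dvd_left a.1 b.1) a.2⟩
  inf_le_left a b := Nat.gcd_dvd_left a.1 b.1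
  inf_le_right a b := Nat.gcd_dvd_right a.1 b.1
  le_inf _ _ _ h₁ h₂ := Nat.dvd_gcd h₁ h₂

/-- `c_s(D_v)`, the number of strict chains `1 = M_0 < M_1 < ⋯ < M_s = v` in `D_v`. -/
noncomputable def chainCount (s v : ℕ) : ℕ :=
  Nat.card {M : Fin (s + 1) → DivisorLattice v //
    StrictMono M ∧ (M 0).1 = 1 ∧ (M (Fin.last s)).1 = v}

end GorensteinSimplices

open GorensteinSimplices

/-! A lattice simplex with vertices p_0, …, p_d is encoded by the group L of vectors x in ℝ^(d+1)
for which ∑ x_i and ∑ x_i p_i are integral (`simplexLattice`). It contains ℤ^(d+1), and up to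
permuting coordinates it is a complete invariant for unimodular equivalence. The coefficient of t^n
in the h^*-polynomial counts the vectors of L in the half-open unit cube with coordinate sum n, and
for d ≥ 1 the simplex is a pyramid exactly when some coordinate is integral on all of L. So one has
to classify the groups L whose cube vectors have sums 0, k, …, (v-1)k, once each.

The problem becomes recursive once coordinate sums are replaced by positive weights α and k by a
step κ (`Stepped`). If v ≥ 2, the cube vector of weight κ equals 1/f on a set S and 0 elsewhere
(`Stepped.exists_unitVec`). Every cube vector is a multiple c < f of it plus a vector that is less
than 1/f on S; this is division of the index by f. Moreover f divides v, vectors of L are constant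
modulo ℤ on S, and multiplying the coordinates in S by f gives a stepped group for v/f, step f κ and
weights α/f on S (`Stepped.pushLattice`). Conversely S, f and the new group determine L
(`eq_constOn_inf_comap`).

In the new group the coordinates of S all carry the same label: one of the later nodes, or none if
they have become integral. That label is the parent of the node just removed. Iterating
(`exists_forest`) yields an ordered factorization of v into s factors ≥ 2, and for each node a
parent among the later nodes or none, which makes s! choices. Every forest whose weights are
balanced gives a stepped group (`forestLattice_stepped`), and the forest can be read off from it
(`forest_unique`). For unit weights, balance prescribes how many coordinates carry each label
(`balanced_one_iff`), so the data determine the simplex up to permutation.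

Each datum occurs: its group comes from a lattice simplex (`exists_simplexLattice_eq`), which is
Gorenstein because the group contains a vector of unit fractions clearing all denominators
(`exists_unit_fractions`, `isGorenstein_simplex`). Finally, partial products turn ordered
factorizations into chains of divisors. -/

namespace GorensteinSimplices

/-! ### Integrality and the lattices of labelled forests. -/

section

/-- The integers inside `ℝ`. -/
def intReal : AddSubgroup ℝ := (Int.castAddHom ℝ).range

theorem mem_intReal {x : ℝ} : x ∈ intReal ↔ ∃ n : ℤ, (n : ℝ) = x := Iff.rfl

theorem intCast_mem_intReal (n : ℤ) : (n : ℝ) ∈ intReal := ⟨n, rfl⟩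

theorem natCast_mem_intReal (n : ℕ) : (n : ℝ) ∈ intReal := ⟨n, by simp⟩

theorem one_mem_intReal : (1 : ℝ) ∈ intReal := ⟨1, by simp⟩

theorem intReal_mul_mem {x y : ℝ} (hx : x ∈ intReal) (hy : y ∈ intReal) : x * y ∈ intReal := by
  obtain ⟨a, rfl⟩ := mem_intReal.1 hx
  obtain ⟨b, rfl⟩ := mem_intReal.1 hy
  exact ⟨a * b, by simp⟩

theorem sub_fract_mem_intReal (x : ℝ) : x - Int.fract x ∈ intReal := by
  rw [Int.self_sub_fract]
  exact intCast_mem_intReal _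

theorem eq_zero_of_mem_intReal {x : ℝ} (hx : x ∈ intReal) (h₁ : -1 < x) (h₂ : x < 1) : x = 0 := by
  obtain ⟨n, rfl⟩ := mem_intReal.1 hx
  have h₁ : (-1 : ℤ) < n := by exact_mod_cast h₁
  have h₂ : n < (1 : ℤ) := by exact_mod_cast h₂
  have : n = 0 := by omega
  simp [this]

theorem eq_of_sub_mem_intReal {x y : ℝ} (hx : 0 ≤ x ∧ x < 1) (hy : 0 ≤ y ∧ y < 1)
    (h : x - y ∈ intReal) : x = y := by
  have := eq_zero_of_mem_intReal h (by linarith [hx.1, hy.2]) (by linarith [hx.2, hy.1])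
  linarith

theorem mem_intReal_of_sub_mem {x y : ℝ} (h : x - y ∈ intReal) (hy : y ∈ intReal) :
    x ∈ intReal := by
  simpa using intReal.add_mem h hy

theorem sub_mem_intReal_trans {x y z : ℝ} (h : x - y ∈ intReal) (h' : y - z ∈ intReal) :
    x - z ∈ intReal := by
  simpa using intReal.add_mem h h'

theorem sub_mem_intReal_symm {x y : ℝ} (h : x - y ∈ intReal) : y - x ∈ intReal := by
  simpa using intReal.neg_mem h

variable {I : Type*}

/-- The integer lattice of `ℝ^I`. -/
def stdLattice (I : Type*) : AddSubgroup (I → ℝ) where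
  carrier := {x | ∀ i, x i ∈ intReal}
  add_mem' hx hy i := intReal.add_mem (hx i) (hy i)
  zero_mem' _ := intReal.zero_mem
  neg_mem' hx i := intReal.neg_mem (hx i)

/-- Vectors whose coordinates in `S` agree modulo `ℤ`. -/
def constOn (S : Set I) : AddSubgroup (I → ℝ) where
  carrier := {x | ∀ i ∈ S, ∀ j ∈ S, x i - x j ∈ intReal}
  add_mem' {x y} hx hy i hi j hj := by
    have := intReal.add_mem (hx i hi j hj) (hy i hi j hj)
    simpa [add_sub_add_comm] using this
  zero_mem' i _ j _ := by simp [intReal.zero_mem]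
  neg_mem' {x} hx i hi j hj := by
    have := hx j hj i hi
    simpa [neg_add_eq_sub] using this

open Classical in
/-- Multiply the coordinates in `S` by `f`. -/
noncomputable def scaleOn (S : Set I) (f : ℝ) : (I → ℝ) →+ (I → ℝ) where
  toFun x i := if i ∈ S then f * x i else x i
  map_zero' := by ext; simp
  map_add' x y := by ext i; by_cases h : i ∈ S <;> simp [h, mul_add]

theorem scaleOn_of_mem {S : Set I} {i : I} (h : i ∈ S) (f : ℝ) (x : I → ℝ) :
    scaleOn S f x i = f * x i := by simp [scaleOn, h]

theorem scaleOn_of_notMem {S : Set I} {i : I} (h : i ∉ S) (f : ℝ) (x : I → ℝ) :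
    scaleOn S f x i = x i := by simp [scaleOn, h]

/-- Parent pointers of a forest on `Fin s` in which every parent is larger than its child:
the parent of the least element, followed by the forest on the remaining ones. -/
def Par : ℕ → Type
  | 0 => Unit
  | s + 1 => Option (Fin s) × Par s

/-- Remove the least node from a labelling by nodes, passing its label on to its parent. -/
def peel {s : ℕ} (p : Option (Fin s)) (ν : I → Option (Fin (s + 1))) (i : I) : Option (Fin s) :=
  (ν i).bind (Fin.cases p some)

theorem peel_of_none {s : ℕ} (p : Option (Fin s)) {ν : I → Option (Fin (s + 1))} {i : I}
    (h : ν i = none) : peel p ν i = none := by simp [peel, h]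

theorem peel_of_zero {s : ℕ} (p : Option (Fin s)) {ν : I → Option (Fin (s + 1))} {i : I}
    (h : ν i = some 0) : peel p ν i = p := by simp [peel, h]

theorem peel_of_succ {s : ℕ} (p : Option (Fin s)) {ν : I → Option (Fin (s + 1))} {i : I}
    {j : Fin s} (h : ν i = some j.succ) : peel p ν i = some j := by simp [peel, h]

/-- The coordinates labelled by the least node. -/
def leastSet {s : ℕ} (ν : I → Option (Fin (s + 1))) : Set I := {i | ν i = some 0}

theorem mem_leastSet {s : ℕ} {ν : I → Option (Fin (s + 1))} {i : I} :
    i ∈ leastSet ν ↔ ν i = some 0 := Iff.rfl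

theorem eq_of_peel_eq {s : ℕ} {p : Option (Fin s)} {ν ν' : I → Option (Fin (s + 1))} {i i' : I}
    (hi : ν i ≠ some 0) (hi' : ν' i' ≠ some 0) (h : peel p ν i = peel p ν' i') :
    ν i = ν' i' := by
  rcases hν : ν i with _ | j
  · rcases hν' : ν' i' with _ | j'
    · rfl
    · cases j' using Fin.cases with
      | zero => exact absurd hν' hi'
      | succ j' => rw [peel_of_none p hν, peel_of_succ p hν'] at h; cases h
  · cases j using Fin.cases with
    | zero => exact absurd hν hi
    | succ j =>
      rcases hν' : ν' i' with _ | j'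
      · rw [peel_of_none p hν', peel_of_succ p hν] at h; cases h
      · cases j' using Fin.cases with
        | zero => exact absurd hν' hi'
        | succ j' =>
          rw [peel_of_succ p hν, peel_of_succ p hν'] at h
          cases h
          rfl

/-- The lattice in `ℝ^I` of a labelled forest: a vector `x` that is constant modulo `ℤ` on the
coordinates labelled by a node, with value `u` say, such that `f j * u j - u (parent j)` is an
integer for all nodes `j`. -/
noncomputable def forestLattice : {s : ℕ} → (Fin s → ℕ) → Par s → (I → Option (Fin s)) →
    AddSubgroup (I → ℝ)
  | 0, _, _, _ => stdLattice I
  | _ + 1, f, q, ν => constOn (leastSet ν) ⊓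
      (forestLattice (fun j => f j.succ) q.2 (peel q.1 ν)).comap (scaleOn (leastSet ν) (f 0))

theorem forestLattice_succ {s : ℕ} (f : Fin (s + 1) → ℕ) (q : Par (s + 1))
    (ν : I → Option (Fin (s + 1))) : forestLattice f q ν = constOn (leastSet ν) ⊓
      (forestLattice (fun j => f j.succ) q.2 (peel q.1 ν)).comap (scaleOn (leastSet ν) (f 0)) :=
  rfl

theorem mem_forestLattice_succ {s : ℕ} {f : Fin (s + 1) → ℕ} {q : Par (s + 1)}
    {ν : I → Option (Fin (s + 1))} {x : I → ℝ} :
    x ∈ forestLattice f q ν ↔ x ∈ constOn (leastSet ν) ∧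
      scaleOn (leastSet ν) (f 0) x ∈
        forestLattice (fun j => f j.succ) q.2 (peel q.1 ν) := Iff.rfl

theorem scaleOn_mem_stdLattice (S : Set I) (f : ℕ) {x : I → ℝ} (hx : x ∈ stdLattice I) :
    scaleOn S f x ∈ stdLattice I := by
  intro i
  by_cases h : i ∈ S
  · rw [scaleOn_of_mem h]
    exact intReal_mul_mem (natCast_mem_intReal f) (hx i)
  · rw [scaleOn_of_notMem h]
    exact hx i

theorem stdLattice_le_constOn (S : Set I) : stdLattice I ≤ constOn S :=
  fun _ hx i _ j _ => intReal.sub_mem (hx i) (hx j)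

theorem stdLattice_le_forestLattice : ∀ {s : ℕ} (f : Fin s → ℕ) (q : Par s)
    (ν : I → Option (Fin s)), stdLattice I ≤ forestLattice f q ν
  | 0, _, _, _ => le_rfl
  | _ + 1, _, q, _ => fun _ hx => mem_forestLattice_succ.2 ⟨stdLattice_le_constOn _ hx,
      stdLattice_le_forestLattice _ q.2 _ (scaleOn_mem_stdLattice _ _ hx)⟩

theorem mem_of_sub_mem_stdLattice {L : AddSubgroup (I → ℝ)} (hL : stdLattice I ≤ L)
    {x y : I → ℝ} (h : ∀ i, x i - y i ∈ intReal) (hy : y ∈ L) : x ∈ L := by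
  have := L.add_mem (hL (show x - y ∈ stdLattice I from h)) hy
  simpa using this

theorem forestLattice_sub_mem : ∀ {s : ℕ} {f : Fin s → ℕ} {q : Par s}
    {ν : I → Option (Fin s)} {x : I → ℝ}, x ∈ forestLattice f q ν → ∀ {i j : I}, ν i = ν j →
    x i - x j ∈ intReal
  | 0, _, _, _, _, hx, i, j, _ => intReal.sub_mem (hx i) (hx j)
  | s + 1, f, q, ν, x, hx, i, j, hij => by
    by_cases h : ν i = some 0
    · exact (mem_forestLattice_succ.1 hx).1 i h j (by rw [mem_leastSet, ← hij, h])
    · have := forestLattice_sub_mem (mem_forestLattice_succ.1 hx).2 (i := i) (j := j)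
        (by simp [peel, hij])
      rwa [scaleOn_of_notMem (by simpa [leastSet] using h),
        scaleOn_of_notMem (by simpa [leastSet, ← hij] using h)] at this

theorem forestLattice_mem_of_none : ∀ {s : ℕ} {f : Fin s → ℕ} {q : Par s}
    {ν : I → Option (Fin s)} {x : I → ℝ}, x ∈ forestLattice f q ν → ∀ {i : I}, ν i = none →
    x i ∈ intReal
  | 0, _, _, _, _, hx, i, _ => hx i
  | _ + 1, _, _, _, x, hx, i, hi => by
    have := forestLattice_mem_of_none (mem_forestLattice_succ.1 hx).2 (i := i)
      (peel_of_none _ hi)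
    rwa [scaleOn_of_notMem (by simp [leastSet, hi])] at this

/-- The image of `L` under `scaleOn S f`, saturated by the integer lattice. -/
noncomputable def pushLattice (S : Set I) (f : ℝ) (L : AddSubgroup (I → ℝ)) :
    AddSubgroup (I → ℝ) := L.map (scaleOn S f) ⊔ stdLattice I

theorem mem_pushLattice {S : Set I} {f : ℝ} {L : AddSubgroup (I → ℝ)} {w : I → ℝ} :
    w ∈ pushLattice S f L ↔ ∃ x ∈ L, ∀ i, w i - scaleOn S f x i ∈ intReal := by
  constructor
  · intro h
    obtain ⟨_, ⟨x, hx, rfl⟩, z, hz, rfl⟩ := AddSubgroup.mem_sup.1 h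
    exact ⟨x, hx, fun i => by simpa using hz i⟩
  · rintro ⟨x, hx, h⟩
    exact AddSubgroup.mem_sup.2 ⟨_, ⟨x, hx, rfl⟩, w - scaleOn S f x, h, by simp⟩

/-- The least coordinates share a label after peeling, so `w` agrees on them modulo ℤ. The lift
divides one representative value `w a` by `f 0` for all of them: dividing each entry separately
would lose the agreement modulo ℤ. -/
theorem exists_forestLattice_lift {s : ℕ} {f : Fin (s + 1) → ℕ} (hf : f 0 ≠ 0)
    {q : Par (s + 1)} {ν : I → Option (Fin (s + 1))} {w : I → ℝ}
    (hw : w ∈ forestLattice (fun j => f j.succ) q.2 (peel q.1 ν)) :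
    ∃ x ∈ forestLattice f q ν, ∀ i, w i - scaleOn (leastSet ν) (f 0) x i ∈ intReal := by
  classical
  have hf' : (f 0 : ℝ) ≠ 0 := by exact_mod_cast hf
  by_cases hS : (leastSet ν).Nonempty
  · obtain ⟨a, ha⟩ := hS
    set x : I → ℝ := fun i => if i ∈ leastSet ν then w a / f 0 else w i with hx
    have key : ∀ i, w i - scaleOn (leastSet ν) (f 0) x i ∈ intReal := by
      intro i
      by_cases h : i ∈ leastSet ν
      · rw [scaleOn_of_mem h]
        simp only [hx, if_pos h, mul_div_cancel₀ _ hf']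
        exact forestLattice_sub_mem hw (by rw [peel_of_zero _ h, peel_of_zero _ ha])
      · rw [scaleOn_of_notMem h]
        simp [hx, h, intReal.zero_mem]
    refine ⟨x, mem_forestLattice_succ.2 ⟨?_, ?_⟩, key⟩
    · intro i hi j hj
      simp [hx, hi, hj, intReal.zero_mem]
    · exact mem_of_sub_mem_stdLattice (stdLattice_le_forestLattice _ _ _)
        (fun i => sub_mem_intReal_symm (key i)) hw
  · have h0 : ∀ i, i ∉ leastSet ν := fun i hi => hS ⟨i, hi⟩
    have h1 : scaleOn (leastSet ν) (f 0) w = w := by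
      ext i
      rw [scaleOn_of_notMem (h0 i)]
    refine ⟨w, mem_forestLattice_succ.2 ⟨fun i hi => absurd hi (h0 i), by rwa [h1]⟩, ?_⟩
    intro i
    simp [h1, intReal.zero_mem]

theorem pushLattice_forestLattice {s : ℕ} {f : Fin (s + 1) → ℕ} (hf : f 0 ≠ 0)
    (q : Par (s + 1)) (ν : I → Option (Fin (s + 1))) :
    pushLattice (leastSet ν) (f 0) (forestLattice f q ν) =
      forestLattice (fun j => f j.succ) q.2 (peel q.1 ν) := by
  ext w
  rw [mem_pushLattice]
  constructor
  · rintro ⟨x, hx, h⟩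
    exact mem_of_sub_mem_stdLattice (stdLattice_le_forestLattice _ _ _) h
      (mem_forestLattice_succ.1 hx).2
  · exact exists_forestLattice_lift hf

open Classical in
/-- The vector with entries `1 / f` on `S` and `0` elsewhere. -/
noncomputable def unitVec (S : Set I) (f : ℝ) : I → ℝ := fun i => if i ∈ S then 1 / f else 0

theorem unitVec_of_mem {S : Set I} {i : I} (h : i ∈ S) (f : ℝ) : unitVec S f i = 1 / f := by
  simp [unitVec, h]

theorem unitVec_of_notMem {S : Set I} {i : I} (h : i ∉ S) (f : ℝ) : unitVec S f i = 0 := by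
  simp [unitVec, h]

/-- Scaling turns this vector into an integral one. It is the vector that distinguishes the least
node from all other labels. -/
theorem unitVec_mem_forestLattice {s : ℕ} {f : Fin (s + 1) → ℕ} (hf : f 0 ≠ 0)
    (q : Par (s + 1)) (ν : I → Option (Fin (s + 1))) :
    unitVec (leastSet ν) (f 0) ∈ forestLattice f q ν := by
  have hf' : (f 0 : ℝ) ≠ 0 := by exact_mod_cast hf
  refine mem_forestLattice_succ.2 ⟨fun i hi j hj => ?_, stdLattice_le_forestLattice _ _ _ ?_⟩
  · simp [unitVec_of_mem hi, unitVec_of_mem hj, intReal.zero_mem]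
  · intro i
    by_cases h : i ∈ leastSet ν
    · rw [scaleOn_of_mem h, unitVec_of_mem h, mul_one_div_cancel hf']
      exact one_mem_intReal
    · rw [scaleOn_of_notMem h, unitVec_of_notMem h]
      exact intReal.zero_mem

theorem one_div_notMem_intReal {f : ℕ} (hf : 2 ≤ f) : (1 / f : ℝ) ∉ intReal := by
  intro h
  have hf' : (2 : ℝ) ≤ f := by exact_mod_cast hf
  have h0 : (0 : ℝ) < 1 / f := by positivity
  have h1 : (1 / f : ℝ) < 1 := by rw [div_lt_one (by linarith)]; linarith
  have := eq_zero_of_mem_intReal h (by linarith) h1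
  linarith

/-- Coordinates on which the lattice agrees modulo `ℤ` carry the same label. -/
theorem label_eq_of_sub_mem : ∀ {s : ℕ} {f : Fin s → ℕ} (_ : ∀ j, 2 ≤ f j) {q : Par s}
    {ν : I → Option (Fin s)} {i i' : I},
    (∀ x ∈ forestLattice f q ν, x i - x i' ∈ intReal) → ν i = ν i'
  | 0, _, _, _, ν, i, i', _ => Subsingleton.elim _ _
  | s + 1, f, hf, q, ν, i, i', h => by
    have hf0 : f 0 ≠ 0 := by have := hf 0; omega
    have hx := h _ (unitVec_mem_forestLattice hf0 q ν)
    by_cases hi : i ∈ leastSet ν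
    · by_cases hi' : i' ∈ leastSet ν
      · rw [mem_leastSet.1 hi, mem_leastSet.1 hi']
      · rw [unitVec_of_mem hi, unitVec_of_notMem hi', sub_zero] at hx
        exact absurd hx (one_div_notMem_intReal (hf 0))
    · by_cases hi' : i' ∈ leastSet ν
      · rw [unitVec_of_mem hi', unitVec_of_notMem hi, zero_sub, intReal.neg_mem_iff] at hx
        exact absurd hx (one_div_notMem_intReal (hf 0))
      -- Scaling does not touch coordinates outside the least set, so the hypothesis passes to the
      -- peeled lattice through lifts.
      · refine eq_of_peel_eq (p := q.1) hi hi'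
          (label_eq_of_sub_mem (fun j => hf j.succ) (q := q.2) fun w hw => ?_)
        obtain ⟨x, hx, hxw⟩ := exists_forestLattice_lift hf0 hw
        have h1 := hxw i
        have h2 := hxw i'
        rw [scaleOn_of_notMem hi] at h1
        rw [scaleOn_of_notMem hi'] at h2
        exact sub_mem_intReal_trans (sub_mem_intReal_trans h1 (h x hx)) (sub_mem_intReal_symm h2)

/-- A coordinate on which the lattice is integral carries no label. -/
theorem label_eq_none_of_mem : ∀ {s : ℕ} {f : Fin s → ℕ} (_ : ∀ j, 2 ≤ f j) {q : Par s}
    {ν : I → Option (Fin s)} {i : I},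
    (∀ x ∈ forestLattice f q ν, x i ∈ intReal) → ν i = none
  | 0, _, _, _, ν, i, _ => Subsingleton.elim _ _
  | s + 1, f, hf, q, ν, i, h => by
    have hf0 : f 0 ≠ 0 := by have := hf 0; omega
    have hx := h _ (unitVec_mem_forestLattice hf0 q ν)
    by_cases hi : i ∈ leastSet ν
    · rw [unitVec_of_mem hi] at hx
      exact absurd hx (one_div_notMem_intReal (hf 0))
    · have h0 : peel q.1 ν i = none := by
        refine label_eq_none_of_mem (fun j => hf j.succ) (q := q.2) fun w hw => ?_
        obtain ⟨x, hx, hxw⟩ := exists_forestLattice_lift hf0 hw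
        have h1 := hxw i
        rw [scaleOn_of_notMem hi] at h1
        exact mem_intReal_of_sub_mem h1 (h x hx)
      refine eq_of_peel_eq (p := q.1) (ν' := fun _ : I => none) (i' := i) hi (by simp) ?_
      rw [h0]
      rfl

end

/-! ### Forest lattices are stepped, and determine their forest. -/

section

variable {I : Type*}

/-- The half-open unit cube. -/
def unitBox (I : Type*) : Set (I → ℝ) := {x | ∀ i, 0 ≤ x i ∧ x i < 1}

theorem fract_mem_unitBox (x : I → ℝ) : (fun i ↦ Int.fract (x i)) ∈ unitBox I :=
  fun _ => ⟨Int.fract_nonneg _, Int.fract_lt_one _⟩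

theorem fract_mem_of_mem {L : AddSubgroup (I → ℝ)} (hL : stdLattice I ≤ L) {x : I → ℝ}
    (hx : x ∈ L) : (fun i ↦ Int.fract (x i)) ∈ L :=
  mem_of_sub_mem_stdLattice hL (fun _ => sub_mem_intReal_symm (sub_fract_mem_intReal _)) hx

theorem scaleOn_scaleOn_inv (S : Set I) {f : ℝ} (hf : f ≠ 0) (x : I → ℝ) :
    scaleOn S f (scaleOn S f⁻¹ x) = x := by
  ext i
  by_cases h : i ∈ S
  · rw [scaleOn_of_mem h, scaleOn_of_mem h, mul_inv_cancel_left₀ hf]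
  · rw [scaleOn_of_notMem h, scaleOn_of_notMem h]

theorem scaleOn_inv_scaleOn (S : Set I) {f : ℝ} (hf : f ≠ 0) (x : I → ℝ) :
    scaleOn S f⁻¹ (scaleOn S f x) = x := by
  ext i
  by_cases h : i ∈ S
  · rw [scaleOn_of_mem h, scaleOn_of_mem h, inv_mul_cancel_left₀ hf]
  · rw [scaleOn_of_notMem h, scaleOn_of_notMem h]

theorem unitVec_mem_unitBox (S : Set I) {f : ℕ} (hf : 2 ≤ f) : unitVec S f ∈ unitBox I := by
  intro i
  have hf' : (2 : ℝ) ≤ f := by exact_mod_cast hf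
  by_cases h : i ∈ S
  · rw [unitVec_of_mem h]
    refine ⟨by positivity, ?_⟩
    rw [div_lt_one (by linarith)]
    linarith
  · rw [unitVec_of_notMem h]
    simp

/-- Division with remainder: `x` has a single value on the least set; `f 0` times it has integer
part `c`, the digit, and its fractional part is passed on to `w`. `forestLattice_box_glue` is the
converse. -/
theorem forestLattice_box_split {s : ℕ} {f : Fin (s + 1) → ℕ} (hf : 2 ≤ f 0)
    {q : Par (s + 1)} {ν : I → Option (Fin (s + 1))} (hν : (leastSet ν).Nonempty) {x : I → ℝ}
    (hx : x ∈ forestLattice f q ν) (hb : x ∈ unitBox I) :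
    ∃ c < f 0, ∃ w ∈ forestLattice (fun j => f j.succ) q.2 (peel q.1 ν), w ∈ unitBox I ∧
      x = (c : ℝ) • unitVec (leastSet ν) (f 0) + scaleOn (leastSet ν) (f 0 : ℝ)⁻¹ w := by
  obtain ⟨a, ha⟩ := hν
  have hf0 : (0 : ℝ) < f 0 := by exact_mod_cast (by omega : 0 < f 0)
  obtain ⟨hc, hl⟩ := mem_forestLattice_succ.1 hx
  have hxa : ∀ i ∈ leastSet ν, x i = x a := fun i hi =>
    eq_of_sub_mem_intReal (hb i) (hb a) (hc i hi a ha)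
  have hn : 0 ≤ (f 0 : ℝ) * x a := mul_nonneg hf0.le (hb a).1
  refine ⟨⌊(f 0 : ℝ) * x a⌋₊, ?_, _, fract_mem_of_mem (stdLattice_le_forestLattice _ _ _) hl,
    fract_mem_unitBox _, ?_⟩
  · rw [Nat.floor_lt hn]
    nlinarith [(hb a).2]
  · ext i
    by_cases h : i ∈ leastSet ν
    · simp only [Pi.add_apply, Pi.smul_apply, smul_eq_mul]
      rw [unitVec_of_mem h, scaleOn_of_mem h, scaleOn_of_mem h, hxa i h, Int.fract,
        natCast_floor_eq_intCast_floor hn]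
      field_simp
      ring
    · simp only [Pi.add_apply, Pi.smul_apply, smul_eq_mul]
      rw [unitVec_of_notMem h, scaleOn_of_notMem h, scaleOn_of_notMem h,
        Int.fract_eq_self.2 (hb i)]
      ring

theorem forestLattice_box_glue {s : ℕ} {f : Fin (s + 1) → ℕ} (hf : 2 ≤ f 0)
    {q : Par (s + 1)} {ν : I → Option (Fin (s + 1))} {c : ℕ} (hc : c < f 0) {w : I → ℝ}
    (hw : w ∈ forestLattice (fun j => f j.succ) q.2 (peel q.1 ν)) (hb : w ∈ unitBox I) :
    (c : ℝ) • unitVec (leastSet ν) (f 0) + scaleOn (leastSet ν) (f 0 : ℝ)⁻¹ w ∈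
      forestLattice f q ν ∧
    (c : ℝ) • unitVec (leastSet ν) (f 0) + scaleOn (leastSet ν) (f 0 : ℝ)⁻¹ w ∈ unitBox I := by
  have hf0 : (0 : ℝ) < f 0 := by exact_mod_cast (by omega : 0 < f 0)
  have hcf : (c : ℝ) + 1 ≤ f 0 := by exact_mod_cast hc
  refine ⟨AddSubgroup.add_mem _ ?_ (mem_forestLattice_succ.2 ⟨?_, ?_⟩), ?_⟩
  · have := AddSubgroup.nsmul_mem _ (unitVec_mem_forestLattice (f := f) (by omega) q ν) c
    rwa [← Nat.cast_smul_eq_nsmul ℝ] at this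
  · intro i hi j hj
    have := eq_of_sub_mem_intReal (hb i) (hb j)
      (forestLattice_sub_mem hw (by rw [peel_of_zero _ hi, peel_of_zero _ hj]))
    rw [scaleOn_of_mem hi, scaleOn_of_mem hj, this, sub_self]
    exact intReal.zero_mem
  · rwa [scaleOn_scaleOn_inv _ hf0.ne']
  · intro i
    by_cases h : i ∈ leastSet ν
    · simp only [Pi.add_apply, Pi.smul_apply, smul_eq_mul]
      rw [unitVec_of_mem h, scaleOn_of_mem h]
      have := (hb i).1
      refine ⟨by positivity, ?_⟩
      rw [mul_one_div, inv_mul_eq_div, ← add_div, div_lt_one hf0]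
      linarith [(hb i).2]
    · simp only [Pi.add_apply, Pi.smul_apply, smul_eq_mul]
      rw [unitVec_of_notMem h, scaleOn_of_notMem h]
      simpa using hb i

theorem unitVec_injective {S S' : Set I} (hS : S.Nonempty) {f f' : ℕ} (hf : 2 ≤ f)
    (hf' : 2 ≤ f') (h : unitVec S (f : ℝ) = unitVec S' f') : S = S' ∧ f = f' := by
  have hpos : (0 : ℝ) < 1 / f := by
    have : (0 : ℝ) < f := by exact_mod_cast (by omega : 0 < f)
    positivity
  have hpos' : (0 : ℝ) < 1 / f' := by
    have : (0 : ℝ) < f' := by exact_mod_cast (by omega : 0 < f')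
    positivity
  have hSS : S = S' := by
    ext i
    have hi := congrFun h i
    constructor
    · intro hs
      by_contra hs'
      rw [unitVec_of_mem hs, unitVec_of_notMem hs'] at hi
      exact hpos.ne' hi
    · intro hs'
      by_contra hs
      rw [unitVec_of_mem hs', unitVec_of_notMem hs] at hi
      exact hpos'.ne hi
  refine ⟨hSS, ?_⟩
  obtain ⟨a, ha⟩ := hS
  have hi := congrFun h a
  rw [unitVec_of_mem ha, unitVec_of_mem (hSS ▸ ha)] at hi
  simpa using hi

variable [Fintype I]

theorem dotProduct_scaleOn (S : Set I) (f : ℝ) (α x : I → ℝ) :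
    α ⬝ᵥ scaleOn S f x = scaleOn S f α ⬝ᵥ x := by
  refine Finset.sum_congr rfl fun i _ => ?_
  by_cases h : i ∈ S
  · rw [scaleOn_of_mem h, scaleOn_of_mem h]; ring
  · rw [scaleOn_of_notMem h, scaleOn_of_notMem h]

/-- The vectors of `L` in the half-open unit cube have weights `κ * n` for `n < v`, and each of
these weights is attained exactly once. -/
structure Stepped (α : I → ℝ) (κ : ℝ) (v : ℕ) (L : AddSubgroup (I → ℝ)) : Prop where
  exists_index : ∀ x ∈ L, x ∈ unitBox I → ∃ n < v, α ⬝ᵥ x = κ * n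
  exists_mem : ∀ n < v, ∃ x ∈ L, x ∈ unitBox I ∧ α ⬝ᵥ x = κ * n
  injOn : ∀ x ∈ L, x ∈ unitBox I → ∀ y ∈ L, y ∈ unitBox I → α ⬝ᵥ x = α ⬝ᵥ y → x = y

/-- The condition on weights `α` which makes the lattice of a labelled forest stepped: the
canonical vector attached to the `j`-th node has weight `κ * f 0 * ⋯ * f (j - 1)`. -/
def Balanced : {s : ℕ} → (Fin s → ℕ) → Par s → (I → Option (Fin s)) → (I → ℝ) → ℝ → Prop
  | 0, _, _, _, _, _ => True
  | _ + 1, f, q, ν, α, κ => α ⬝ᵥ unitVec (leastSet ν) (f 0) = κ ∧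
      Balanced (fun j => f j.succ) q.2 (peel q.1 ν) (scaleOn (leastSet ν) (f 0 : ℝ)⁻¹ α) (f 0 * κ)

theorem leastSet_nonempty_of_balanced {s : ℕ} {f : Fin (s + 1) → ℕ} {q : Par (s + 1)}
    {ν : I → Option (Fin (s + 1))} {α : I → ℝ} {κ : ℝ} (hκ : 0 < κ) (h : Balanced f q ν α κ) :
    (leastSet ν).Nonempty := by
  by_contra hS
  have h0 : unitVec (leastSet ν) (f 0) = 0 := by
    ext i
    exact unitVec_of_notMem (fun hi => hS ⟨i, hi⟩) _
  have := h.1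
  rw [h0, dotProduct_zero] at this
  exact hκ.ne this

/-- Mixed-radix expansion: splitting off the least node writes the index as `f 0 * m + c`, with `c`
the digit and `m` the index of `w` in the peeled lattice. Existence and uniqueness of indices are
those of quotient and remainder. -/
theorem forestLattice_stepped : ∀ {s : ℕ} {f : Fin s → ℕ} (_ : ∀ j, 2 ≤ f j) {q : Par s}
    {ν : I → Option (Fin s)} {α : I → ℝ} {κ : ℝ}, 0 < κ → Balanced f q ν α κ →
    Stepped α κ (∏ j, f j) (forestLattice f q ν)
  | 0, f, _, q, ν, α, κ, hκ, _ => by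
    have h0 : ∀ x ∈ forestLattice f q ν, x ∈ unitBox I → x = 0 := fun x hx hb => by
      ext i
      exact eq_zero_of_mem_intReal (hx i) (by linarith [(hb i).1]) (hb i).2
    refine ⟨fun x hx hb => ⟨0, by simp, by simp [h0 x hx hb]⟩, fun n hn => ?_,
      fun x hx hb y hy hb' _ => by rw [h0 x hx hb, h0 y hy hb']⟩
    have hn : n = 0 := by simpa using hn
    exact ⟨0, AddSubgroup.zero_mem _, fun i => by simp, by simp [hn]⟩
  | s + 1, f, hf, q, ν, α, κ, hκ, hbal => by
    have hf0 : (0 : ℝ) < f 0 := by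
      have := hf 0
      exact_mod_cast (by omega : 0 < f 0)
    have hS := leastSet_nonempty_of_balanced hκ hbal
    have ih := forestLattice_stepped (fun j => hf j.succ) (mul_pos hf0 hκ) hbal.2
    have hht : ∀ (c : ℕ) (w : I → ℝ), α ⬝ᵥ ((c : ℝ) • unitVec (leastSet ν) (f 0) +
        scaleOn (leastSet ν) (f 0 : ℝ)⁻¹ w) =
        c * κ + scaleOn (leastSet ν) (f 0 : ℝ)⁻¹ α ⬝ᵥ w := fun c w => by
      rw [dotProduct_add, dotProduct_smul, hbal.1, dotProduct_scaleOn, smul_eq_mul]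
    rw [Fin.prod_univ_succ]
    refine ⟨fun x hx hb => ?_, fun n hn => ?_, fun x hx hb y hy hb' hxy => ?_⟩
    · obtain ⟨c, hc, w, hw, hwb, rfl⟩ := forestLattice_box_split (hf 0) hS hx hb
      obtain ⟨m, hm, hm'⟩ := ih.exists_index w hw hwb
      refine ⟨f 0 * m + c, ?_, ?_⟩
      · calc f 0 * m + c < f 0 * (m + 1) := by rw [mul_add, mul_one]; omega
          _ ≤ _ := Nat.mul_le_mul_left _ hm
      · rw [hht, hm']
        push_cast
        ring
    · obtain ⟨w, hw, hwb, hh⟩ := ih.exists_mem (n / f 0)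
        (Nat.div_lt_of_lt_mul hn)
      obtain ⟨h1, h2⟩ := forestLattice_box_glue (hf 0)
        (Nat.mod_lt n (by have := hf 0; omega : 0 < f 0)) hw hwb
      refine ⟨_, h1, h2, ?_⟩
      rw [hht, hh]
      conv_rhs => rw [← Nat.div_add_mod n (f 0)]
      push_cast
      ring
    · obtain ⟨c, hc, w, hw, hwb, rfl⟩ := forestLattice_box_split (hf 0) hS hx hb
      obtain ⟨c', hc', w', hw', hwb', rfl⟩ := forestLattice_box_split (hf 0) hS hy hb'
      obtain ⟨m, hm, hmh⟩ := ih.exists_index w hw hwb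
      obtain ⟨m', hm', hmh'⟩ := ih.exists_index w' hw' hwb'
      rw [hht, hht, hmh, hmh'] at hxy
      have h1 : ((f 0 * m + c : ℕ) : ℝ) = (f 0 * m' + c' : ℕ) := by
        push_cast
        have : κ * ((f 0 * m + c : ℝ)) = κ * (f 0 * m' + c') := by linarith
        exact mul_left_cancel₀ hκ.ne' this
      have h2 : f 0 * m + c = f 0 * m' + c' := by exact_mod_cast h1
      have h3 : m = m' := by
        have := congrArg (· / f 0) h2
        simpa [Nat.mul_add_div (by omega : 0 < f 0), Nat.div_eq_of_lt hc,
          Nat.div_eq_of_lt hc'] using this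
      subst h3
      have h4 : c = c' := by omega
      subst h4
      rw [ih.injOn w hw hwb w' hw' hwb' (by rw [hmh, hmh'])]

instance : Subsingleton (Par 0) := inferInstanceAs (Subsingleton Unit)

/-- The vector of index 1 is unique, so it reveals the least set and its factor; pushing forward
then reveals the peeled lattice, to which induction applies. Both sides share `α` and `κ`, which
makes the index comparable. -/
theorem forest_unique : ∀ {s : ℕ} {f : Fin s → ℕ} (_ : ∀ j, 2 ≤ f j) {q : Par s}
    {ν : I → Option (Fin s)} {s' : ℕ} {f' : Fin s' → ℕ} (_ : ∀ j, 2 ≤ f' j) {q' : Par s'}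
    {ν' : I → Option (Fin s')} {α : I → ℝ} {κ : ℝ}, 0 < κ → Balanced f q ν α κ →
    Balanced f' q' ν' α κ → forestLattice f q ν = forestLattice f' q' ν' →
    (⟨s, f, q, ν⟩ : Σ s : ℕ, (Fin s → ℕ) × Par s × (I → Option (Fin s))) = ⟨s', f', q', ν'⟩ := by
  have aux : ∀ {s : ℕ} {f : Fin (s + 1) → ℕ} (_ : ∀ j, 2 ≤ f j) {q : Par (s + 1)}
      {ν : I → Option (Fin (s + 1))} {α : I → ℝ} {κ : ℝ}, 0 < κ → Balanced f q ν α κ →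
      forestLattice f q ν ≠ stdLattice I := by
    intro s f hf q ν α κ hκ hb h
    obtain ⟨a, ha⟩ := leastSet_nonempty_of_balanced hκ hb
    have h1 := unitVec_mem_forestLattice (f := f) (by have := hf 0; omega) q ν
    rw [h] at h1
    have h2 := h1 a
    rw [unitVec_of_mem ha] at h2
    exact one_div_notMem_intReal (hf 0) h2
  intro s
  induction s with
  | zero =>
    intro f hf q ν s' f' hf' q' ν' α κ hκ hb hb' h
    cases s' with
    | zero =>
      rw [Subsingleton.elim f f', Subsingleton.elim q q', Subsingleton.elim ν ν']
    | succ s' => exact absurd h.symm (aux hf' hκ hb')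
  | succ s ih =>
    intro f hf q ν s' f' hf' q' ν' α κ hκ hb hb' h
    cases s' with
    | zero => exact absurd h (aux hf hκ hb)
    | succ s' =>
      have hf0 : f 0 ≠ 0 := by have := hf 0; omega
      have hf0' : f' 0 ≠ 0 := by have := hf' 0; omega
      have hS := leastSet_nonempty_of_balanced hκ hb
      obtain ⟨hSS, hff⟩ := unitVec_injective hS (hf 0) (hf' 0)
        ((forestLattice_stepped hf hκ hb).injOn _ (unitVec_mem_forestLattice hf0 q ν)
          (unitVec_mem_unitBox _ (hf 0)) _ (h ▸ unitVec_mem_forestLattice hf0' q' ν')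
          (unitVec_mem_unitBox _ (hf' 0)) (by rw [hb.1, hb'.1]))
      have hl := pushLattice_forestLattice hf0 q ν
      rw [h, hSS, hff, pushLattice_forestLattice hf0' q' ν'] at hl
      have hb2 := hb'.2
      rw [← hSS, ← hff] at hb2
      have key := ih (fun j => hf j.succ) (fun j => hf' j.succ)
        (mul_pos (by exact_mod_cast Nat.pos_of_ne_zero hf0) hκ) hb.2 hb2 hl.symm
      obtain rfl : s = s' := congrArg Sigma.fst key
      have key := eq_of_heq (Sigma.mk.inj key).2
      simp only [Prod.mk.injEq] at key
      obtain ⟨k1, k2, k3⟩ := key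
      have e1 : f = f' := by
        ext j
        cases j using Fin.cases with
        | zero => exact hff
        | succ j => exact congrFun k1 j
      obtain ⟨a, ha⟩ := hS
      -- The parent is the label that a least coordinate receives after peeling; this needs the
      -- least set to be nonempty.
      have e2 : q.1 = q'.1 := by
        have := congrFun k3 a
        rwa [peel_of_zero _ ha, peel_of_zero _ (hSS ▸ ha : a ∈ leastSet ν')] at this
      have e3 : ν = ν' := by
        ext1 i
        by_cases hi : i ∈ leastSet ν
        · rw [mem_leastSet.1 hi, mem_leastSet.1 (hSS ▸ hi : i ∈ leastSet ν')]
        · refine eq_of_peel_eq (p := q.1) hi (fun hi' => hi (hSS ▸ hi')) ?_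
          rw [congrFun k3 i, e2]
      rw [e1, e3, show q = q' from Prod.ext e2 k2]

end

/-! ### Classification of stepped lattices. -/

section

variable {I : Type*}

/-- The hypothesis says that ⌊f n a⌋ and ⌊f n b⌋ agree modulo f. Since f a and f b are below 1, each
floor grows by 0 or 1 as n increases by 1, so congruence modulo f ≥ 2 forces equality for all n.
Then n f |a - b| < 1 for every n. -/
theorem eq_of_floor_mul_fract_eq {f : ℕ} (hf : 2 ≤ f) {a b : ℝ} (ha : 0 ≤ a) (hb : 0 ≤ b)
    (ha' : f * a < 1) (hb' : f * b < 1)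
    (h : ∀ n : ℕ, ⌊(f : ℝ) * Int.fract (n * a)⌋ = ⌊(f : ℝ) * Int.fract (n * b)⌋) : a = b := by
  have hfl : ∀ t : ℝ, ⌊(f : ℝ) * Int.fract t⌋ = ⌊(f : ℝ) * t⌋ - f * ⌊t⌋ := fun t => by
    rw [← Int.floor_sub_intCast, Int.fract]
    congr 1
    push_cast
    ring
  have hstep : ∀ (t : ℝ) (n : ℕ), 0 ≤ t → f * t < 1 →
      ⌊(f : ℝ) * (n * t)⌋ ≤ ⌊(f : ℝ) * ((n + 1 : ℕ) * t)⌋ ∧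
      ⌊(f : ℝ) * ((n + 1 : ℕ) * t)⌋ ≤ ⌊(f : ℝ) * (n * t)⌋ + 1 := fun t n h0 h1 => by
    have h2 : 0 ≤ f * t := by positivity
    refine ⟨Int.floor_mono ?_, ?_⟩
    · push_cast
      nlinarith
    · rw [← Int.floor_add_one]
      refine Int.floor_mono ?_
      push_cast
      nlinarith
  have key : ∀ n : ℕ, ⌊(f : ℝ) * (n * a)⌋ = ⌊(f : ℝ) * (n * b)⌋ := by
    intro n
    induction n with
    | zero => simp
    | succ n ih =>
      have h1 := h (n + 1)
      rw [hfl, hfl] at h1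
      obtain ⟨a1, a2⟩ := hstep a n ha ha'
      obtain ⟨b1, b2⟩ := hstep b n hb hb'
      have h2 : ⌊(f : ℝ) * ((n + 1 : ℕ) * a)⌋ - ⌊(f : ℝ) * ((n + 1 : ℕ) * b)⌋ =
          f * (⌊((n + 1 : ℕ) : ℝ) * a⌋ - ⌊((n + 1 : ℕ) : ℝ) * b⌋) := by linarith
      have h3 : (f : ℤ) ∣ ⌊(f : ℝ) * ((n + 1 : ℕ) * a)⌋ - ⌊(f : ℝ) * ((n + 1 : ℕ) * b)⌋ :=
        ⟨_, h2⟩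
      have h4 := Int.eq_zero_of_abs_lt_dvd h3 (by rw [abs_lt]; omega)
      omega
  by_contra hab
  have hd : 0 < |a - b| := abs_pos.2 (sub_ne_zero.2 hab)
  obtain ⟨n, hn⟩ := exists_nat_gt (1 / |a - b|)
  rw [div_lt_iff₀ hd] at hn
  have h1 := Int.abs_sub_lt_one_of_floor_eq_floor (key n)
  rw [← mul_sub, ← mul_sub, abs_mul, abs_mul, Nat.abs_cast, Nat.abs_cast] at h1
  have hf' : (2 : ℝ) ≤ f := by exact_mod_cast hf
  nlinarith

section

variable {f : ℕ} {S : Set I} {L : AddSubgroup (I → ℝ)}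

theorem add_smul_unitVec_mem_unitBox (hf : 2 ≤ f) {y : I → ℝ} (hb : y ∈ unitBox I)
    (hy : ∀ i ∈ S, f * y i < 1) {c : ℕ} (hc : c < f) :
    y + (c : ℝ) • unitVec S f ∈ unitBox I := by
  have hf0 : (0 : ℝ) < f := by exact_mod_cast (by omega : 0 < f)
  have hcf : (c : ℝ) + 1 ≤ f := by exact_mod_cast hc
  intro i
  simp only [Pi.add_apply, Pi.smul_apply, smul_eq_mul]
  by_cases h : i ∈ S
  · rw [unitVec_of_mem h]
    have := (hb i).1
    refine ⟨by positivity, ?_⟩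
    have h1 := hy i h
    rw [mul_one_div, ← sub_pos]
    have : 1 - (y i + c / f) = (f - f * y i - c) / f := by field_simp; ring
    rw [this]
    exact div_pos (by linarith) hf0
  · rw [unitVec_of_notMem h]
    simpa using hb i

theorem mul_unitVec_notMem_intReal (hS : S.Nonempty) {c : ℕ} (hc : 0 < c) (hcf : c < f) :
    ∃ a, (c : ℝ) * unitVec S f a ∉ intReal := by
  obtain ⟨a, ha⟩ := hS
  refine ⟨a, fun h => ?_⟩
  have hf0 : (0 : ℝ) < f := by exact_mod_cast (by omega : 0 < f)
  have hc0 : (0 : ℝ) < c := by exact_mod_cast hc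
  have hcf' : (c : ℝ) < f := by exact_mod_cast hcf
  rw [unitVec_of_mem ha, mul_one_div] at h
  have h1 : (0 : ℝ) < c / f := by positivity
  exact h1.ne' (eq_zero_of_mem_intReal h (by linarith) ((div_lt_one hf0).2 hcf'))

theorem natCast_smul_unitVec_mem_stdLattice (hf : f ≠ 0) (S : Set I) (c : ℤ) (i : I) :
    ((f : ℝ) * c) * unitVec S f i ∈ intReal := by
  have hf0 : (f : ℝ) ≠ 0 := by exact_mod_cast hf
  by_cases h : i ∈ S
  · rw [unitVec_of_mem h]
    have : (f : ℝ) * c * (1 / f) = c := by field_simp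
    rw [this]
    exact intCast_mem_intReal c
  · rw [unitVec_of_notMem h, mul_zero]
    exact intReal.zero_mem

theorem scaleOn_mem_unitBox {y : I → ℝ} (hyb : y ∈ unitBox I) (hlow : ∀ i ∈ S, f * y i < 1) :
    scaleOn S f y ∈ unitBox I := by
  intro i
  by_cases hi : i ∈ S
  · rw [scaleOn_of_mem hi]
    exact ⟨mul_nonneg (Nat.cast_nonneg f) (hyb i).1, hlow i hi⟩
  · rw [scaleOn_of_notMem hi]
    exact hyb i

/-- If the scalings of `x` and `y` agree modulo ℤ, then `x - y` is integral off `S` and, by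
constancy, equals n/f modulo ℤ on `S` for one integer n; a multiple of `unitVec S f` accounts for
it. -/
theorem eq_constOn_inf_comap (hL : stdLattice I ≤ L) (hf : f ≠ 0) (hS : S.Nonempty)
    (hc : L ≤ constOn S) (he : unitVec S f ∈ L) :
    constOn S ⊓ (pushLattice S f L).comap (scaleOn S f) = L := by
  have hf0 : (f : ℝ) ≠ 0 := by exact_mod_cast hf
  ext x
  constructor
  · rintro ⟨hx1, hx2⟩
    obtain ⟨y, hy, hxy⟩ := mem_pushLattice.1 (AddSubgroup.mem_comap.1 hx2)
    obtain ⟨a, ha⟩ := hS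
    have h1 := hxy a
    rw [scaleOn_of_mem ha, scaleOn_of_mem ha] at h1
    obtain ⟨n, hn⟩ := mem_intReal.1 h1
    refine mem_of_sub_mem_stdLattice hL (y := y + n • unitVec S f) (fun i => ?_)
      (L.add_mem hy (L.zsmul_mem he n))
    change x i - (y i + n • unitVec S f i) ∈ intReal
    rw [zsmul_eq_mul]
    by_cases hi : i ∈ S
    · rw [unitVec_of_mem hi]
      have h2 := intReal.sub_mem (hx1 i hi a ha) (hc hy i hi a ha)
      convert h2 using 1
      rw [hn]
      field_simp
      ring
    · rw [unitVec_of_notMem hi]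
      have h2 := hxy i
      rw [scaleOn_of_notMem hi, scaleOn_of_notMem hi] at h2
      simpa using h2
  · intro hx
    exact ⟨hc hx, mem_pushLattice.2 ⟨x, hx, fun i => by simp [intReal.zero_mem]⟩⟩

open Classical in
/-- Add a new least node, labelling the coordinates in `S`. -/
noncomputable def extendLabel {s : ℕ} (S : Set I) (ν : I → Option (Fin s)) (i : I) :
    Option (Fin (s + 1)) := if i ∈ S then some 0 else (ν i).map Fin.succ

theorem leastSet_extendLabel {s : ℕ} (S : Set I) (ν : I → Option (Fin s)) :
    leastSet (extendLabel S ν) = S := by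
  ext i
  rw [mem_leastSet, extendLabel]
  by_cases h : i ∈ S
  · simp [h]
  · rcases hν : ν i with _ | j <;> simp [h]

theorem peel_extendLabel {s : ℕ} {S : Set I} {ν : I → Option (Fin s)} {p : Option (Fin s)}
    (hp : ∀ i ∈ S, ν i = p) : peel p (extendLabel S ν) = ν := by
  ext1 i
  by_cases h : i ∈ S
  · rw [peel_of_zero _ (by simp [extendLabel, h]), hp i h]
  · rcases hν : ν i with _ | j
    · rw [peel_of_none _ (by simp [extendLabel, h, hν])]
    · rw [peel_of_succ (j := j) _ (by simp [extendLabel, h, hν])]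

end

variable [Fintype I]

/-- `x` is the vector of `L` in the half-open unit cube with weight `κ * n`. -/
structure HasIndex (α : I → ℝ) (κ : ℝ) (L : AddSubgroup (I → ℝ)) (x : I → ℝ) (n : ℕ) : Prop where
  mem : x ∈ L
  box : x ∈ unitBox I
  weight : α ⬝ᵥ x = κ * n

section Index

variable {α : I → ℝ} {κ : ℝ} {v : ℕ} {L : AddSubgroup (I → ℝ)} {x y : I → ℝ} {m n : ℕ}

theorem HasIndex.index_unique (hκ : 0 < κ) (hx : HasIndex α κ L x m) (hy : HasIndex α κ L x n) :
    m = n := by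
  have := hx.weight.symm.trans hy.weight
  exact_mod_cast mul_left_cancel₀ hκ.ne' this

theorem Stepped.exists_hasIndex (h : Stepped α κ v L) (hx : x ∈ L) (hb : x ∈ unitBox I) :
    ∃ n, HasIndex α κ L x n :=
  let ⟨n, _, hn⟩ := h.exists_index x hx hb
  ⟨n, hx, hb, hn⟩

theorem Stepped.index_lt (h : Stepped α κ v L) (hκ : 0 < κ) (hx : HasIndex α κ L x n) :
    n < v := by
  obtain ⟨m, hm, hm'⟩ := h.exists_index x hx.mem hx.box
  rwa [hx.index_unique hκ ⟨hx.mem, hx.box, hm'⟩]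

theorem Stepped.eq_of_hasIndex (h : Stepped α κ v L) (hx : HasIndex α κ L x n)
    (hy : HasIndex α κ L y n) : x = y :=
  h.injOn x hx.mem hx.box y hy.mem hy.box (hx.weight.trans hy.weight.symm)

/-- Reducing modulo ℤ lowers some coordinate by at least 1 and raises none, so positive weights make
the index drop strictly. This descent drives the whole classification. -/
theorem HasIndex.carry (h : Stepped α κ v L) (hL : stdLattice I ≤ L) (hα : ∀ i, 0 < α i)
    (hκ : 0 < κ) (hx : HasIndex α κ L x m) (hy : HasIndex α κ L y n) (hb : x + y ∉ unitBox I) :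
    ∃ j < m + n, HasIndex α κ L (fun i => Int.fract ((x + y) i)) j := by
  obtain ⟨j, hj⟩ := h.exists_hasIndex (fract_mem_of_mem hL (L.add_mem hx.mem hy.mem))
    (fract_mem_unitBox _)
  refine ⟨j, ?_, hj⟩
  have hn : ∀ i, 0 ≤ (x + y) i := fun i => add_nonneg (hx.box i).1 (hy.box i).1
  obtain ⟨a, ha⟩ : ∃ a, 1 ≤ (x + y) a := by
    by_contra! hcon
    exact hb fun i => ⟨hn i, hcon i⟩
  have hlt : α ⬝ᵥ (fun i => Int.fract ((x + y) i)) < α ⬝ᵥ (x + y) := by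
    refine Finset.sum_lt_sum (fun i _ => ?_) ⟨a, Finset.mem_univ _, ?_⟩
    · have : (0 : ℝ) ≤ ⌊(x + y) i⌋ := by exact_mod_cast Int.floor_nonneg.2 (hn i)
      refine mul_le_mul_of_nonneg_left ?_ (hα i).le
      change Int.fract ((x + y) i) ≤ _
      linarith [Int.self_sub_floor ((x + y) i)]
    · exact mul_lt_mul_of_pos_left (lt_of_lt_of_le (Int.fract_lt_one _) ha) (hα a)
  rw [hj.weight, dotProduct_add, hx.weight, hy.weight, ← mul_add] at hlt
  have := lt_of_mul_lt_mul_left hlt hκ.le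
  exact_mod_cast this

end Index

section Classification

variable {α : I → ℝ} {κ : ℝ} {v : ℕ} {L : AddSubgroup (I → ℝ)}

/-- Let (g+1)x be the first multiple of the index-1 vector x to leave the cube. Its reduction has an
index j ≤ g, hence equals j x, and (g+1-j)x is integral. Minimality forces j = 0, so every nonzero
entry of x is 1/(g+1). -/
theorem Stepped.exists_unitVec (h : Stepped α κ v L) (hL : stdLattice I ≤ L) (hα : ∀ i, 0 < α i)
    (hκ : 0 < κ) (hv : 2 ≤ v) : ∃ (f : ℕ) (S : Set I), 2 ≤ f ∧ S.Nonempty ∧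
    HasIndex α κ L (unitVec S f) 1 := by
  obtain ⟨x, hx, hb, hw⟩ := h.exists_mem 1 (by omega)
  have hx1 : HasIndex α κ L x 1 := ⟨hx, hb, hw⟩
  obtain ⟨a, ha⟩ : ∃ a, 0 < x a := by
    by_contra! hcon
    have : x = 0 := by
      ext i
      exact le_antisymm (hcon i) (hb i).1
    rw [this, dotProduct_zero] at hw
    simp only [Nat.cast_one, mul_one] at hw
    exact hκ.ne hw
  have hex : ∃ n : ℕ, (n : ℝ) • x ∉ unitBox I := by
    obtain ⟨n, hn⟩ := exists_nat_gt (1 / x a)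
    rw [div_lt_iff₀ ha] at hn
    exact ⟨n, fun hcon => absurd (hcon a).2 (by simpa using hn.le)⟩
  classical
  have hmin : ∀ n < Nat.find hex, (n : ℝ) • x ∈ unitBox I := fun n hn =>
    not_not.1 (Nat.find_min hex hn)
  have hspec := Nat.find_spec hex
  obtain ⟨g, hg⟩ : ∃ g, Nat.find hex = g + 1 := by
    refine Nat.exists_eq_succ_of_ne_zero fun h0 => hspec ?_
    rw [h0]
    intro i
    simp
  rw [hg] at hmin hspec
  have hg1 : 1 ≤ g := by
    by_contra! hcon
    have : g = 0 := by omega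
    apply hspec
    simpa [this] using hb
  have hidx : ∀ n ≤ g, HasIndex α κ L ((n : ℝ) • x) n := fun n hn =>
    ⟨by rw [Nat.cast_smul_eq_nsmul]; exact L.nsmul_mem hx n, hmin n (by omega), by
      rw [dotProduct_smul, hw]; simp [mul_comm]⟩
  have hsum : ((g + 1 : ℕ) : ℝ) • x = (g : ℝ) • x + x := by
    push_cast
    rw [add_smul, one_smul]
  rw [hsum] at hspec
  obtain ⟨j, hj, hj'⟩ := HasIndex.carry h hL hα hκ (hidx g le_rfl) hx1 hspec
  have hjx := h.eq_of_hasIndex hj' (hidx j (by omega))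
  have hint : ∀ i, ((g + 1 : ℕ) - j : ℝ) * x i ∈ intReal := fun i => by
    have h1 := sub_fract_mem_intReal (((g : ℝ) • x + x) i)
    have h2 := congrFun hjx i
    rw [h2, ← hsum] at h1
    simpa [sub_mul] using h1
  have hj0 : j = 0 := by
    by_contra hne
    have hpos : (0 : ℝ) < ((g + 1 - j : ℕ) : ℝ) := by exact_mod_cast (by omega : 0 < g + 1 - j)
    have h1 := hint a
    rw [← Nat.cast_sub (by omega)] at h1
    have h2 := (hmin (g + 1 - j) (by omega) a).2
    simp only [Pi.smul_apply, smul_eq_mul] at h2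
    have := eq_zero_of_mem_intReal h1 (by have := mul_pos hpos ha; linarith) h2
    exact (mul_pos hpos ha).ne' this
  rw [hj0] at hint
  simp only [Nat.cast_zero, sub_zero] at hint
  -- The integer (g+1) x_i is positive, and it is less than 2 because both g x_i and x_i are less
  -- than 1.
  have hval : ∀ i, x i ≠ 0 → ((g + 1 : ℕ) : ℝ) * x i = 1 := fun i hi => by
    have h1 : 0 < x i := lt_of_le_of_ne (hb i).1 hi.symm
    have h2 := (hmin g (by omega) i).2
    have h3 := (hb i).2
    simp only [Pi.smul_apply, smul_eq_mul] at h2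
    have h4 := intReal.sub_mem (hint i) one_mem_intReal
    have := eq_zero_of_mem_intReal h4 (by have : (0 : ℝ) < (g + 1 : ℕ) := by positivity
                                          nlinarith) (by push_cast; linarith)
    linarith
  refine ⟨g + 1, {i | x i ≠ 0}, by omega, ⟨a, ha.ne'⟩, ?_⟩
  convert hx1
  ext i
  by_cases hi : x i = 0
  · rw [unitVec_of_notMem (by simpa using hi), hi]
  · rw [unitVec_of_mem (by simpa using hi), div_eq_iff (by positivity), mul_comm, hval i hi]

variable {f : ℕ} {S : Set I}

theorem HasIndex.add_smul_unitVec (he : HasIndex α κ L (unitVec S f) 1) {y : I → ℝ} {n : ℕ}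
    (hy : HasIndex α κ L y n) {c : ℕ} (hb : y + (c : ℝ) • unitVec S f ∈ unitBox I) :
    HasIndex α κ L (y + (c : ℝ) • unitVec S f) (n + c) :=
  ⟨L.add_mem hy.mem (by rw [Nat.cast_smul_eq_nsmul]; exact L.nsmul_mem he.mem c), hb, by
    rw [dotProduct_add, dotProduct_smul, hy.weight, he.weight]; push_cast; simp; ring⟩

/-- Take `y` of least index in the class of `z` modulo ℤ and multiples of e = `unitVec S f`. Then y
+ d e stays in the cube for all d < f, and d = f - 1 gives f y_i < 1 on `S`. -/
theorem Stepped.exists_low (h : Stepped α κ v L) (hL : stdLattice I ≤ L) (hα : ∀ i, 0 < α i)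
    (hκ : 0 < κ) (hf : 2 ≤ f) (hS : S.Nonempty) (he : HasIndex α κ L (unitVec S f) 1)
    {z : I → ℝ} (hz : z ∈ L) (hzb : z ∈ unitBox I) :
    ∃ y ∈ L, y ∈ unitBox I ∧ (∀ i ∈ S, f * y i < 1) ∧ ∃ c < f,
      z = y + (c : ℝ) • unitVec S f := by
  classical
  have hf0 : (0 : ℝ) < f := by exact_mod_cast (by omega : 0 < f)
  have hex : ∃ n, ∃ y, HasIndex α κ L y n ∧
      ∃ c : ℤ, ∀ i, z i - (y i + c * unitVec S f i) ∈ intReal := by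
    obtain ⟨n, hn⟩ := h.exists_hasIndex hz hzb
    exact ⟨n, z, hn, 0, fun i => by simp [intReal.zero_mem]⟩
  obtain ⟨y, hy, c, hc⟩ := Nat.find_spec hex
  set n := Nat.find hex with hn
  -- On leaving the cube at d + 1, the reduced vector has index below n + d + 1 and, by minimality,
  -- at least n. By uniqueness it is y + r e with r ≤ d, so (d + 1 - r) e would be integral although
  -- 0 < d + 1 - r < f.
  have hbox : ∀ d : ℕ, d < f → ∀ d' ≤ d, y + (d' : ℝ) • unitVec S f ∈ unitBox I := by
    intro d
    induction d with
    | zero =>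
      intro _ d' hd'
      obtain rfl : d' = 0 := by omega
      simpa using hy.box
    | succ d ih =>
      intro hd d' hd'
      have ih := ih (by omega)
      rcases Nat.lt_or_eq_of_le hd' with hlt | rfl
      · exact ih d' (by omega)
      have hsum : y + ((d + 1 : ℕ) : ℝ) • unitVec S f =
          (y + (d : ℝ) • unitVec S f) + unitVec S f := by
        push_cast
        rw [add_smul, one_smul, add_assoc]
      by_contra hcon
      rw [hsum] at hcon
      obtain ⟨j, hj, hj'⟩ := HasIndex.carry h hL hα hκ
        (he.add_smul_unitVec hy (ih d le_rfl)) he hcon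
      have hfr := fun i => sub_fract_mem_intReal (((y + (d : ℝ) • unitVec S f) + unitVec S f) i)
      have hnj : n ≤ j := by
        refine Nat.find_min' hex ⟨_, hj', c - (d + 1), fun i => ?_⟩
        have := intReal.add_mem (hc i) (hfr i)
        convert this using 1
        simp only [Pi.add_apply, Pi.smul_apply, smul_eq_mul]
        push_cast
        ring
      obtain ⟨r, rfl⟩ := Nat.exists_eq_add_of_le hnj
      have hr := he.add_smul_unitVec hy (ih r (by omega))
      have heq := h.eq_of_hasIndex hj' hr
      obtain ⟨a, ha⟩ := mul_unitVec_notMem_intReal (f := f) hS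
        (c := d + 1 - r) (by omega) (by omega)
      refine ha ?_
      have h1 := hfr a
      rw [congrFun heq a] at h1
      rw [Nat.cast_sub (by omega)]
      convert h1 using 1
      simp
      ring
  have hlow : ∀ i ∈ S, f * y i < 1 := fun i hi => by
    have := (hbox (f - 1) (by omega) (f - 1) le_rfl i).2
    simp only [Pi.add_apply, Pi.smul_apply, smul_eq_mul] at this
    rw [unitVec_of_mem hi, Nat.cast_sub (by omega)] at this
    have h2 : y i + ((f : ℝ) - (1 : ℕ)) * (1 / f) = (f * y i - 1) / f + 1 := by
      field_simp
      push_cast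
      ring
    rw [h2] at this
    have h3 : (f * y i - 1) / f < 0 := by linarith
    rw [div_lt_iff₀ hf0] at h3
    linarith
  have hfz : (0 : ℤ) < f := by omega
  have hcm0 := Int.emod_nonneg c hfz.ne'
  have hcm1 := Int.emod_lt_of_pos c hfz
  obtain ⟨r, hr⟩ := Int.eq_ofNat_of_zero_le hcm0
  have hrf : r < f := by omega
  refine ⟨y, hy.mem, hy.box, hlow, r, hrf, ?_⟩
  have hyr := add_smul_unitVec_mem_unitBox hf hy.box hlow hrf
  ext i
  refine eq_of_sub_mem_intReal (hzb i) (hyr i) ?_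
  have h1 := intReal.add_mem (hc i)
    (natCast_smul_unitVec_mem_stdLattice (by omega : f ≠ 0) S (c / f) i)
  convert h1 using 1
  have h2 : (c : ℝ) = f * ((c / f : ℤ) : ℝ) + r := by
    have := Int.mul_ediv_add_emod c f
    rw [hr] at this
    exact_mod_cast this.symm
  simp only [Pi.add_apply, Pi.smul_apply, smul_eq_mul]
  rw [h2]
  ring

/-- If n had remainder r > 0 modulo f, induction would show that the vector of index n - r is itself
low. Adding r copies of `unitVec S f` gives the vector of index n, whose entries on `S` are at least
r/f, so it is not low. -/
theorem Stepped.dvd_index_of_low (h : Stepped α κ v L) (hL : stdLattice I ≤ L)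
    (hα : ∀ i, 0 < α i) (hκ : 0 < κ) (hf : 2 ≤ f) (hS : S.Nonempty)
    (he : HasIndex α κ L (unitVec S f) 1) : ∀ (n : ℕ) {y : I → ℝ}, HasIndex α κ L y n →
    (∀ i ∈ S, f * y i < 1) → f ∣ n := by
  intro n
  induction n using Nat.strong_induction_on with
  | _ n ih =>
    intro y hy hlow
    by_contra hdvd
    have hf0 : (0 : ℝ) < f := by exact_mod_cast (by omega : 0 < f)
    have hr : 0 < n % f := Nat.pos_of_ne_zero fun h0 => hdvd (Nat.dvd_of_mod_eq_zero h0)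
    have hdm := Nat.div_add_mod n f
    have hrf : n % f < f := Nat.mod_lt _ (by omega)
    obtain ⟨z, hz, hzb, hzw⟩ := h.exists_mem (f * (n / f))
      (lt_of_le_of_lt (by omega) (h.index_lt hκ hy))
    obtain ⟨y', hy', hyb', hlow', c, hc, rfl⟩ := h.exists_low hL hα hκ hf hS he hz hzb
    obtain ⟨n', hn'⟩ := h.exists_hasIndex hy' hyb'
    have h1 := (he.add_smul_unitVec hn' hzb).index_unique hκ ⟨hz, hzb, hzw⟩
    have h2 := ih n' (by omega) hn' hlow'
    have h3 : f ∣ c := (Nat.dvd_add_right h2).1 ⟨_, h1⟩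
    have h4 : c = 0 := Nat.eq_zero_of_dvd_of_lt h3 hc
    have h5 : n' + n % f = n := by omega
    have h6 := he.add_smul_unitVec hn' (add_smul_unitVec_mem_unitBox hf hyb' hlow' hrf)
    rw [h5] at h6
    obtain ⟨a, ha⟩ := hS
    have h7 := hlow a ha
    rw [h.eq_of_hasIndex hy h6] at h7
    simp only [Pi.add_apply, Pi.smul_apply, smul_eq_mul] at h7
    rw [unitVec_of_mem ha, mul_add, mul_one_div, mul_div_cancel₀ _ hf0.ne'] at h7
    have h8 : (1 : ℝ) ≤ (n % f : ℕ) := by exact_mod_cast hr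
    nlinarith [(hyb' a).1]

/-- For low `y`, reduce each multiple n y to a low vector plus c copies of `unitVec S f`. Then ⌊f ·
fract(n y_i)⌋ = c for every i in `S`, and `eq_of_floor_mul_fract_eq` makes `y` constant there.
General vectors reduce to low ones. -/
theorem Stepped.le_constOn (h : Stepped α κ v L) (hL : stdLattice I ≤ L)
    (hα : ∀ i, 0 < α i) (hκ : 0 < κ) (hf : 2 ≤ f) (hS : S.Nonempty)
    (he : HasIndex α κ L (unitVec S f) 1) : L ≤ constOn S := by
  have hf0 : (0 : ℝ) < f := by exact_mod_cast (by omega : 0 < f)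
  have hlowc : ∀ y ∈ L, y ∈ unitBox I → (∀ i ∈ S, f * y i < 1) → ∀ i ∈ S, ∀ j ∈ S,
      y i = y j := by
    intro y hy hyb hlow i hi j hj
    refine eq_of_floor_mul_fract_eq hf (hyb i).1 (hyb j).1 (hlow i hi) (hlow j hj) fun n => ?_
    obtain ⟨y', hy', hyb', hlow', c, hc, hyc⟩ := h.exists_low hL hα hκ hf hS he
      (fract_mem_of_mem hL (L.nsmul_mem hy n)) (fract_mem_unitBox _)
    have hfl : ∀ i ∈ S, ⌊(f : ℝ) * Int.fract (n * y i)⌋ = c := fun i hi => by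
      have h1 := congrFun hyc i
      simp only [Pi.add_apply, Pi.smul_apply, smul_eq_mul, nsmul_eq_mul] at h1
      rw [unitVec_of_mem hi] at h1
      rw [h1, mul_add, mul_one_div, mul_div_cancel₀ _ hf0.ne', Int.floor_eq_iff]
      have := mul_nonneg hf0.le (hyb' i).1
      have := hlow' i hi
      push_cast
      constructor <;> linarith
    rw [hfl i hi, hfl j hj]
  intro x hx i hi j hj
  obtain ⟨y, hy, hyb, hlow, c, hc, hyc⟩ := h.exists_low hL hα hκ hf hS he
    (fract_mem_of_mem hL hx) (fract_mem_unitBox _)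
  have h1 : Int.fract (x i) = Int.fract (x j) := by
    have h1 := congrFun hyc i
    have h2 := congrFun hyc j
    simp only [Pi.add_apply, Pi.smul_apply, smul_eq_mul] at h1 h2
    rw [h1, h2, unitVec_of_mem hi, unitVec_of_mem hj, hlowc y hy hyb hlow i hi j hj]
  have h2 := sub_fract_mem_intReal (x i)
  rw [h1] at h2
  exact sub_mem_intReal_trans h2 (sub_mem_intReal_symm (sub_fract_mem_intReal (x j)))

theorem Stepped.pushLattice_box (h : Stepped α κ v L) (hL : stdLattice I ≤ L)
    (hα : ∀ i, 0 < α i) (hκ : 0 < κ) (hf : 2 ≤ f) (hS : S.Nonempty)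
    (he : HasIndex α κ L (unitVec S f) 1) {w : I → ℝ} (hw : w ∈ pushLattice S f L)
    (hb : w ∈ unitBox I) :
    ∃ y ∈ L, y ∈ unitBox I ∧ (∀ i ∈ S, f * y i < 1) ∧ w = scaleOn S f y := by
  have hf0 : (0 : ℝ) < f := by exact_mod_cast (by omega : 0 < f)
  obtain ⟨x, hx, hxw⟩ := mem_pushLattice.1 hw
  obtain ⟨y, hy, hyb, hlow, c, hc, hyc⟩ := h.exists_low hL hα hκ hf hS he
    (fract_mem_of_mem hL hx) (fract_mem_unitBox _)
  refine ⟨y, hy, hyb, hlow, ?_⟩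
  ext i
  have h1 := hxw i
  have h2 := congrFun hyc i
  have h3 := sub_fract_mem_intReal (x i)
  rw [h2] at h3
  simp only [Pi.add_apply, Pi.smul_apply, smul_eq_mul] at h3
  by_cases hi : i ∈ S
  · rw [scaleOn_of_mem hi] at h1 ⊢
    refine eq_of_sub_mem_intReal (hb i) ⟨mul_nonneg hf0.le (hyb i).1, hlow i hi⟩
      (sub_mem_intReal_trans h1 ?_)
    rw [unitVec_of_mem hi] at h3
    have h4 := intReal.add_mem (intReal_mul_mem (natCast_mem_intReal f) h3)
      (natCast_mem_intReal c)
    convert h4 using 1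
    field_simp
    ring
  · rw [scaleOn_of_notMem hi] at h1 ⊢
    rw [unitVec_of_notMem hi, mul_zero, add_zero] at h3
    exact eq_of_sub_mem_intReal (hb i) (hyb i) (sub_mem_intReal_trans h1 h3)

theorem dotProduct_scaleOn_inv_scaleOn (hf : (f : ℝ) ≠ 0) (y : I → ℝ) :
    scaleOn S (f : ℝ)⁻¹ α ⬝ᵥ scaleOn S f y = α ⬝ᵥ y := by
  rw [← dotProduct_scaleOn, scaleOn_inv_scaleOn _ hf]

/-- Split the vector of top index v - 1 as a low vector of index n plus c copies. Since f - 1 copies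
also fit in the cube, c = f - 1 and v = n + f, where f divides n. -/
theorem Stepped.dvd (h : Stepped α κ v L) (hL : stdLattice I ≤ L)
    (hα : ∀ i, 0 < α i) (hκ : 0 < κ) (hv : 1 ≤ v) (hf : 2 ≤ f) (hS : S.Nonempty)
    (he : HasIndex α κ L (unitVec S f) 1) : f ∣ v := by
  obtain ⟨z, hz, hzb, hzw⟩ := h.exists_mem (v - 1) (by omega)
  obtain ⟨y, hy, hyb, hlow, c, hc, rfl⟩ := h.exists_low hL hα hκ hf hS he hz hzb
  obtain ⟨n, hn⟩ := h.exists_hasIndex hy hyb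
  have h1 := (he.add_smul_unitVec hn hzb).index_unique hκ ⟨hz, hzb, hzw⟩
  have h2 := h.index_lt hκ (he.add_smul_unitVec hn
    (add_smul_unitVec_mem_unitBox hf hyb hlow (by omega : f - 1 < f)))
  have h3 : v = n + f := by omega
  rw [h3]
  exact (h.dvd_index_of_low hL hα hκ hf hS he n hn hlow).add dvd_rfl

/-- Cube vectors of the pushed lattice are the scaled low vectors. The low vectors are those with
index divisible by f, and dividing the weights on `S` by f makes scaling preserve total weight. -/
theorem Stepped.pushLattice (h : Stepped α κ v L) (hL : stdLattice I ≤ L)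
    (hα : ∀ i, 0 < α i) (hκ : 0 < κ) (hf : 2 ≤ f) (hS : S.Nonempty)
    (he : HasIndex α κ L (unitVec S f) 1) (hfv : f ∣ v) :
    Stepped (scaleOn S (f : ℝ)⁻¹ α) (f * κ) (v / f) (pushLattice S f L) := by
  have hf0 : (f : ℝ) ≠ 0 := by exact_mod_cast (by omega : f ≠ 0)
  refine ⟨fun w hw hb => ?_, fun q hq => ?_, fun w hw hb w' hw' hb' hww => ?_⟩
  · obtain ⟨y, hy, hyb, hlow, rfl⟩ := h.pushLattice_box hL hα hκ hf hS he hw hb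
    obtain ⟨n, hn⟩ := h.exists_hasIndex hy hyb
    obtain ⟨q, rfl⟩ := h.dvd_index_of_low hL hα hκ hf hS he n hn hlow
    refine ⟨q, ?_, ?_⟩
    · rw [Nat.lt_div_iff_mul_lt' hfv]
      exact h.index_lt hκ hn
    · rw [dotProduct_scaleOn_inv_scaleOn hf0, hn.weight]
      push_cast
      ring
  · have hq' : f * q < v := (Nat.lt_div_iff_mul_lt' hfv q).1 hq
    obtain ⟨z, hz, hzb, hzw⟩ := h.exists_mem (f * q) hq'
    obtain ⟨y, hy, hyb, hlow, c, hc, rfl⟩ := h.exists_low hL hα hκ hf hS he hz hzb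
    obtain ⟨n, hn⟩ := h.exists_hasIndex hy hyb
    have h1 := (he.add_smul_unitVec hn hzb).index_unique hκ ⟨hz, hzb, hzw⟩
    have h2 := h.dvd_index_of_low hL hα hκ hf hS he n hn hlow
    have h3 : c = 0 := Nat.eq_zero_of_dvd_of_lt ((Nat.dvd_add_right h2).1 ⟨_, h1⟩) hc
    refine ⟨scaleOn S f y, mem_pushLattice.2 ⟨y, hy, fun i => by simp [intReal.zero_mem]⟩,
      scaleOn_mem_unitBox hyb hlow, ?_⟩
    rw [dotProduct_scaleOn_inv_scaleOn hf0, hn.weight, show n = f * q by omega]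
    push_cast
    ring
  · obtain ⟨y, hy, hyb, hlow, rfl⟩ := h.pushLattice_box hL hα hκ hf hS he hw hb
    obtain ⟨y', hy', hyb', hlow', rfl⟩ := h.pushLattice_box hL hα hκ hf hS he hw' hb'
    rw [dotProduct_scaleOn_inv_scaleOn hf0, dotProduct_scaleOn_inv_scaleOn hf0] at hww
    rw [h.injOn y hy hyb y' hy' hyb' hww]

/-- Strong induction on `v`: remove the index-1 vector, apply the hypothesis to the pushed lattice
for `v / f`, and put `S` back as the new least node. -/
theorem exists_forest : ∀ (v : ℕ) {L : AddSubgroup (I → ℝ)} {α : I → ℝ} {κ : ℝ},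
    stdLattice I ≤ L → (∀ i, 0 < α i) → 0 < κ → 1 ≤ v → Stepped α κ v L →
    ∃ (s : ℕ) (f : Fin s → ℕ) (q : Par s) (ν : I → Option (Fin s)), (∀ j, 2 ≤ f j) ∧
      ∏ j, f j = v ∧ Balanced f q ν α κ ∧ forestLattice f q ν = L := by
  intro v
  induction v using Nat.strong_induction_on with
  | _ v ih =>
    intro L α κ hL hα hκ hv h
    rcases Nat.lt_or_ge 1 v with hv2 | hv1
    · obtain ⟨f, S, hf, hS, he⟩ := h.exists_unitVec hL hα hκ hv2
      have hf0 : (0 : ℝ) < f := by exact_mod_cast (by omega : 0 < f)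
      have hfv := h.dvd hL hα hκ hv hf hS he
      have hc := h.le_constOn hL hα hκ hf hS he
      obtain ⟨s, f1, q, ν, hf1, hprod, hbal, hlat⟩ := ih (v / f)
        (Nat.div_lt_self (by omega) (by omega)) (L := pushLattice S f L)
        le_sup_right
        (α := scaleOn S (f : ℝ)⁻¹ α) (κ := f * κ) (fun i => by
          by_cases hi : i ∈ S
          · rw [scaleOn_of_mem hi]
            have := hα i
            positivity
          · rw [scaleOn_of_notMem hi]
            exact hα i) (by positivity)
        (Nat.div_pos (Nat.le_of_dvd (by omega) hfv) (by omega))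
        (h.pushLattice hL hα hκ hf hS he hfv)
      obtain ⟨a, ha⟩ := hS
      -- Constancy modulo ℤ on `S` survives scaling, so `S` lies in one label class of the smaller
      -- forest; that label is the parent of the new node.
      have hp : ∀ i ∈ S, ν i = ν a := fun i hi => by
        refine label_eq_of_sub_mem hf1 (q := q) fun w hw => ?_
        rw [hlat] at hw
        obtain ⟨x, hx, hxw⟩ := mem_pushLattice.1 hw
        have h1 := hxw i
        have h2 := hxw a
        rw [scaleOn_of_mem hi] at h1
        rw [scaleOn_of_mem ha] at h2
        refine sub_mem_intReal_trans (sub_mem_intReal_trans h1 ?_) (sub_mem_intReal_symm h2)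
        rw [← mul_sub]
        exact intReal_mul_mem (natCast_mem_intReal f) (hc hx i hi a ha)
      refine ⟨s + 1, Fin.cons f f1, (ν a, q), extendLabel S ν, ?_, ?_, ?_, ?_⟩
      · intro j
        cases j using Fin.cases with
        | zero => exact hf
        | succ j => exact hf1 j
      · rw [Fin.prod_univ_succ]
        simp only [Fin.cons_zero, Fin.cons_succ, hprod]
        exact Nat.mul_div_cancel' hfv
      · refine ⟨?_, ?_⟩
        · rw [leastSet_extendLabel, Fin.cons_zero, he.weight]
          simp
        · simpa only [leastSet_extendLabel, Fin.cons_zero, Fin.cons_succ, peel_extendLabel hp]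
            using hbal
      · refine (forestLattice_succ _ _ _).trans ?_
        simp only [leastSet_extendLabel, Fin.cons_zero, Fin.cons_succ, peel_extendLabel hp, hlat]
        exact eq_constOn_inf_comap hL (by omega) ⟨a, ha⟩ hc he.mem
    · obtain rfl : v = 1 := by omega
      refine ⟨0, Fin.elim0, (), fun _ => none, fun j => j.elim0, by simp, trivial, ?_⟩
      refine le_antisymm hL fun x hx i => ?_
      obtain ⟨n, hn, hw⟩ := h.exists_index _ (fract_mem_of_mem hL hx) (fract_mem_unitBox _)
      obtain rfl : n = 0 := by omega
      have h0 := h.injOn _ (fract_mem_of_mem hL hx) (fract_mem_unitBox _) 0 L.zero_mem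
        (fun i => by simp) (by rw [hw]; simp)
      have h1 := sub_fract_mem_intReal (x i)
      rw [congrFun h0 i] at h1
      simpa using h1

end Classification

end

section

/-! ### Sizes of the label classes for unit weights. -/

section NodeCount

/-- The number of coordinates carrying each label, when the lattice of a labelled forest is
balanced for unit weights. -/
def nodeCount : {s : ℕ} → (Fin s → ℕ) → Par s → ℕ → Fin s → ℕ
  | 0, _, _, _ => Fin.elim0
  | _ + 1, f, q, k => Fin.cons (f 0 * k) fun j =>
      nodeCount (fun j => f j.succ) q.2 (f 0 * k) j - if q.1 = some j then k else 0

theorem nodeCount_zero {s : ℕ} (f : Fin (s + 1) → ℕ) (q : Par (s + 1)) (k : ℕ) :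
    nodeCount f q k 0 = f 0 * k := rfl

theorem nodeCount_succ {s : ℕ} (f : Fin (s + 1) → ℕ) (q : Par (s + 1)) (k : ℕ) (j : Fin s) :
    nodeCount f q k j.succ =
      nodeCount (fun j => f j.succ) q.2 (f 0 * k) j - if q.1 = some j then k else 0 := rfl

/-- Ensures that the natural subtraction in `nodeCount` never truncates: the recursive count exceeds
`f 0 * k`, which is at least 2k, so more than k remains after removing k. -/
theorem lt_nodeCount : ∀ {s : ℕ} {f : Fin s → ℕ} (_ : ∀ j, 2 ≤ f j) (q : Par s) {k : ℕ},
    1 ≤ k → ∀ j, k < nodeCount f q k j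
  | s + 1, f, hf, q, k, hk, j => by
    have h2 : 2 * k ≤ f 0 * k := Nat.mul_le_mul_right k (hf 0)
    cases j using Fin.cases with
    | zero => rw [nodeCount_zero]; omega
    | succ j =>
      have := lt_nodeCount (fun j => hf j.succ) q.2 (k := f 0 * k) (by omega) j
      rw [nodeCount_succ]
      split_ifs <;> omega

variable {I : Type*} [Fintype I]

theorem dotProduct_unitVec {s : ℕ} (α : I → ℝ) (ν : I → Option (Fin (s + 1))) (f : ℝ) :
    α ⬝ᵥ unitVec (leastSet ν) f = (∑ i with ν i = some 0, α i) / f := by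
  rw [Finset.sum_filter, Finset.sum_div]
  refine Finset.sum_congr rfl fun i _ => ?_
  by_cases h : ν i = some 0
  · rw [unitVec_of_mem (mem_leastSet.2 h), if_pos h, mul_one_div]
  · rw [unitVec_of_notMem (mt mem_leastSet.1 h), if_neg h, mul_zero, zero_div]

/-- Peeling moves the weight of the least node, divided by f, to its parent. This is the source of
the correction by k in `nodeCount`. -/
theorem sum_peel {s : ℕ} (α : I → ℝ) (ν : I → Option (Fin (s + 1))) (p : Option (Fin s))
    (f : ℝ) (j : Fin s) : ∑ i with peel p ν i = some j, scaleOn (leastSet ν) f⁻¹ α i =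
      ∑ i with ν i = some j.succ, α i +
        if p = some j then (∑ i with ν i = some 0, α i) / f else 0 := by
  have hs : (if p = some j then (∑ i with ν i = some 0, α i) / f else 0) =
      ∑ i, if p = some j then (if ν i = some 0 then α i / f else 0) else 0 := by
    by_cases h : p = some j
    · simp only [if_pos h]
      rw [Finset.sum_filter, Finset.sum_div]
      exact Finset.sum_congr rfl fun i _ => by split_ifs <;> simp
    · simp [h]
  rw [hs, Finset.sum_filter, Finset.sum_filter, ← Finset.sum_add_distrib]
  refine Finset.sum_congr rfl fun i _ => ?_
  rcases hν : ν i with _ | l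
  · simp [peel_of_none p hν]
  · cases l using Fin.cases with
    | zero =>
      rw [peel_of_zero p hν, scaleOn_of_mem (mem_leastSet.2 hν)]
      have : (some 0 : Option (Fin (s + 1))) ≠ some j.succ := by
        simp [(Fin.succ_ne_zero j).symm]
      rw [if_neg this, if_pos rfl, zero_add, div_eq_inv_mul]
    | succ l =>
      have h1 : (some l.succ : Option (Fin (s + 1))) ≠ some 0 := by
        simp
      rw [peel_of_succ p hν, scaleOn_of_notMem (by rw [mem_leastSet, hν]; exact h1)]
      simp

theorem balanced_iff : ∀ {s : ℕ} {f : Fin s → ℕ} (_ : ∀ j, 2 ≤ f j) (q : Par s)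
    (ν : I → Option (Fin s)) (α : I → ℝ) {k : ℕ}, 1 ≤ k →
    (Balanced f q ν α k ↔ ∀ j, ∑ i with ν i = some j, α i = nodeCount f q k j)
  | 0, _, _, _, _, _, _, _ => ⟨fun _ j => j.elim0, fun _ => trivial⟩
  | s + 1, f, hf, q, ν, α, k, hk => by
    have hf0 : (f 0 : ℝ) ≠ 0 := by
      have := hf 0
      exact_mod_cast (by omega : f 0 ≠ 0)
    have hk' : 1 ≤ f 0 * k := Nat.mul_pos (by have := hf 0; omega) hk
    have ih := balanced_iff (fun j => hf j.succ) q.2 (peel q.1 ν)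
      (scaleOn (leastSet ν) (f 0 : ℝ)⁻¹ α) hk'
    have h1 : α ⬝ᵥ unitVec (leastSet ν) (f 0) = k ↔
        ∑ i with ν i = some 0, α i = nodeCount f q k 0 := by
      rw [dotProduct_unitVec, div_eq_iff hf0, nodeCount_zero]
      push_cast
      rw [mul_comm]
    rw [Fin.forall_fin_succ, ← h1, Balanced]
    refine and_congr_right fun h => ?_
    rw [← Nat.cast_mul, ih]
    refine forall_congr' fun j => ?_
    rw [sum_peel, ← dotProduct_unitVec, h, nodeCount_succ]
    have hlt := lt_nodeCount (fun j => hf j.succ) q.2 hk' j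
    have h2 : k ≤ f 0 * k := Nat.le_mul_of_pos_left k (by have := hf 0; omega)
    by_cases hp : q.1 = some j
    · rw [if_pos hp, if_pos hp, Nat.cast_sub (by omega), eq_sub_iff_add_eq]
    · rw [if_neg hp, if_neg hp, add_zero, Nat.sub_zero]

theorem balanced_one_iff {s : ℕ} {f : Fin s → ℕ} (hf : ∀ j, 2 ≤ f j) (q : Par s)
    (ν : I → Option (Fin s)) {k : ℕ} (hk : 1 ≤ k) :
    Balanced f q ν 1 k ↔ ∀ j, Nat.card {i // ν i = some j} = nodeCount f q k j := by
  rw [balanced_iff hf q ν 1 hk]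
  refine forall_congr' fun j => ?_
  rw [Nat.card_eq_fintype_card, Fintype.card_subtype]
  simp

theorem exists_balanced_label {s : ℕ} {f : Fin s → ℕ} (hf : ∀ j, 2 ≤ f j) (q : Par s)
    {k : ℕ} (hk : 1 ≤ k) : ∃ ν : Fin (∑ j, nodeCount f q k j) → Option (Fin s),
      (∀ i, ν i ≠ none) ∧ Balanced f q ν 1 k := by
  refine ⟨fun i => some (finSigmaFinEquiv.symm i).1, fun i => by simp,
    (balanced_one_iff hf q _ hk).2 fun j => ?_⟩
  have e : {i // some (finSigmaFinEquiv.symm i).1 = some j} ≃ {x // Sigma.fst x = j} :=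
    (finSigmaFinEquiv (n := nodeCount f q k)).symm.subtypeEquiv
      (q := fun x => x.1 = j) (fun i => by simp)
  rw [Nat.card_congr (e.trans (Equiv.sigmaSubtype j)), Nat.card_eq_fintype_card,
    Fintype.card_fin]

theorem exists_relabel {J : Type*} [Finite J] {s : ℕ} {ν : I → Option (Fin s)}
    {μ : J → Option (Fin s)} (hν : ∀ i, ν i ≠ none) (hμ : ∀ i, μ i ≠ none)
    (h : ∀ j, Nat.card {i // ν i = some j} = Nat.card {i // μ i = some j}) :
    ∃ e : I ≃ J, ∀ i, μ (e i) = ν i := by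
  have h' : ∀ j, Nat.card {i // ν i = j} = Nat.card {i // μ i = j} := by
    rintro (_ | j)
    · have : IsEmpty {i // ν i = none} := ⟨fun i => hν i.1 i.2⟩
      have : IsEmpty {i // μ i = none} := ⟨fun i => hμ i.1 i.2⟩
      rw [Nat.card_of_isEmpty, Nat.card_of_isEmpty]
    · exact h j
  let e : ∀ j, {i // ν i = j} ≃ {i // μ i = j} := fun j => (Finite.card_eq.1 (h' j)).some
  refine ⟨(Equiv.sigmaFiberEquiv ν).symm.trans
    ((Equiv.sigmaCongrRight e).trans (Equiv.sigmaFiberEquiv μ)), fun i => ?_⟩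
  exact (e (ν i) ⟨i, rfl⟩).2

end NodeCount

/-! ### Reindexing coordinates, and unit fractions in forest lattices. -/

theorem mem_forestLattice_comp {I J : Type*} (e : I ≃ J) : ∀ {s : ℕ} (f : Fin s → ℕ)
    (q : Par s) (ν : J → Option (Fin s)) (x : J → ℝ),
    x ∘ e ∈ forestLattice f q (ν ∘ e) ↔ x ∈ forestLattice f q ν
  | 0, f, q, ν, x => by
    change (∀ i, x (e i) ∈ intReal) ↔ ∀ i, x i ∈ intReal
    exact e.forall_congr_right (q := fun i => x i ∈ intReal)
  | s + 1, f, q, ν, x => by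
    rw [mem_forestLattice_succ, mem_forestLattice_succ,
      ← mem_forestLattice_comp e _ q.2 (peel q.1 ν)]
    refine and_congr ?_ (iff_of_eq (congrArg (· ∈ _) ?_))
    · constructor
      · intro h i hi j hj
        simpa using h (e.symm i) (by simpa [leastSet] using hi) (e.symm j)
          (by simpa [leastSet] using hj)
      · intro h i hi j hj
        exact h (e i) hi (e j) hj
    · ext i
      have hi : i ∈ leastSet (ν ∘ e) ↔ ν (e i) = some 0 := Iff.rfl
      by_cases h : ν (e i) = some 0
      · rw [scaleOn_of_mem (hi.2 h), Function.comp_apply, Function.comp_apply,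
          scaleOn_of_mem (mem_leastSet.2 h)]
      · rw [scaleOn_of_notMem (mt hi.1 h), Function.comp_apply, Function.comp_apply,
          scaleOn_of_notMem (by rwa [mem_leastSet])]

/-- The lattice of a labelled forest contains a vector of unit fractions whose denominators
clear all the denominators of the lattice. -/
theorem exists_unit_fractions {I : Type*} : ∀ {s : ℕ} {f : Fin s → ℕ} (_ : ∀ j, 2 ≤ f j)
    (q : Par s) (ν : I → Option (Fin s)), ∃ n : I → ℕ, (∀ i, 1 ≤ n i) ∧
    (fun i => (1 / n i : ℝ)) ∈ forestLattice f q ν ∧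
    ∀ x ∈ forestLattice f q ν, ∀ i, (n i : ℝ) * x i ∈ intReal
  | 0, f, _, q, ν => ⟨fun _ => 1, fun _ => le_rfl, fun i => by simpa using one_mem_intReal,
      fun x hx i => by simpa using hx i⟩
  | s + 1, f, hf, q, ν => by
    classical
    obtain ⟨n, hn1, hn, hnx⟩ := exists_unit_fractions (fun j => hf j.succ) q.2 (peel q.1 ν)
    have hf0 : 0 < f 0 := by have := hf 0; omega
    have hf0' : (0 : ℝ) < f 0 := by exact_mod_cast hf0
    refine ⟨fun i => if i ∈ leastSet ν then f 0 * n i else n i, fun i => ?_,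
      mem_forestLattice_succ.2 ⟨fun i hi j hj => ?_, ?_⟩, fun x hx i => ?_⟩
    · have := hn1 i
      dsimp only
      split_ifs
      · exact Nat.mul_pos hf0 this
      · exact this
    · have h1 := forestLattice_sub_mem hn (i := i) (j := j)
        (by rw [peel_of_zero _ hi, peel_of_zero _ hj])
      have hb : ∀ i, (0 : ℝ) < 1 / n i ∧ (1 / n i : ℝ) ≤ 1 := fun i => by
        have : (1 : ℝ) ≤ n i := by exact_mod_cast hn1 i
        exact ⟨by positivity, by rw [div_le_one (by linarith)]; exact this⟩
      -- Two unit fractions lie in (0, 1], so if they agree modulo ℤ they are equal; hence they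
      -- remain equal after division by `f 0`.
      have h2 := eq_zero_of_mem_intReal h1 (by linarith [hb i, hb j]) (by linarith [hb i, hb j])
      simp only [if_pos hi, if_pos hj]
      push_cast
      rw [mul_comm, ← div_div, mul_comm, ← div_div, ← sub_div, h2, zero_div]
      exact intReal.zero_mem
    · convert hn using 1
      ext i
      by_cases h : i ∈ leastSet ν
      · rw [scaleOn_of_mem h]
        simp only [if_pos h]
        push_cast
        field_simp
      · rw [scaleOn_of_notMem h]
        simp only [if_neg h]
    · have h1 := hnx _ (mem_forestLattice_succ.1 hx).2 i
      by_cases h : i ∈ leastSet ν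
      · rw [scaleOn_of_mem h] at h1
        simp only [if_pos h]
        push_cast
        rwa [mul_comm (f 0 : ℝ), mul_assoc]
      · rw [scaleOn_of_notMem h] at h1
        simpa only [if_neg h] using h1

/-! ### Counting forests, factorizations and divisor chains. -/

section Counting

instance finitePar : ∀ s : ℕ, Finite (Par s)
  | 0 => inferInstanceAs (Finite Unit)
  | s + 1 => by
    have := finitePar s
    exact inferInstanceAs (Finite (Option (Fin s) × Par s))

theorem card_par : ∀ s : ℕ, Nat.card (Par s) = s !
  | 0 => by
    change Nat.card Unit = _
    simp
  | s + 1 => by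
    change Nat.card (Option (Fin s) × Par s) = _
    rw [Nat.card_prod, card_par s, Nat.factorial_succ]
    simp

/-- The ordered factorizations of `v` into `s` factors greater than `1`. -/
def OrderedFactorization (s v : ℕ) : Type := {f : Fin s → ℕ // (∀ j, 2 ≤ f j) ∧ ∏ j, f j = v}

theorem partialProd_last {s : ℕ} (f : Fin s → ℕ) :
    Fin.partialProd f (Fin.last s) = ∏ j, f j := by
  rw [Fin.partialProd, Fin.val_last, List.take_of_length_le (by simp), List.prod_ofFn]

theorem partialProd_dvd {s : ℕ} (f : Fin s → ℕ) (j : Fin (s + 1)) :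
    Fin.partialProd f j ∣ ∏ j, f j := by
  rw [← List.prod_ofFn, Fin.partialProd]
  exact ⟨_, (List.prod_take_mul_prod_drop (List.ofFn f) j).symm⟩

theorem divisor_lt_iff {v : ℕ} {a b : DivisorLattice v} : a < b ↔ a.1 ∣ b.1 ∧ ¬ b.1 ∣ a.1 :=
  lt_iff_le_not_ge

theorem DivisorLattice.pos {v : ℕ} (hv : 1 ≤ v) (a : DivisorLattice v) : 0 < a.1 :=
  Nat.pos_of_dvd_of_pos a.2 hv

theorem partialProd_chain {s v : ℕ} {M : Fin (s + 1) → DivisorLattice v} (hM : StrictMono M)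
    (h0 : (M 0).1 = 1) (j : Fin (s + 1)) :
    Fin.partialProd (fun j : Fin s => (M j.succ).1 / (M j.castSucc).1) j = (M j).1 := by
  induction j using Fin.induction with
  | zero => rw [Fin.partialProd_zero, h0]
  | succ j ih =>
    rw [Fin.partialProd_succ, ih]
    exact Nat.mul_div_cancel' (divisor_lt_iff.1 (hM (Fin.castSucc_lt_succ))).1

/-- Successive quotients of a chain and partial products of a factorization are mutually inverse. -/
theorem chainCount_eq_card (s : ℕ) {v : ℕ} (hv : 1 ≤ v) :
    chainCount s v = Nat.card (OrderedFactorization s v) := by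
  refine Nat.card_eq_of_bijective (fun M => ⟨fun j : Fin s =>
    (M.1 j.succ).1 / (M.1 j.castSucc).1, ⟨fun j => ?_, ?_⟩⟩) ⟨?_, ?_⟩
  · obtain ⟨⟨c, hc⟩, h2⟩ := divisor_lt_iff.1 (M.2.1 (Fin.castSucc_lt_succ (i := j)))
    have hp := (M.1 j.castSucc).pos hv
    have hp' := (M.1 j.succ).pos hv
    change 2 ≤ (M.1 j.succ).1 / (M.1 j.castSucc).1
    rw [hc, Nat.mul_div_cancel_left _ hp]
    rw [hc] at h2 hp'
    rcases c with _ | _ | c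
    · simp at hp'
    · simp at h2
    · omega
  · rw [← partialProd_last, partialProd_chain M.2.1 M.2.2.1, M.2.2.2]
  · intro M M' h
    have h' := congrArg Subtype.val h
    dsimp only at h'
    refine Subtype.ext (funext fun j => Subtype.ext ?_)
    rw [← partialProd_chain M.2.1 M.2.2.1, ← partialProd_chain M'.2.1 M'.2.2.1, h']
  · rintro ⟨f, hf, hprod⟩
    have hpos : ∀ j, 0 < Fin.partialProd f j := fun j =>
      Nat.pos_of_dvd_of_pos (partialProd_dvd f j) (by omega)
    refine ⟨⟨fun j => ⟨Fin.partialProd f j, hprod ▸ partialProd_dvd f j⟩, ?_, ?_, ?_⟩, ?_⟩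
    · refine Fin.strictMono_iff_lt_succ.2 fun j => divisor_lt_iff.2 ?_
      dsimp only
      rw [Fin.partialProd_succ]
      refine ⟨⟨_, rfl⟩, fun h => ?_⟩
      have h1 := Nat.le_of_dvd (hpos _) h
      have h2 := hpos j.castSucc
      have h3 := hf j
      nlinarith
    · exact Fin.partialProd_zero f
    · exact (partialProd_last f).trans hprod
    · refine Subtype.ext (funext fun j => ?_)
      change Fin.partialProd f j.succ / Fin.partialProd f j.castSucc = f j
      rw [Fin.partialProd_succ, Nat.mul_div_cancel_left _ (hpos _)]

theorem OrderedFactorization.pow_le {s v : ℕ} (f : OrderedFactorization s v) : 2 ^ s ≤ v := by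
  have := Finset.prod_le_prod' (s := Finset.univ) (f := fun _ : Fin s => 2) (g := f.1)
    fun j _ => f.2.1 j
  simpa [f.2.2] using this

instance finiteOrderedFactorization (s v : ℕ) : Finite (OrderedFactorization s v) := by
  have : ∀ (f : OrderedFactorization s v) (j : Fin s), f.1 j < v + 1 := fun f j => by
    have h1 : f.1 j ∣ v := by
      have := Finset.dvd_prod_of_mem f.1 (Finset.mem_univ j)
      rwa [f.2.2] at this
    have h2 := f.pow_le
    have h3 : 0 < v := lt_of_lt_of_le (by positivity) h2
    exact Nat.lt_succ_of_le (Nat.le_of_dvd h3 h1)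
  refine Finite.of_injective
    (fun (f : OrderedFactorization s v) (j : Fin s) => (⟨f.1 j, this f j⟩ : Fin (v + 1)))
    fun f g h => Subtype.ext (funext fun j => ?_)
  simpa using congrFun h j

/-- The combinatorial data classifying the simplices. -/
def ForestData (v : ℕ) : Type := Σ s : ℕ, OrderedFactorization s v × Par s

theorem OrderedFactorization.length_pos {s v : ℕ} (hv : 2 ≤ v) (f : OrderedFactorization s v) :
    0 < s := by
  refine Nat.pos_of_ne_zero fun h => ?_
  subst h
  have := f.2.2
  simp at this
  omega

/-- The data of a given length, as a finite dependent sum. -/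
def forestDataEquiv (v : ℕ) :
    ForestData v ≃ Σ s : Fin (v + 1), OrderedFactorization s v × Par s where
  toFun D := ⟨⟨D.1, Nat.lt_succ_of_lt (lt_of_lt_of_le Nat.lt_two_pow_self D.2.1.pow_le)⟩, D.2⟩
  invFun D := ⟨D.1, D.2⟩
  left_inv _ := rfl
  right_inv _ := rfl

instance (v : ℕ) : Finite (ForestData v) := Finite.of_equiv _ (forestDataEquiv v).symm

/-- The sum is finite because 2^s ≤ v for a factorization of length s, and starting it at s = 1
loses nothing because the empty product is not `v`. -/
theorem card_forestData {v : ℕ} (hv : 2 ≤ v) :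
    HasSum (fun s : ℕ+ => chainCount s v * (s : ℕ)!) (Nat.card (ForestData v)) := by
  have hz : ∀ s, (s = 0 ∨ v + 1 ≤ s) → chainCount s v = 0 := by
    intro s hs
    rw [chainCount_eq_card s (by omega)]
    have : IsEmpty (OrderedFactorization s v) := ⟨fun f => by
      have h1 := f.length_pos hv
      have h2 := lt_of_lt_of_le Nat.lt_two_pow_self f.pow_le
      omega⟩
    exact Nat.card_of_isEmpty
  have hcard : Nat.card (ForestData v) = ∑ s ∈ Finset.range (v + 1), chainCount s v * s ! := by
    rw [Nat.card_congr (forestDataEquiv v), Nat.card_sigma, Finset.sum_range]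
    refine Finset.sum_congr rfl fun s _ => ?_
    rw [Nat.card_prod, card_par, chainCount_eq_card _ (by omega)]
  have hsum : HasSum (fun s : ℕ => chainCount s v * s !) (Nat.card (ForestData v)) := by
    rw [hcard]
    refine hasSum_sum_of_ne_finset_zero fun s hs => ?_
    rw [hz s (Or.inr (by simpa using hs)), zero_mul]
  refine (Function.Injective.hasSum_iff PNat.coe_injective fun s hs => ?_).2 hsum
  have : s = 0 := by
    by_contra h
    exact hs ⟨⟨s, Nat.pos_of_ne_zero h⟩, rfl⟩
  rw [hz s (Or.inl this), zero_mul]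

/-- The endpoints 1 and `v` are the bottom and the top of the lattice, so an order isomorphism
respects them. -/
theorem chainCount_congr {v v' : ℕ} (e : DivisorLattice v ≃o DivisorLattice v') (s : ℕ) :
    chainCount s v = chainCount s v' := by
  have hbot : ∀ (v : ℕ) (a : DivisorLattice v), a.1 = 1 ↔ ∀ b, a ≤ b := fun v a =>
    ⟨fun h b => show a.1 ∣ b.1 by rw [h]; exact one_dvd _, fun h =>
      Nat.dvd_one.1 (show a.1 ∣ 1 from h ⟨1, one_dvd v⟩)⟩
  have htop : ∀ (v : ℕ) (a : DivisorLattice v), a.1 = v ↔ ∀ b, b ≤ a := fun v a =>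
    ⟨fun h b => show b.1 ∣ a.1 by rw [h]; exact b.2, fun h =>
      Nat.dvd_antisymm a.2 (show v ∣ a.1 from h ⟨v, dvd_rfl⟩)⟩
  refine Nat.card_congr ((Equiv.arrowCongr (Equiv.refl _) e.toEquiv).subtypeEquiv fun M => ?_)
  refine and_congr ?_ (and_congr ?_ ?_)
  · exact forall₂_congr fun a b => imp_congr_right fun _ => e.lt_iff_lt.symm
  · rw [hbot, hbot]
    exact ⟨fun h b => by simpa using e.monotone (h (e.symm b)), fun h b => by simpa using h (e b)⟩
  · rw [htop, htop]
    exact ⟨fun h b => by simpa using e.monotone (h (e.symm b)), fun h b => by simpa using h (e b)⟩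

end Counting

end

/-! ### Barycentric lattices of simplices and the h^*-polynomial. -/

section

variable {d : ℕ}

/-- The linear map `x ↦ ∑ i, x i • p i`. -/
noncomputable def combo (p : Fin (d + 1) → Fin d → ℤ) : (Fin (d + 1) → ℝ) →ₗ[ℝ] (Fin d → ℝ) :=
  Fintype.linearCombination ℝ fun i => latticeVec (p i)

theorem combo_eq_sum (p : Fin (d + 1) → Fin d → ℤ) (x : Fin (d + 1) → ℝ) :
    combo p x = ∑ i, x i • latticeVec (p i) := rfl

theorem combo_apply (p : Fin (d + 1) → Fin d → ℤ) (x : Fin (d + 1) → ℝ) (j : Fin d) :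
    combo p x j = ∑ i, x i * p i j := by
  simp [combo_eq_sum, latticeVec]

/-- The vectors of barycentric coordinates, of arbitrary integral level, of the lattice points
with respect to `p`. -/
noncomputable def simplexLattice (p : Fin (d + 1) → Fin d → ℤ) :
    AddSubgroup (Fin (d + 1) → ℝ) where
  carrier := {x | ∑ i, x i ∈ intReal ∧ ∀ j, combo p x j ∈ intReal}
  add_mem' {x y} hx hy := ⟨by
    simpa [Finset.sum_add_distrib] using intReal.add_mem hx.1 hy.1, fun j => by
    simpa using intReal.add_mem (hx.2 j) (hy.2 j)⟩
  zero_mem' := ⟨by simp [intReal.zero_mem], fun j => by simp [intReal.zero_mem]⟩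
  neg_mem' {x} hx := ⟨by simpa using intReal.neg_mem hx.1, fun j => by
    simpa using intReal.neg_mem (hx.2 j)⟩

theorem mem_simplexLattice {p : Fin (d + 1) → Fin d → ℤ} {x : Fin (d + 1) → ℝ} :
    x ∈ simplexLattice p ↔ ∑ i, x i ∈ intReal ∧ ∀ j, combo p x j ∈ intReal := Iff.rfl

theorem stdLattice_le_simplexLattice (p : Fin (d + 1) → Fin d → ℤ) :
    stdLattice (Fin (d + 1)) ≤ simplexLattice p := fun x hx =>
  ⟨intReal.sum_mem fun i _ => hx i, fun j => by
    rw [combo_apply]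
    exact intReal.sum_mem fun i _ => intReal_mul_mem (hx i) (intCast_mem_intReal _)⟩

/-- The convex hull of the points `p i`. -/
def simplex (p : Fin (d + 1) → Fin d → ℤ) : Set (Fin d → ℝ) :=
  convexHull ℝ (Set.range fun i => latticeVec (p i))

/-- Affine independence of the lattice points `p i`. -/
def AffIndep (p : Fin (d + 1) → Fin d → ℤ) : Prop :=
  AffineIndependent ℝ fun i => latticeVec (p i)

theorem affIndep_iff {p : Fin (d + 1) → Fin d → ℤ} :
    AffIndep p ↔ ∀ x : Fin (d + 1) → ℝ, ∑ i, x i = 0 → combo p x = 0 → x = 0 := by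
  rw [AffIndep, affineIndependent_iff_of_fintype]
  refine forall₂_congr fun x hx => ?_
  rw [Finset.univ.weightedVSub_eq_linear_combination hx, ← combo_eq_sum, funext_iff (f := x)]
  rfl

theorem AffIndep.eq {p : Fin (d + 1) → Fin d → ℤ} (hp : AffIndep p) {x y : Fin (d + 1) → ℝ}
    (h : ∑ i, x i = ∑ i, y i) (h' : combo p x = combo p y) : x = y := by
  refine sub_eq_zero.1 (affIndep_iff.1 hp _ ?_ ?_)
  · simp [h]
  · rw [map_sub, h', sub_self]

/-- Level and position together form an injective linear map between spaces of dimension d + 1,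
hence a bijection. -/
theorem AffIndep.exists_eq {p : Fin (d + 1) → Fin d → ℤ} (hp : AffIndep p) (t : ℝ)
    (y : Fin d → ℝ) : ∃ x : Fin (d + 1) → ℝ, ∑ i, x i = t ∧ combo p x = y := by
  let F : (Fin (d + 1) → ℝ) →ₗ[ℝ] ℝ × (Fin d → ℝ) :=
    (∑ i, LinearMap.proj i : (Fin (d + 1) → ℝ) →ₗ[ℝ] ℝ).prod (combo p)
  have hF : ∀ x, F x = (∑ i, x i, combo p x) := fun x => by simp [F]
  have hinj : Function.Injective F := fun x y hxy => by
    rw [hF, hF, Prod.mk.injEq] at hxy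
    exact hp.eq hxy.1 hxy.2
  have hsurj : Function.Surjective F :=
    (LinearMap.injective_iff_surjective_of_finrank_eq_finrank (by simp [add_comm])).1 hinj
  obtain ⟨x, hx⟩ := hsurj (t, y)
  rw [hF, Prod.mk.injEq] at hx
  exact ⟨x, hx⟩

theorem mem_convexHull_range {ι E : Type*} [Fintype ι] [AddCommGroup E] [Module ℝ E]
    {b : ι → E} {y : E} : y ∈ convexHull ℝ (Set.range b) ↔
      ∃ w : ι → ℝ, (∀ i, 0 ≤ w i) ∧ ∑ i, w i = 1 ∧ ∑ i, w i • b i = y := by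
  classical
  constructor
  · intro hy
    have h := convexHull_basis_eq_stdSimplex (R := ℝ) (ι := ι)
    have h2 : Set.range b = Fintype.linearCombination ℝ b ''
        Set.range (fun i j : ι => if i = j then (1 : ℝ) else 0) := by
      rw [← Set.range_comp]
      congr 1
      ext i
      simp [Fintype.linearCombination_apply]
    rw [h2, ← LinearMap.image_convexHull, h] at hy
    obtain ⟨w, hw, rfl⟩ := hy
    exact ⟨w, hw.1, hw.2, rfl⟩
  · rintro ⟨w, hw0, hw1, rfl⟩
    exact (convex_convexHull ℝ _).sum_mem (fun i _ => hw0 i) hw1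
      fun i _ => subset_convexHull ℝ _ ⟨i, rfl⟩

theorem mem_simplex {p : Fin (d + 1) → Fin d → ℤ} {y : Fin d → ℝ} :
    y ∈ simplex p ↔ ∃ w : Fin (d + 1) → ℝ, (∀ i, 0 ≤ w i) ∧ ∑ i, w i = 1 ∧ combo p w = y :=
  mem_convexHull_range

theorem mem_smul_simplex {p : Fin (d + 1) → Fin d → ℤ} {m : ℝ} (hm : 0 ≤ m) {y : Fin d → ℝ} :
    y ∈ m • simplex p ↔
      ∃ w : Fin (d + 1) → ℝ, (∀ i, 0 ≤ w i) ∧ ∑ i, w i = m ∧ combo p w = y := by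
  rw [Set.mem_smul_set]
  constructor
  · rintro ⟨z, hz, rfl⟩
    obtain ⟨w, hw0, hw1, rfl⟩ := mem_simplex.1 hz
    exact ⟨m • w, fun i => mul_nonneg hm (hw0 i), by
      simp [← Finset.mul_sum, hw1], by rw [map_smul]⟩
  · rintro ⟨w, hw0, hw1, rfl⟩
    rcases hm.eq_or_lt with rfl | hm
    · have : w = 0 := funext fun i =>
        (Finset.sum_eq_zero_iff_of_nonneg fun i _ => hw0 i).1 hw1 i (Finset.mem_univ i)
      exact ⟨latticeVec (p 0), subset_convexHull ℝ _ ⟨0, rfl⟩, by simp [this]⟩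
    · refine ⟨combo p (m⁻¹ • w), mem_simplex.2 ⟨m⁻¹ • w, fun i =>
        mul_nonneg (inv_nonneg.2 hm.le) (hw0 i), ?_, rfl⟩, ?_⟩
      · simp [← Finset.mul_sum, hw1, hm.ne']
      · rw [map_smul, smul_inv_smul₀ hm.ne']

theorem isLatticePolytope_simplex (p : Fin (d + 1) → Fin d → ℤ) :
    IsLatticePolytope (simplex p) := by
  classical
  refine ⟨Finset.univ.image p, ⟨p 0, by simp⟩, ?_⟩
  rw [simplex, Finset.coe_image, Finset.coe_univ, Set.image_univ, ← Set.range_comp]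
  rfl

/-- The vectors of `L` with coordinate sum `n` in the half-open unit cube. -/
def boxLevel {I : Type*} [Fintype I] (L : AddSubgroup (I → ℝ)) (n : ℕ) : Set (I → ℝ) :=
  {x | x ∈ L ∧ x ∈ unitBox I ∧ ∑ i, x i = n}

/-- A vector is determined by its level and position, which are integral here and bounded on the
cube. -/
theorem finite_simplexLattice_box {p : Fin (d + 1) → Fin d → ℤ} (hp : AffIndep p) :
    {x | x ∈ simplexLattice p ∧ x ∈ unitBox (Fin (d + 1))}.Finite := by
  classical
  let F : (Fin (d + 1) → ℝ) → ℤ × (Fin d → ℤ) := fun x =>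
    (⌊∑ i, x i⌋, fun j => ⌊combo p x j⌋)
  let B : Fin d → ℤ := fun j => ∑ i, |p i j|
  refine Set.Finite.of_injOn (f := F)
    (t := (Set.Icc 0 (d + 1 : ℤ)) ×ˢ Set.pi Set.univ fun j => Set.Icc (- B j) (B j)) ?_ ?_
    ((Set.finite_Icc _ _).prod (Set.Finite.pi fun j => Set.finite_Icc _ _))
  · rintro x ⟨hx, hb⟩
    obtain ⟨n, hn⟩ := mem_intReal.1 hx.1
    refine ⟨?_, fun j _ => ?_⟩
    · simp only [F, ← hn, Int.floor_intCast, Set.mem_Icc]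
      have h1 : (0 : ℝ) ≤ n := by rw [hn]; exact Finset.sum_nonneg fun i _ => (hb i).1
      have h2 : (n : ℝ) ≤ d + 1 := by
        rw [hn]
        calc ∑ i, x i ≤ ∑ _i : Fin (d + 1), (1 : ℝ) :=
              Finset.sum_le_sum fun i _ => (hb i).2.le
          _ = d + 1 := by simp
      exact ⟨by exact_mod_cast h1, by exact_mod_cast h2⟩
    · obtain ⟨m, hm⟩ := mem_intReal.1 (hx.2 j)
      simp only [F, ← hm, Int.floor_intCast, Set.mem_Icc]
      rw [← abs_le]
      have : |(m : ℝ)| ≤ (B j : ℝ) := by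
        rw [hm, combo_apply]
        refine (Finset.abs_sum_le_sum_abs _ _).trans ?_
        simp only [B]
        push_cast
        refine Finset.sum_le_sum fun i _ => ?_
        rw [abs_mul, abs_of_nonneg (hb i).1]
        exact mul_le_of_le_one_left (abs_nonneg _) (hb i).2.le
      exact_mod_cast this
  · rintro x ⟨hx, _⟩ y ⟨hy, _⟩ hxy
    have hfl : ∀ {a b : ℝ}, a ∈ intReal → b ∈ intReal → ⌊a⌋ = ⌊b⌋ → a = b := by
      rintro a b ha hb h
      obtain ⟨n, rfl⟩ := mem_intReal.1 ha
      obtain ⟨m, rfl⟩ := mem_intReal.1 hb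
      simpa using h
    refine hp.eq (hfl hx.1 hy.1 (congrArg Prod.fst hxy)) (funext fun j => ?_)
    exact hfl (hx.2 j) (hy.2 j) (congrFun (congrArg Prod.snd hxy) j)

theorem finite_boxLevel {p : Fin (d + 1) → Fin d → ℤ} (hp : AffIndep p) (n : ℕ) :
    (boxLevel (simplexLattice p) n).Finite :=
  (finite_simplexLattice_box hp).subset fun _ hx => ⟨hx.1, hx.2.1⟩

theorem card_compositions (d n : ℕ) :
    Nat.card {z : Fin (d + 1) → ℕ // ∑ i, z i = n} = (d + n).choose d := by
  have e : {z : Fin (d + 1) → ℕ // ∑ i, z i = n} ≃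
      Finset.finsuppAntidiag (Finset.univ : Finset (Fin (d + 1))) n :=
    Finsupp.equivFunOnFinite.symm.subtypeEquiv fun z => by
      simp [Finset.mem_finsuppAntidiag]
  rw [Nat.card_congr e, Nat.card_eq_fintype_card, Fintype.card_coe,
    Finset.card_finsuppAntidiag_nat_eq_choose, Finset.card_univ, Fintype.card_fin,
    show d + 1 + n - 1 = d + n by omega, Nat.choose_symm_add]

instance (d n : ℕ) : Finite {z : Fin (d + 1) → ℕ // ∑ i, z i = n} :=
  Nat.finite_of_card_ne_zero (by
    rw [card_compositions]
    exact (Nat.choose_pos (Nat.le_add_right d n)).ne')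

/-- The nonnegative vectors of `L` with coordinate sum `m`. -/
def coneLevel {I : Type*} [Fintype I] (L : AddSubgroup (I → ℝ)) (m : ℕ) : Set (I → ℝ) :=
  {x | x ∈ L ∧ (∀ i, 0 ≤ x i) ∧ ∑ i, x i = m}

theorem latticePointCount_simplex {p : Fin (d + 1) → Fin d → ℤ} (hp : AffIndep p) (m : ℕ) :
    latticePointCount (simplex p) m = Nat.card (coneLevel (simplexLattice p) m) := by
  rw [latticePointCount, ← Nat.card_coe_set_eq]
  have hex : ∀ z : {z : Fin d → ℤ | latticeVec z ∈ (m : ℝ) • simplex p},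
      ∃ w : Fin (d + 1) → ℝ, w ∈ coneLevel (simplexLattice p) m ∧ combo p w = latticeVec z := by
    rintro ⟨z, hz⟩
    obtain ⟨w, hw0, hw1, hw⟩ := (mem_smul_simplex (Nat.cast_nonneg m)).1 hz
    refine ⟨w, ⟨⟨?_, fun j => ?_⟩, hw0, hw1⟩, hw⟩
    · rw [hw1]; exact natCast_mem_intReal m
    · rw [hw]; exact intCast_mem_intReal _
  choose F hF hFc using hex
  refine Nat.card_eq_of_bijective (fun z => (⟨F z, hF z⟩ : coneLevel (simplexLattice p) m))
    ⟨fun z z' h => ?_, fun x => ?_⟩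
  · have h1 := congrArg (combo p) (congrArg Subtype.val h)
    dsimp only at h1
    rw [hFc, hFc] at h1
    refine Subtype.ext (funext fun j => ?_)
    have := congrFun h1 j
    simpa [latticeVec] using this
  · obtain ⟨x, hx, hx0, hx1⟩ := x
    choose z hz using fun j => mem_intReal.1 (hx.2 j)
    have hzx : combo p x = latticeVec z := funext fun j => (hz j).symm
    refine ⟨⟨z, (mem_smul_simplex (Nat.cast_nonneg m)).2 ⟨x, hx0, hx1, hzx⟩⟩, Subtype.ext ?_⟩
    refine hp.eq ?_ ?_
    · rw [(hF _).2.2, hx1]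
    · exact (hFc _).trans hzx.symm

/-- Taking fractional and integer parts splits each nonnegative vector uniquely into a cube vector
and a vector of natural numbers. -/
theorem card_coneLevel {p : Fin (d + 1) → Fin d → ℤ} (hp : AffIndep p) (m : ℕ) :
    Nat.card (coneLevel (simplexLattice p) m) = ∑ a ∈ Finset.HasAntidiagonal.antidiagonal m,
      Nat.card (boxLevel (simplexLattice p) a.1) * (d + a.2).choose d := by
  set L := simplexLattice p with hL
  have hstd : stdLattice (Fin (d + 1)) ≤ L := stdLattice_le_simplexLattice p
  let T := Σ a : Finset.HasAntidiagonal.antidiagonal m,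
    boxLevel L a.1.1 × {z : Fin (d + 1) → ℕ // ∑ i, z i = a.1.2}
  let G : T → coneLevel L m := fun t => ⟨fun i => t.2.1.1 i + t.2.2.1 i,
    L.add_mem t.2.1.2.1 (hstd fun i => natCast_mem_intReal _),
    fun i => add_nonneg (t.2.1.2.2.1 i).1 (Nat.cast_nonneg _), by
      rw [Finset.sum_add_distrib, t.2.1.2.2.2, ← Nat.cast_sum, t.2.2.2, ← Nat.cast_add,
        Finset.HasAntidiagonal.mem_antidiagonal.1 t.1.2]⟩
  have hG : Function.Bijective G := by
    constructor
    · rintro ⟨⟨⟨a, b⟩, hab⟩, ⟨x, hx⟩, ⟨z, hz⟩⟩ ⟨⟨⟨a', b'⟩, hab'⟩, ⟨x', hx'⟩, ⟨z', hz'⟩⟩ h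
      have h1 : ∀ i, x i + z i = x' i + z' i := fun i => congrFun (congrArg Subtype.val h) i
      have h2 : x = x' := funext fun i => by
        refine eq_of_sub_mem_intReal (hx.2.1 i) (hx'.2.1 i) ⟨z' i - z i, ?_⟩
        have := h1 i
        simp
        linarith
      have h3 : z = z' := funext fun i => by
        have := h1 i
        rw [h2] at this
        exact_mod_cast add_left_cancel this
      subst h2 h3
      have h4 : a = a' := by exact_mod_cast hx.2.2.symm.trans hx'.2.2
      have h5 : b = b' := hz.symm.trans hz'
      subst h4 h5
      rfl
    · rintro ⟨x, hx, hx0, hx1⟩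
      have hfr : (fun i => Int.fract (x i)) ∈ L := fract_mem_of_mem hstd hx
      obtain ⟨n, hn⟩ : ∃ n : ℕ, ∑ i, Int.fract (x i) = n := by
        obtain ⟨n, hn⟩ := mem_intReal.1 (mem_simplexLattice.1 hfr).1
        have : (0 : ℝ) ≤ n := by
          rw [hn]
          exact Finset.sum_nonneg fun i _ => Int.fract_nonneg _
        obtain ⟨k, rfl⟩ := Int.eq_ofNat_of_zero_le (by exact_mod_cast this : 0 ≤ n)
        exact ⟨k, by rw [← hn]; simp⟩
      have hfl : ∀ i, Int.fract (x i) + (⌊x i⌋₊ : ℝ) = x i := fun i => by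
        rw [natCast_floor_eq_intCast_floor (hx0 i), Int.fract_add_floor]
      have hsum : n + ∑ i, ⌊x i⌋₊ = m := by
        have : (n : ℝ) + ∑ i, (⌊x i⌋₊ : ℝ) = m := by
          rw [← hn, ← Finset.sum_add_distrib, ← hx1]
          exact Finset.sum_congr rfl fun i _ => hfl i
        exact_mod_cast this
      refine ⟨⟨⟨(n, ∑ i, ⌊x i⌋₊), Finset.HasAntidiagonal.mem_antidiagonal.2 hsum⟩,
        ⟨_, hfr, fract_mem_unitBox x, hn⟩, ⟨fun i => ⌊x i⌋₊, rfl⟩⟩, Subtype.ext (funext hfl)⟩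
  have hfin : ∀ n, Finite (boxLevel L n) := fun n => finite_boxLevel hp n
  rw [← Nat.card_eq_of_bijective G hG, Nat.card_sigma,
    ← Finset.sum_coe_sort _ fun a : ℕ × ℕ => Nat.card (boxLevel L a.1) * (d + a.2).choose d]
  refine Finset.sum_congr rfl fun a _ => ?_
  rw [Nat.card_prod, card_compositions]

/-- By `card_coneLevel` the Ehrhart series is the generating series of cube vectors times
1/(1-t)^(d+1). -/
theorem hasHStarPolynomial_iff {p : Fin (d + 1) → Fin d → ℤ} (hp : AffIndep p)
    (h : Polynomial ℤ) : HasHStarPolynomial (simplex p) h ↔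
      ∀ n, (Nat.card (boxLevel (simplexLattice p) n) : ℤ) = h.coeff n := by
  have hE : ehrhartSeries (simplex p) =
      PowerSeries.mk (fun n => (Nat.card (boxLevel (simplexLattice p) n) : ℤ)) *
        PowerSeries.mk (fun n => ((d + n).choose d : ℤ)) := by
    ext m
    rw [PowerSeries.coeff_mul]
    simp only [PowerSeries.coeff_mk, ehrhartSeries]
    have h1 := card_coneLevel hp m
    split_ifs with hm
    · subst hm
      have : coneLevel (simplexLattice p) 0 = {0} := by
        ext x
        constructor
        · rintro ⟨_, hx0, hx1⟩
          exact funext fun i => (Finset.sum_eq_zero_iff_of_nonneg fun i _ => hx0 i).1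
            (by simpa using hx1) i (Finset.mem_univ i)
        · rintro rfl
          exact ⟨AddSubgroup.zero_mem _, fun i => le_rfl, by simp⟩
      rw [this] at h1
      simp only [Nat.card_unique] at h1
      exact_mod_cast h1
    · rw [latticePointCount_simplex hp, h1]
      push_cast
      rfl
  rw [HasHStarPolynomial, hE, mul_assoc]
  have := PowerSeries.mk_add_choose_mul_one_sub_pow_eq_one (S := ℤ) d
  rw [this, mul_one, PowerSeries.ext_iff]
  simp

theorem coeff_stepPolynomial (v : ℕ) {k : ℕ} (hk : 1 ≤ k) (n : ℕ) :
    (stepPolynomial v k).coeff n = if ∃ j < v, n = j * k then 1 else 0 := by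
  rw [stepPolynomial, Polynomial.finsetSum_coeff]
  simp only [Polynomial.coeff_X_pow]
  split_ifs with h
  · obtain ⟨j, hj, rfl⟩ := h
    rw [Finset.sum_eq_single_of_mem j (Finset.mem_range.2 hj)]
    · simp
    · intro i _ hi
      rw [if_neg]
      intro h
      exact hi (Nat.eq_of_mul_eq_mul_right hk h).symm
  · refine Finset.sum_eq_zero fun j hj => if_neg fun hn => h ⟨j, Finset.mem_range.1 hj, hn⟩

theorem hasHStar_step_iff {p : Fin (d + 1) → Fin d → ℤ} (hp : AffIndep p) (v : ℕ) {k : ℕ}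
    (hk : 1 ≤ k) : HasHStarPolynomial (simplex p) (stepPolynomial v k) ↔
      Stepped 1 k v (simplexLattice p) := by
  rw [hasHStarPolynomial_iff hp]
  have hd : ∀ x : Fin (d + 1) → ℝ, (1 : Fin (d + 1) → ℝ) ⬝ᵥ x = ∑ i, x i := one_dotProduct
  have hmul : ∀ j : ℕ, ((j * k : ℕ) : ℝ) = k * j := fun j => by push_cast; ring
  constructor
  · intro h
    have hone : ∀ n (x y : Fin (d + 1) → ℝ), x ∈ boxLevel (simplexLattice p) n →
        y ∈ boxLevel (simplexLattice p) n → (∃ j < v, n = j * k) ∧ x = y := by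
      intro n x y hx hy
      have h1 := h n
      rw [coeff_stepPolynomial v hk] at h1
      have hf : Finite (boxLevel (simplexLattice p) n) := finite_boxLevel hp n
      split_ifs at h1 with hn
      · have h2 : Nat.card (boxLevel (simplexLattice p) n) = 1 := by exact_mod_cast h1
        have h3 := (Nat.card_eq_one_iff_unique.1 h2).1
        exact ⟨hn, congrArg Subtype.val (h3.elim ⟨x, hx⟩ ⟨y, hy⟩)⟩
      · have h2 : Nat.card (boxLevel (simplexLattice p) n) = 0 := by exact_mod_cast h1
        have h3 := Finite.card_eq_zero_iff.1 h2
        exact (h3.false ⟨x, hx⟩).elim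
    have hlev : ∀ x ∈ simplexLattice p, x ∈ unitBox (Fin (d + 1)) →
        ∃ n, x ∈ boxLevel (simplexLattice p) n := by
      intro x hx hb
      obtain ⟨n, hn⟩ := mem_intReal.1 hx.1
      have h0 : (0 : ℝ) ≤ n := by
        rw [hn]
        exact Finset.sum_nonneg fun i _ => (hb i).1
      obtain ⟨m, rfl⟩ := Int.eq_ofNat_of_zero_le (by exact_mod_cast h0 : 0 ≤ n)
      exact ⟨m, hx, hb, by rw [← hn]; simp⟩
    refine ⟨fun x hx hb => ?_, fun j hj => ?_, fun x hx hb y hy hb' hxy => ?_⟩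
    · obtain ⟨n, hn⟩ := hlev x hx hb
      obtain ⟨⟨j, hj, rfl⟩, _⟩ := hone n x x hn hn
      exact ⟨j, hj, by rw [hd, hn.2.2, hmul]⟩
    · have h1 := h (j * k)
      rw [coeff_stepPolynomial v hk, if_pos ⟨j, hj, rfl⟩] at h1
      have h2 : Nat.card (boxLevel (simplexLattice p) (j * k)) = 1 := by exact_mod_cast h1
      obtain ⟨⟨x, hx⟩⟩ := (Nat.card_eq_one_iff_unique.1 h2).2
      exact ⟨x, hx.1, hx.2.1, by rw [hd, hx.2.2, hmul]⟩
    · obtain ⟨n, hn⟩ := hlev x hx hb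
      rw [hd, hd] at hxy
      exact (hone n x y hn ⟨hy, hb', hxy ▸ hn.2.2⟩).2
  · intro h n
    rw [coeff_stepPolynomial v hk]
    split_ifs with hn
    · obtain ⟨j, hj, rfl⟩ := hn
      obtain ⟨x, hx, hb, hw⟩ := h.exists_mem j hj
      have : Nat.card (boxLevel (simplexLattice p) (j * k)) = 1 := by
        refine Nat.card_eq_one_iff_unique.2 ⟨⟨fun y z => Subtype.ext ?_⟩,
          ⟨x, hx, hb, by rw [← hd, hw, hmul]⟩⟩
        exact h.injOn _ y.2.1 y.2.2.1 _ z.2.1 z.2.2.1 (by rw [hd, hd, y.2.2.2, z.2.2.2])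
      rw [this]
      rfl
    · have : IsEmpty (boxLevel (simplexLattice p) n) := ⟨fun x => by
        obtain ⟨j, hj, hw⟩ := h.exists_index _ x.2.1 x.2.2.1
        rw [hd, x.2.2.2, ← hmul] at hw
        exact hn ⟨j, hj, by exact_mod_cast hw⟩⟩
      rw [Nat.card_of_isEmpty]
      rfl

end

/-! ### Unimodular equivalence in terms of barycentric lattices. -/

section

/-- If the convex hull of `b` is a simplex with vertices `a`, then `a` is a permutation of `b`. -/
theorem exists_perm_of_convexHull_eq {ι E : Type*} [Fintype ι] [AddCommGroup E] [Module ℝ E]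
    {a b : ι → E} (ha : AffineIndependent ℝ a)
    (h : convexHull ℝ (Set.range a) = convexHull ℝ (Set.range b)) :
    ∃ σ : Equiv.Perm ι, ∀ i, b (σ i) = a i := by
  classical
  have hb : ∀ j, ∃ t : ι → ℝ, (∀ l, 0 ≤ t l) ∧ ∑ l, t l = 1 ∧ ∑ l, t l • a l = b j := fun j =>
    mem_convexHull_range.1 (h ▸ subset_convexHull ℝ _ ⟨j, rfl⟩)
  choose t ht0 ht1 ht using hb
  have key : ∀ i, ∃ j, b j = a i := by
    intro i
    obtain ⟨w, hw0, hw1, hw⟩ := mem_convexHull_range.1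
      (h ▸ subset_convexHull ℝ _ ⟨i, rfl⟩ : a i ∈ convexHull ℝ (Set.range b))
    obtain ⟨j, hj⟩ : ∃ j, 0 < w j := by
      by_contra! hcon
      have := Finset.sum_nonpos fun j (_ : j ∈ Finset.univ) => hcon j
      linarith
    refine ⟨j, ?_⟩
    -- Expanding each `b j` in the vertices `a` writes `a i` as a convex combination of them, which
    -- must be the trivial one. All terms being nonnegative, any `b j` of positive weight has all
    -- its mass at `a i`.
    have hc := affineIndependent_iff.1 ha Finset.univ
      (fun l => ∑ j, w j * t j l - if l = i then 1 else 0) (by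
        rw [Finset.sum_sub_distrib, Finset.sum_comm]
        simp [← Finset.mul_sum, ht1, hw1]) (by
        simp only [sub_smul, Finset.sum_smul, Finset.sum_sub_distrib, ite_smul, one_smul,
          zero_smul, Finset.sum_ite_eq', Finset.mem_univ, if_true]
        rw [Finset.sum_comm]
        simp only [mul_smul, ← Finset.smul_sum, ht, hw, sub_self])
    have h0 : ∀ l, l ≠ i → t j l = 0 := fun l hl => by
      have h1 := hc l (Finset.mem_univ l)
      rw [if_neg hl, sub_zero] at h1
      have h2 := (Finset.sum_eq_zero_iff_of_nonneg fun j _ =>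
        mul_nonneg (hw0 j) (ht0 j l)).1 h1 j (Finset.mem_univ j)
      exact (mul_eq_zero.1 h2).resolve_left hj.ne'
    have h1 : t j i = 1 := by
      rw [← ht1 j, Finset.sum_eq_single i (fun l _ hl => h0 l hl) (by simp)]
    rw [← ht j, Finset.sum_eq_single i (fun l _ hl => by rw [h0 l hl, zero_smul]) (by simp), h1,
      one_smul]
  choose σ hσ using key
  have hinj : Function.Injective σ := fun i i' hii => ha.injective (by rw [← hσ, ← hσ, hii])
  exact ⟨Equiv.ofBijective σ (Finite.injective_iff_bijective.1 hinj), hσ⟩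

variable {d : ℕ}

theorem latticeVec_injective : Function.Injective (latticeVec (d := d)) := fun z z' h => by
  ext j
  have := congrFun h j
  simpa [latticeVec] using this

theorem latticeVec_vecMul_add (U : Matrix (Fin d) (Fin d) ℤ) (w z : Fin d → ℤ) :
    latticeVec (Matrix.vecMul z U + w) = affineLatticeMap U w (latticeVec z) := by
  ext i
  simp [affineLatticeMap, latticeVec, Matrix.vecMul, dotProduct]

theorem image_convexHull_affineLatticeMap (U : Matrix (Fin d) (Fin d) ℤ) (w : Fin d → ℤ)
    (s : Set (Fin d → ℝ)) :
    affineLatticeMap U w '' convexHull ℝ s = convexHull ℝ (affineLatticeMap U w '' s) :=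
  AffineMap.image_convexHull ((Matrix.vecMulLinear (U.map fun a : ℤ => (a : ℝ))).toAffineMap +
    AffineMap.const ℝ (Fin d → ℝ) (latticeVec w)) s

theorem vecMul_mem_intReal (U : Matrix (Fin d) (Fin d) ℤ) {y : Fin d → ℝ}
    (hy : ∀ j, y j ∈ intReal) (j : Fin d) :
    Matrix.vecMul y (U.map fun a : ℤ => (a : ℝ)) j ∈ intReal :=
  intReal.sum_mem (t := Finset.univ) (f := fun i => y i * (U i j : ℝ))
    fun i _ => intReal_mul_mem (hy i) (intCast_mem_intReal _)

theorem combo_comp_perm (p : Fin (d + 1) → Fin d → ℤ) (σ : Equiv.Perm (Fin (d + 1)))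
    (x : Fin (d + 1) → ℝ) : combo (p ∘ σ) x = combo p (x ∘ σ.symm) := by
  rw [combo_eq_sum, combo_eq_sum, ← Equiv.sum_comp σ.symm]
  simp

theorem combo_affineLatticeMap {p q : Fin (d + 1) → Fin d → ℤ} {U : Matrix (Fin d) (Fin d) ℤ}
    {w : Fin d → ℤ} (h : ∀ i, latticeVec (q i) = affineLatticeMap U w (latticeVec (p i)))
    (x : Fin (d + 1) → ℝ) :
    combo q x = Matrix.vecMul (combo p x) (U.map fun a : ℤ => (a : ℝ)) +
      (∑ i, x i) • latticeVec w := by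
  simp only [combo_eq_sum, h, affineLatticeMap, smul_add, Finset.sum_add_distrib,
    Finset.sum_smul]
  congr 1
  have := map_sum (Matrix.vecMulLinear (U.map fun a : ℤ => (a : ℝ)))
    (fun i => x i • latticeVec (p i)) Finset.univ
  simp only [map_smul] at this
  exact this.symm

theorem map_mul_map_inv {U : Matrix (Fin d) (Fin d) ℤ} (hU : IsUnit U.det) :
    U.map (fun a : ℤ => (a : ℝ)) * U⁻¹.map (fun a : ℤ => (a : ℝ)) = 1 := by
  have h := congrArg (fun A => A.map (Int.castRingHom ℝ)) (Matrix.mul_nonsing_inv U hU)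
  simp only [Matrix.map_mul] at h
  rw [Matrix.map_one _ (map_zero _) (map_one _)] at h
  exact h

theorem exists_perm_of_unimodularlyEquivalent {p q : Fin (d + 1) → Fin d → ℤ} (hq : AffIndep q)
    (h : UnimodularlyEquivalent (simplex p) (simplex q)) : ∃ σ : Equiv.Perm (Fin (d + 1)),
      ∀ x, x ∈ simplexLattice q ↔ x ∘ σ ∈ simplexLattice p := by
  obtain ⟨U, w, hU, hqp⟩ := h
  rw [simplex, simplex, image_convexHull_affineLatticeMap, ← Set.range_comp] at hqp
  obtain ⟨σ, hσ⟩ := exists_perm_of_convexHull_eq hq hqp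
  refine ⟨σ.symm, fun x => ?_⟩
  have hc := combo_affineLatticeMap (p := p ∘ σ) (q := q) (fun i => (hσ i).symm) x
  rw [combo_comp_perm] at hc
  have hs : ∑ i, (x ∘ σ.symm) i = ∑ i, x i := Equiv.sum_comp σ.symm x
  rw [mem_simplexLattice, mem_simplexLattice, hs]
  refine and_congr_right fun hx => ⟨fun h => ?_, fun h j => ?_⟩
  · have h1 : combo p (x ∘ σ.symm) = Matrix.vecMul (combo q x - (∑ i, x i) • latticeVec w)
        (U⁻¹.map fun a : ℤ => (a : ℝ)) := by
      rw [hc, add_sub_cancel_right, Matrix.vecMul_vecMul, map_mul_map_inv hU, Matrix.vecMul_one]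
    rw [h1]
    exact vecMul_mem_intReal _ fun j => intReal.sub_mem (h j)
      (intReal_mul_mem hx (intCast_mem_intReal _))
  · rw [hc]
    exact intReal.add_mem (vecMul_mem_intReal _ h j) (intReal_mul_mem hx (intCast_mem_intReal _))

/-- The rows of `U` are the `q`-images of the level-0 coordinates of the standard basis vectors with
respect to `p`, and `w` is the image of the level-1 coordinates of the origin. All these lie in the
lattice of `p`, so the inclusion makes `U` and `w` integral. -/
theorem exists_matrix_of_le {p q : Fin (d + 1) → Fin d → ℤ} (hp : AffIndep p)
    (h : simplexLattice p ≤ simplexLattice q) :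
    ∃ (U : Matrix (Fin d) (Fin d) ℤ) (w : Fin d → ℤ), ∀ x : Fin (d + 1) → ℝ,
      combo q x = Matrix.vecMul (combo p x) (U.map fun a : ℤ => (a : ℝ)) +
        (∑ i, x i) • latticeVec w := by
  choose X hX0 hX using fun j : Fin d => hp.exists_eq 0 (Pi.single j 1)
  obtain ⟨Y, hY1, hY⟩ := hp.exists_eq 1 0
  have hXL : ∀ j, X j ∈ simplexLattice q := fun j => h ⟨by rw [hX0]; exact intReal.zero_mem,
    fun l => by
      rw [hX]
      by_cases hl : l = j
      · rw [hl, Pi.single_eq_same]; exact one_mem_intReal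
      · rw [Pi.single_eq_of_ne hl]; exact intReal.zero_mem⟩
  have hYL : Y ∈ simplexLattice q := h ⟨by rw [hY1]; exact one_mem_intReal,
    fun l => by rw [hY]; exact intReal.zero_mem⟩
  choose U hU using fun j l => mem_intReal.1 ((hXL j).2 l)
  choose w hw using fun l => mem_intReal.1 (hYL.2 l)
  refine ⟨U, w, fun x => ?_⟩
  have hx : x = ∑ j, combo p x j • X j + (∑ i, x i) • Y := by
    refine hp.eq ?_ ?_
    · simp only [Pi.add_apply, Finset.sum_apply, Pi.smul_apply, smul_eq_mul,
        Finset.sum_add_distrib, ← Finset.mul_sum, hY1, mul_one]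
      rw [Finset.sum_comm]
      simp [← Finset.mul_sum, hX0]
    · ext l
      simp [hX, hY, Finset.sum_apply, Pi.single_apply]
  conv_lhs => rw [hx]
  ext l
  simp only [map_add, map_sum, map_smul, Pi.add_apply, Finset.sum_apply, Pi.smul_apply,
    smul_eq_mul, ← hU, ← hw]
  rfl

theorem unimodularlyEquivalent_of_eq {p q : Fin (d + 1) → Fin d → ℤ} (hp : AffIndep p)
    (hq : AffIndep q) (h : simplexLattice p = simplexLattice q) :
    UnimodularlyEquivalent (simplex p) (simplex q) := by
  obtain ⟨U, w, hU⟩ := exists_matrix_of_le hp h.le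
  obtain ⟨V, u, hV⟩ := exists_matrix_of_le hq h.ge
  have hUV : U * V = 1 := by
    ext i j
    obtain ⟨x, hx0, hx⟩ := hp.exists_eq 0 (Pi.single i 1)
    have h1 := hV x
    rw [hU x, hx0, hx, zero_smul, zero_smul, add_zero, add_zero, Matrix.vecMul_vecMul] at h1
    have h2 := congrFun h1 j
    rw [Matrix.single_one_vecMul] at h2
    have h3 : (((U * V) i j : ℤ) : ℝ) = ((1 : Matrix (Fin d) (Fin d) ℤ) i j : ℤ) := by
      simp only [Matrix.mul_apply, Int.cast_sum, Int.cast_mul]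
      refine (h2.symm.trans ?_)
      simp [Matrix.one_apply, Pi.single_apply, eq_comm]
    exact_mod_cast h3
  refine ⟨U, w, Matrix.isUnit_det_of_right_inverse hUV, ?_⟩
  ext y
  simp only [Set.mem_image, mem_simplex]
  constructor
  · rintro ⟨x, hx0, hx1, rfl⟩
    exact ⟨_, ⟨x, hx0, hx1, rfl⟩, by rw [hU, hx1, one_smul]; rfl⟩
  · rintro ⟨_, ⟨x, hx0, hx1, rfl⟩, rfl⟩
    exact ⟨x, hx0, hx1, by rw [hU, hx1, one_smul]; rfl⟩

theorem unimodularlyEquivalent_of_perm {p q : Fin (d + 1) → Fin d → ℤ} (hp : AffIndep p)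
    (hq : AffIndep q) (σ : Equiv.Perm (Fin (d + 1)))
    (h : ∀ x, x ∈ simplexLattice q ↔ x ∘ σ ∈ simplexLattice p) :
    UnimodularlyEquivalent (simplex p) (simplex q) := by
  have h1 : simplex (p ∘ σ.symm) = simplex p := by
    rw [simplex, simplex]
    congr 1
    exact σ.symm.surjective.range_comp fun i => latticeVec (p i)
  have hs : ∀ x : Fin (d + 1) → ℝ, ∑ i, (x ∘ σ) i = ∑ i, x i := fun x => Equiv.sum_comp σ x
  have hc : ∀ x, combo (p ∘ σ.symm) x = combo p (x ∘ σ) := fun x => by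
    rw [combo_comp_perm, Equiv.symm_symm]
  have hp' : AffIndep (p ∘ σ.symm) := affIndep_iff.2 fun x hx hx' => by
    have := affIndep_iff.1 hp (x ∘ σ) (by rw [hs, hx]) (by rw [← hc, hx'])
    ext i
    simpa using congrFun this (σ.symm i)
  rw [← h1]
  refine unimodularlyEquivalent_of_eq hp' hq ?_
  ext x
  rw [h, mem_simplexLattice, mem_simplexLattice, hs, hc]

/-- Every overlattice of `ℤ^(d+1)` with bounded denominators and integral coordinate sums is the
lattice of barycentric coordinates of a lattice simplex. -/
theorem exists_simplexLattice_eq {L : AddSubgroup (Fin (d + 1) → ℝ)}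
    (hL : stdLattice (Fin (d + 1)) ≤ L) (hs : ∀ x ∈ L, ∑ i, x i ∈ intReal) {N : ℕ} (hN : N ≠ 0)
    (hNL : ∀ x ∈ L, ∀ i, (N : ℝ) * x i ∈ intReal) :
    ∃ p : Fin (d + 1) → Fin d → ℤ, AffIndep p ∧ simplexLattice p = L := by
  let ψ : (Fin d → ℝ) →+ (Fin (d + 1) → ℝ) :=
    { toFun := fun y => Fin.cons (-∑ i, y i) y
      map_zero' := by ext i; cases i using Fin.cases <;> simp
      map_add' := fun x y => by
        ext i
        cases i using Fin.cases with
        | zero => simp [Finset.sum_add_distrib, add_comm]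
        | succ i => simp }
  -- `M` is the level-0 part of `L` with the first coordinate dropped. With the first vertex at the
  -- origin and the others at the standard basis vectors, it is the lattice to be identified with
  -- ℤ^d.
  let M : Submodule ℤ (Fin d → ℝ) := AddSubgroup.toIntSubmodule (L.comap ψ)
  have hM : ∀ y, y ∈ M ↔ (Fin.cons (-∑ i, y i) y : Fin (d + 1) → ℝ) ∈ L := fun y => Iff.rfl
  have hint : ∀ y : Fin d → ℝ, (∀ i, y i ∈ intReal) → y ∈ M := fun y hy => by
    refine (hM y).2 (hL fun i => ?_)
    cases i using Fin.cases with
    | zero => exact intReal.neg_mem (intReal.sum_mem fun i _ => hy i)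
    | succ i => exact hy i
  have hsingle : ∀ i : Fin d, (Pi.single i 1 : Fin d → ℝ) ∈ M := fun i => hint _ fun j => by
    by_cases hj : j = i
    · rw [hj, Pi.single_eq_same]; exact one_mem_intReal
    · rw [Pi.single_eq_of_ne hj]; exact intReal.zero_mem
  have hdisc : DiscreteTopology M := by
    let B := Pi.basisFun ℝ (Fin d)
    -- The common denominator embeds `M` in the standard lattice, whence it is discrete.
    have hmem : ∀ y : M, (N : ℝ) • (y : Fin d → ℝ) ∈ Submodule.span ℤ (Set.range B) := by
      intro y
      rw [B.mem_span_iff_repr_mem ℤ]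
      intro i
      obtain ⟨n, hn⟩ := mem_intReal.1 (hNL _ ((hM y).1 y.2) i.succ)
      exact ⟨n, by simpa [B] using hn⟩
    refine DiscreteTopology.of_continuous_injective
      (f := fun y : M => (⟨(N : ℝ) • (y : Fin d → ℝ), hmem y⟩ :
        Submodule.span ℤ (Set.range B))) (by fun_prop) fun y z hyz => ?_
    have := congrArg Subtype.val hyz
    exact Subtype.ext (smul_right_injective _ (by exact_mod_cast hN : (N : ℝ) ≠ 0) this)
  have hlat : IsZLattice ℝ M := ⟨by
    rw [eq_top_iff, ← (Pi.basisFun ℝ (Fin d)).span_eq]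
    refine Submodule.span_mono ?_
    rintro _ ⟨i, rfl⟩
    simpa using hsingle i⟩
  let b := (IsZLattice.basis M).ofZLatticeBasis ℝ M
  have hb : ∀ y, y ∈ M ↔ ∀ j, b.repr y j ∈ intReal := fun y => by
    rw [← Module.Basis.ofZLatticeBasis_span ℝ M (IsZLattice.basis M),
      Module.Basis.mem_span_iff_repr_mem]
    rfl
  choose P hP using fun i j => mem_intReal.1 ((hb _).1 (hsingle i) j)
  -- The vertices are the origin and the standard basis vectors, written in a ℤ-basis of `M`.
  let p : Fin (d + 1) → Fin d → ℤ := Fin.cons 0 P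
  have hc : ∀ (x : Fin (d + 1) → ℝ) j, combo p x j = b.repr (fun i : Fin d => x i.succ) j := by
    intro x j
    have hx : (fun i : Fin d => x i.succ) = ∑ i : Fin d, x i.succ • (Pi.single i 1 : Fin d → ℝ) := by
      ext l
      simp [Finset.sum_apply, Pi.single_apply]
    rw [hx, combo_apply, Fin.sum_univ_succ]
    simp [p, hP]
  refine ⟨p, affIndep_iff.2 fun x hx0 hx => ?_, ?_⟩
  · have h1 : (fun i : Fin d => x i.succ) = 0 := by
      refine b.repr.injective (Finsupp.ext fun j => ?_)
      rw [← hc, hx, map_zero]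
      rfl
    have h2 : ∀ i : Fin d, x i.succ = 0 := fun i => congrFun h1 i
    rw [Fin.sum_univ_succ] at hx0
    simp only [h2, Finset.sum_const_zero, add_zero] at hx0
    ext i
    cases i using Fin.cases with
    | zero => exact hx0
    | succ i => exact h2 i
  · ext x
    have hx : ∀ x : Fin (d + 1) → ℝ, ∑ i, x i ∈ intReal →
        (x ∈ L ↔ (fun i : Fin d => x i.succ) ∈ M) := by
      intro x hx
      have hsub : ∀ i, x i - (Fin.cons (-∑ i : Fin d, x i.succ) fun i => x i.succ :
          Fin (d + 1) → ℝ) i ∈ intReal := fun i => by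
        cases i using Fin.cases with
        | zero => simpa [Fin.sum_univ_succ] using hx
        | succ i => simp [intReal.zero_mem]
      rw [hM]
      exact ⟨mem_of_sub_mem_stdLattice hL fun i => sub_mem_intReal_symm (hsub i),
        mem_of_sub_mem_stdLattice hL hsub⟩
    rw [mem_simplexLattice]
    simp only [hc, ← hb]
    exact ⟨fun h => (hx x h.1).2 h.2, fun h => ⟨hs x h, (hx x (hs x h)).1 h⟩⟩

/-- Pigeonhole: among K + 1 multiples of x two agree modulo ℤ, where K counts the cube vectors. So a
positive multiple of x by at most K is integral, and K! works for all x. -/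
theorem exists_common_denominator {I : Type*} {L : AddSubgroup (I → ℝ)}
    (hL : stdLattice I ≤ L) (hfin : {x | x ∈ L ∧ x ∈ unitBox I}.Finite) :
    ∃ N : ℕ, N ≠ 0 ∧ ∀ x ∈ L, ∀ i, (N : ℝ) * x i ∈ intReal := by
  classical
  set K := hfin.toFinset.card with hK
  refine ⟨K !, Nat.factorial_ne_zero K, fun x hx i => ?_⟩
  obtain ⟨a, ha, b, hb, hab, hfr⟩ := Finset.exists_ne_map_eq_of_card_lt_of_maps_to
    (s := Finset.range (K + 1)) (t := hfin.toFinset) (by simp [hK])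
    (f := fun n i => Int.fract (((n : ℝ) • x) i)) (fun n _ => by
      simp only [Set.Finite.coe_toFinset, Set.mem_ofPred_eq]
      refine ⟨fract_mem_of_mem hL ?_, fract_mem_unitBox _⟩
      rw [Nat.cast_smul_eq_nsmul]
      exact L.nsmul_mem hx n)
  wlog hlt : a < b generalizing a b
  · exact this b hb a ha hab.symm hfr.symm (lt_of_le_of_ne (not_lt.1 hlt) hab.symm)
  have h1 : ((b - a : ℕ) : ℝ) * x i ∈ intReal := by
    have h2 := sub_mem_intReal_trans (sub_fract_mem_intReal ((b : ℝ) * x i))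
      (sub_mem_intReal_symm (y := Int.fract ((b : ℝ) * x i)) (x := (a : ℝ) * x i) (by
        have h3 := congrFun hfr i
        simp only [Pi.smul_apply, smul_eq_mul] at h3
        rw [← h3]
        exact sub_fract_mem_intReal _))
    rw [Nat.cast_sub hlt.le, sub_mul]
    exact h2
  obtain ⟨c, hc⟩ := Nat.dvd_factorial (Nat.sub_pos_of_lt hlt)
    (by simp only [Finset.mem_range] at hb; omega : b - a ≤ K)
  rw [hc]
  have := intReal_mul_mem (natCast_mem_intReal c) h1
  convert this using 1
  push_cast
  ring

end

section

/-! ### Pyramids and integral coordinates. -/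

section Pyramid

variable {d : ℕ}

/-- The apex of a pyramid. -/
def apex (d : ℕ) : Fin (d + 1) → ℝ := Fin.snoc (0 : Fin d → ℝ) 1

theorem apex_last (d : ℕ) : apex d (Fin.last d) = 1 := by simp [apex]

theorem pyramid_height {Q : Set (Fin d → ℝ)} {y : Fin (d + 1) → ℝ} (hy : y ∈ pyramid Q) :
    0 ≤ y (Fin.last d) ∧ y (Fin.last d) ≤ 1 ∧ (y (Fin.last d) = 1 → y = apex d) := by
  refine (convexHull_min (t := {y : Fin (d + 1) → ℝ | 0 ≤ y (Fin.last d) ∧ y (Fin.last d) ≤ 1 ∧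
    (y (Fin.last d) = 1 → y = apex d)}) ?_ ?_) hy
  · rintro _ (⟨x, _, rfl⟩ | rfl)
    · simp
    · simp [apex]
  · rintro x ⟨hx0, hx1, hx⟩ y ⟨hy0, hy1, hy⟩ a b ha hb hab
    simp only [Set.mem_ofPred_eq, Pi.add_apply, Pi.smul_apply, smul_eq_mul]
    refine ⟨by positivity, by nlinarith, fun h => ?_⟩
    rcases ha.eq_or_lt with rfl | ha'
    · have : b = 1 := by linarith
      subst this
      rw [zero_smul, zero_add, one_smul]
      exact hy (by linarith)
    · rcases hb.eq_or_lt with rfl | hb'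
      · have : a = 1 := by linarith
        subst this
        rw [zero_smul, add_zero, one_smul]
        exact hx (by linarith)
      · have h1 : x (Fin.last d) = 1 := by nlinarith
        have h2 : y (Fin.last d) = 1 := by nlinarith
        rw [hx h1, hy h2, ← add_smul, hab, one_smul]

theorem AffIndep.injective {p : Fin (d + 1) → Fin d → ℤ} (hp : AffIndep p) :
    Function.Injective p := fun _ _ hij =>
  AffineIndependent.injective hp (congrArg latticeVec hij)

/-- In pyramid position the apex is a vertex, since it is the only point of height 1. The other
vertices have integral height in [0, 1), that is 0, so the barycentric coordinate at the apex is the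
height function, which is integral on lattice points. -/
theorem exists_integral_coord {p : Fin (d + 1) → Fin d → ℤ} (hp : AffIndep p)
    (h : IsLatticePyramid (simplex p)) : ∃ a, ∀ x ∈ simplexLattice p, x a ∈ intReal := by
  cases d with
  | zero => exact h.elim
  | succ d =>
    obtain ⟨Q, -, hQ⟩ := h
    obtain ⟨V, u, hV, hVu⟩ := hQ.symm
    let r : Fin (d + 2) → Fin (d + 1) → ℤ := fun i => Matrix.vecMul (p i) V + u
    have hr : ∀ i, latticeVec (r i) = affineLatticeMap V u (latticeVec (p i)) := fun i =>
      latticeVec_vecMul_add V u (p i)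
    have hpyr : pyramid Q = simplex r := by
      rw [hVu, simplex, image_convexHull_affineLatticeMap, ← Set.range_comp, simplex]
      congr 2
      exact funext fun i => (hr i).symm
    have hrinj : Function.Injective r := fun i j hij => by
      have h1 := congrArg (fun z => Matrix.vecMul z V⁻¹) (add_right_cancel hij)
      simp only [Matrix.vecMul_vecMul, Matrix.mul_nonsing_inv V hV, Matrix.vecMul_one] at h1
      exact hp.injective h1
    have hmem : ∀ i, latticeVec (r i) ∈ pyramid Q := fun i =>
      hpyr ▸ subset_convexHull ℝ _ ⟨i, rfl⟩
    have hap : apex d ∈ pyramid Q := subset_convexHull ℝ _ (Or.inr rfl)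
    rw [hpyr] at hap
    obtain ⟨w, hw0, hw1, hw⟩ := mem_simplex.1 hap
    obtain ⟨a, ha⟩ : ∃ a, latticeVec (r a) = apex d := by
      by_contra! hcon
      have hlt : ∀ i, latticeVec (r i) (Fin.last d) < 1 := fun i =>
        lt_of_le_of_ne (pyramid_height (hmem i)).2.1
          fun he => hcon i ((pyramid_height (hmem i)).2.2 he)
      have h1 := congrFun hw (Fin.last d)
      rw [combo_apply, apex_last] at h1
      obtain ⟨j, hj⟩ : ∃ j, 0 < w j := by
        by_contra! hcon
        have := Finset.sum_nonpos fun j (_ : j ∈ Finset.univ) => hcon j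
        linarith
      have h2 : ∑ i, w i * (r i (Fin.last d) : ℝ) < ∑ i, w i :=
        Finset.sum_lt_sum (fun i _ => mul_le_of_le_one_right (hw0 i) (hlt i).le)
          ⟨j, Finset.mem_univ j, mul_lt_of_lt_one_right hj (hlt j)⟩
      linarith
    have hone : (r a (Fin.last d) : ℝ) = 1 := by
      have := congrFun ha (Fin.last d)
      rwa [apex_last] at this
    have hzero : ∀ i, i ≠ a → (r i (Fin.last d) : ℝ) = 0 := fun i hi => by
      obtain ⟨h0, h1, h2⟩ := pyramid_height (hmem i)
      refine eq_zero_of_mem_intReal (intCast_mem_intReal _) (by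
        change 0 ≤ (r i (Fin.last d) : ℝ) at h0; linarith) (lt_of_le_of_ne h1 fun he => hi ?_)
      exact hrinj (latticeVec_injective ((h2 he).trans ha.symm))
    refine ⟨a, fun x hx => ?_⟩
    have h1 : combo r x (Fin.last d) = x a := by
      rw [combo_apply, Finset.sum_eq_single a (fun i _ hi => by rw [hzero i hi, mul_zero])
        (by simp), hone, mul_one]
    rw [← h1, combo_affineLatticeMap hr]
    exact intReal.add_mem (vecMul_mem_intReal _ hx.2 _)
      (intReal_mul_mem hx.1 (intCast_mem_intReal _))

/-- Integrality splits the lattice as ℤ in the direction `a` times its part with `x a = 0`. The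
latter is realized by a simplex `q` of one dimension less, and the pyramid over `q` has the same
barycentric lattice as `p`. -/
theorem isLatticePyramid_of_integral_coord {p : Fin (d + 2) → Fin (d + 1) → ℤ} (hp : AffIndep p)
    {a : Fin (d + 2)} (ha : ∀ x ∈ simplexLattice p, x a ∈ intReal) :
    IsLatticePyramid (simplex p) := by
  let ins : (Fin (d + 1) → ℝ) →+ (Fin (d + 2) → ℝ) :=
    { toFun := fun y => a.insertNth 0 y
      map_zero' := by ext i; cases i using a.succAboveCases <;> simp
      map_add' := fun x y => by ext i; cases i using a.succAboveCases <;> simp }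
  have hins0 : ∀ y, ins y a = 0 := fun y => by simp [ins]
  have hins1 : ∀ y i, ins y (a.succAbove i) = y i := fun y i => by simp [ins]
  have hstd := stdLattice_le_simplexLattice p
  obtain ⟨N, hN, hNp⟩ := exists_common_denominator hstd (finite_simplexLattice_box hp)
  obtain ⟨q, hq, hqL⟩ := exists_simplexLattice_eq (L := (simplexLattice p).comap ins) (N := N)
    (fun y hy => hstd fun i => by
      cases i using a.succAboveCases with
      | x => rw [hins0]; exact intReal.zero_mem
      | p i => rw [hins1]; exact hy i)
    (fun y hy => by
      have h1 := (mem_simplexLattice.1 (AddSubgroup.mem_comap.1 hy)).1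
      rw [Fin.sum_univ_succAbove _ a, hins0, zero_add] at h1
      simpa only [hins1] using h1) hN
    (fun y hy i => by
      have := hNp _ hy (a.succAbove i)
      rwa [hins1] at this)
  let r : Fin (d + 2) → Fin (d + 1) → ℤ := a.insertNth (α := fun _ => Fin (d + 1) → ℤ)
    (Fin.snoc (0 : Fin d → ℤ) 1) (fun i => Fin.snoc (q i) 0)
  have hr0 : r a = Fin.snoc (0 : Fin d → ℤ) 1 := by simp [r]
  have hr1 : ∀ i, r (a.succAbove i) = Fin.snoc (q i) 0 := fun i => by simp [r]
  have hclast : ∀ x, combo r x (Fin.last d) = x a := fun x => by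
    rw [combo_apply, Fin.sum_univ_succAbove _ a, hr0]
    simp [hr1]
  have hccast : ∀ x (j : Fin d), combo r x j.castSucc =
      combo q (fun i => x (a.succAbove i)) j := fun x j => by
    rw [combo_apply, combo_apply, Fin.sum_univ_succAbove _ a, hr0]
    simp [hr1]
  have hr : AffIndep r := affIndep_iff.2 fun x hx0 hx => by
    have h1 : x a = 0 := by rw [← hclast x, hx]; rfl
    rw [Fin.sum_univ_succAbove _ a, h1, zero_add] at hx0
    have h2 := affIndep_iff.1 hq (fun i => x (a.succAbove i)) hx0
      (funext fun j => by rw [← hccast, hx]; rfl)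
    ext i
    cases i using a.succAboveCases with
    | x => exact h1
    | p i => exact congrFun h2 i
  have hL : simplexLattice r = simplexLattice p := by
    have key : ∀ x : Fin (d + 2) → ℝ, x a ∈ intReal →
        (x ∈ simplexLattice r ↔ x ∈ simplexLattice p) := by
      intro x hxa
      have h1 : x ∈ simplexLattice r ↔ (fun i => x (a.succAbove i)) ∈ simplexLattice q := by
        rw [mem_simplexLattice, mem_simplexLattice, Fin.forall_fin_succ', hclast]
        simp only [hccast]
        rw [Fin.sum_univ_succAbove _ a]
        constructor
        · rintro ⟨h1, h2, h3⟩
          exact ⟨by simpa using intReal.sub_mem h1 h3, h2⟩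
        · rintro ⟨h1, h2⟩
          exact ⟨intReal.add_mem hxa h1, h2, hxa⟩
      have h2 : ∀ i, x i - ins (fun i => x (a.succAbove i)) i ∈ intReal := fun i => by
        cases i using a.succAboveCases with
        | x => rwa [hins0, sub_zero]
        | p i => rw [hins1, sub_self]; exact intReal.zero_mem
      rw [h1, hqL, AddSubgroup.mem_comap]
      exact ⟨mem_of_sub_mem_stdLattice hstd h2,
        mem_of_sub_mem_stdLattice hstd fun i => sub_mem_intReal_symm (h2 i)⟩
    ext x
    refine ⟨fun hx => (key x ?_).1 hx, fun hx => (key x (ha x hx)).2 hx⟩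
    rw [← hclast x]
    exact hx.2 _
  refine ⟨simplex q, isLatticePolytope_simplex q, ?_⟩
  have hpyr : pyramid (simplex q) = simplex r := by
    let g : (Fin d → ℝ) →ₗ[ℝ] (Fin (d + 1) → ℝ) :=
      { toFun := fun x => Fin.snoc x 0
        map_add' := fun x y => by ext i; cases i using Fin.lastCases <;> simp
        map_smul' := fun c x => by ext i; cases i using Fin.lastCases <;> simp }
    have hg : ∀ i, latticeVec (r (a.succAbove i)) = g (latticeVec (q i)) := fun i => by
      ext j
      cases j using Fin.lastCases <;> simp [hr1, g, latticeVec]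
    have hga : latticeVec (r a) = Fin.snoc (0 : Fin d → ℝ) 1 := by
      ext j
      cases j using Fin.lastCases <;> simp [hr0, latticeVec]
    change convexHull ℝ (g '' convexHull ℝ _ ∪ _) = _
    rw [LinearMap.image_convexHull, convexHull_convexHull_union_left, simplex]
    congr 1
    ext y
    constructor
    · rintro (⟨_, ⟨i, rfl⟩, rfl⟩ | rfl)
      · exact ⟨a.succAbove i, hg i⟩
      · exact ⟨a, hga⟩
    · rintro ⟨i, rfl⟩
      cases i using a.succAboveCases with
      | x => exact Or.inr hga
      | p i => exact Or.inl ⟨_, ⟨i, rfl⟩, (hg i).symm⟩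
  rw [hpyr]
  exact unimodularlyEquivalent_of_eq hr hp hL

end Pyramid

/-! ### The Gorenstein property from unit fractions. -/

section Gorenstein

variable {d : ℕ}

theorem zero_mem_interior_simplex {p : Fin (d + 1) → Fin d → ℤ} (hp : AffIndep p)
    {w : Fin (d + 1) → ℝ} (hw0 : ∀ i, 0 < w i) (hw1 : ∑ i, w i = 1) (hw : combo p w = 0) :
    (0 : Fin d → ℝ) ∈ interior (simplex p) := by
  let b : AffineBasis (Fin (d + 1)) ℝ (Fin d → ℝ) := ⟨fun i => latticeVec (p i), hp,
    (AffineIndependent.affineSpan_eq_top_iff_card_eq_finrank_add_one hp).2 (by simp)⟩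
  have h0 : Finset.univ.affineCombination ℝ b w = 0 := by
    rw [Finset.univ.affineCombination_eq_linear_combination b w hw1]
    exact hw
  have h1 : simplex p = convexHull ℝ (Set.range b) := rfl
  rw [h1, AffineBasis.interior_convexHull]
  intro i
  rw [← h0, b.coord_apply_combination_of_mem (Finset.mem_univ i) hw1]
  exact hw0 i

/-- The unit fractions are the coordinates, at level r = ∑ 1/n_i, of an interior lattice point c of
the r-th dilate. After translating c to the origin, each facet lies at height 1 for an integral
normal, so the dual is a lattice simplex. -/
theorem isGorenstein_simplex {p : Fin (d + 1) → Fin d → ℤ} (hp : AffIndep p)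
    {n : Fin (d + 1) → ℕ} (hn : ∀ i, 1 ≤ n i)
    (hmem : (fun i => (1 / n i : ℝ)) ∈ simplexLattice p)
    (hint : ∀ x ∈ simplexLattice p, ∀ i, (n i : ℝ) * x i ∈ intReal) :
    IsGorenstein (simplex p) := by
  have hn0 : ∀ i, (0 : ℝ) < n i := fun i => by exact_mod_cast hn i
  have hpos : ∀ i, (0 : ℝ) < 1 / n i := fun i => by have := hn0 i; positivity
  obtain ⟨r, hr⟩ : ∃ r : ℕ, ∑ i, (1 / n i : ℝ) = r := by
    obtain ⟨z, hz⟩ := mem_intReal.1 hmem.1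
    have h0 : (0 : ℝ) ≤ z := by
      rw [hz]
      exact Finset.sum_nonneg fun i _ => (hpos i).le
    obtain ⟨r, rfl⟩ := Int.eq_ofNat_of_zero_le (by exact_mod_cast h0 : 0 ≤ z)
    exact ⟨r, by rw [← hz]; simp⟩
  have hr0 : (0 : ℝ) < r := by
    rw [← hr]
    exact Finset.sum_pos (fun i _ => hpos i) Finset.univ_nonempty
  choose c hc using fun j => mem_intReal.1 (hmem.2 j)
  have hc' : combo p (fun i => (1 / n i : ℝ)) = latticeVec c := funext fun j => (hc j).symm
  let v : Fin (d + 1) → Fin d → ℤ := fun i j => r * p i j - c j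
  have hcv : ∀ x, combo v x = (r : ℝ) • combo p x - (∑ i, x i) • latticeVec c := fun x => by
    ext j
    simp only [combo_apply, Pi.sub_apply, Pi.smul_apply, smul_eq_mul, Finset.mul_sum,
      Finset.sum_mul, ← Finset.sum_sub_distrib]
    refine Finset.sum_congr rfl fun i _ => ?_
    simp only [v, latticeVec]
    push_cast
    ring
  have hv : AffIndep v := affIndep_iff.2 fun x hx0 hx => by
    rw [hcv, hx0, zero_smul, sub_zero] at hx
    exact affIndep_iff.1 hp x hx0 ((smul_eq_zero.1 hx).resolve_left hr0.ne')
  have hcv0 : combo v (fun i => (1 / n i : ℝ)) = 0 := by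
    rw [hcv, hc', hr, sub_self]
  choose X hX0 hX using fun j : Fin d => hp.exists_eq 0 (Pi.single j 1)
  have hXmem : ∀ j, X j ∈ simplexLattice p := fun j =>
    ⟨by rw [hX0]; exact intReal.zero_mem, fun l => by
      rw [hX]
      by_cases hl : l = j
      · rw [hl, Pi.single_eq_same]; exact one_mem_intReal
      · rw [Pi.single_eq_of_ne hl]; exact intReal.zero_mem⟩
  -- `u i` is -n_i times the linear part of the i-th barycentric coordinate: the normal of the facet
  -- opposite the i-th vertex.
  choose u hu using fun i j => mem_intReal.1 (intReal.neg_mem (hint _ (hXmem j) i))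
  have hexp : ∀ x : Fin (d + 1) → ℝ, ∑ i, x i = 0 → x = ∑ j, combo p x j • X j := fun x hx => by
    refine hp.eq ?_ ?_
    · simp only [Finset.sum_apply, Pi.smul_apply, smul_eq_mul]
      rw [Finset.sum_comm]
      simp [← Finset.mul_sum, hX0, hx]
    · ext l
      simp [hX, Finset.sum_apply, Pi.single_apply]
  have hpair : ∀ i l, latticeVec (v i) ⬝ᵥ latticeVec (u l) =
      1 - (if l = i then (n l : ℝ) * r else 0) := fun i l => by
    have h1 : combo p ((r : ℝ) • Pi.single i 1 - fun i => (1 / n i : ℝ)) = latticeVec (v i) := by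
      rw [map_sub, map_smul, hc']
      ext j
      simp [combo_apply, v, latticeVec, Pi.single_apply]
    have h2 := hexp ((r : ℝ) • Pi.single i 1 - fun i => (1 / n i : ℝ)) (by
      simp only [Pi.sub_apply, Pi.smul_apply, smul_eq_mul, Finset.sum_sub_distrib, hr,
        ← Finset.mul_sum]
      simp)
    rw [h1] at h2
    have h3 := congrFun h2 l
    simp only [Pi.sub_apply, Pi.smul_apply, smul_eq_mul, Finset.sum_apply,
      Pi.single_apply] at h3
    have h4 : latticeVec (v i) ⬝ᵥ latticeVec (u l) =
        -(n l * ∑ j, latticeVec (v i) j * X j l) := by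
      rw [Finset.mul_sum, ← Finset.sum_neg_distrib]
      refine Finset.sum_congr rfl fun j _ => ?_
      have : latticeVec (u l) j = -((n l : ℝ) * X j l) := hu l j
      rw [this]
      ring
    rw [h4, ← h3, mul_sub, mul_one_div_cancel (hn0 l).ne']
    split_ifs <;> ring
  have hpairc : ∀ i μ, ∑ l, μ l = 1 → latticeVec (v i) ⬝ᵥ combo u μ = 1 - n i * r * μ i :=
    fun i μ hμ => by
      rw [combo_eq_sum, dotProduct_sum]
      simp only [dotProduct_smul, hpair, smul_eq_mul, mul_sub, mul_one, Finset.sum_sub_distrib,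
        hμ, mul_ite, mul_zero, Finset.sum_ite_eq', Finset.mem_univ, if_true]
      ring
  have hdual : dualPolytope (simplex v) = simplex u := by
    ext y
    rw [mem_simplex]
    constructor
    · intro hy
      have hle : ∀ i, latticeVec (v i) ⬝ᵥ y ≤ 1 := fun i =>
        hy _ (subset_convexHull ℝ _ ⟨i, rfl⟩)
      -- Obtained by solving `hpairc` for the coordinates of `y`; they sum to 1 because the unit
      -- fractions give a linear relation between the vertices `v i`.
      set μ : Fin (d + 1) → ℝ := fun i => (1 - latticeVec (v i) ⬝ᵥ y) * (1 / n i) / r with hμ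
      have hμ1 : ∑ i, μ i = 1 := by
        have h1 : combo v (fun i => (1 / n i : ℝ)) ⬝ᵥ y = 0 := by rw [hcv0, zero_dotProduct]
        rw [combo_eq_sum, sum_dotProduct] at h1
        simp only [smul_dotProduct, smul_eq_mul] at h1
        rw [← Finset.sum_div, div_eq_one_iff_eq hr0.ne', ← hr]
        simp only [sub_mul, one_mul, Finset.sum_sub_distrib]
        rw [sub_eq_self, ← h1]
        exact Finset.sum_congr rfl fun i _ => mul_comm _ _
      refine ⟨μ, fun i => ?_, hμ1, ?_⟩
      · have h1 := hle i
        have h2 := hpos i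
        exact div_nonneg (mul_nonneg (by linarith) h2.le) hr0.le
      · have h1 : ∀ i, latticeVec (v i) ⬝ᵥ (combo u μ - y) = 0 := fun i => by
          rw [dotProduct_sub, hpairc i μ hμ1, hμ]
          have := (hn0 i).ne'
          field_simp
          ring
        have h2 : ∀ x, combo v x ⬝ᵥ (combo u μ - y) = 0 := fun x => by
          rw [combo_eq_sum, sum_dotProduct]
          simp only [smul_dotProduct, h1, smul_zero, Finset.sum_const_zero]
        refine sub_eq_zero.1 (funext fun j => ?_)
        obtain ⟨x, _, hx⟩ := hv.exists_eq 0 (Pi.single j 1)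
        have h3 := h2 x
        rwa [hx, single_one_dotProduct] at h3
    · rintro ⟨μ, hμ0, hμ1, rfl⟩ x hx
      obtain ⟨w, hw0, hw1, rfl⟩ := mem_simplex.1 hx
      rw [combo_eq_sum v, sum_dotProduct, ← hw1]
      refine Finset.sum_le_sum fun i _ => ?_
      rw [smul_dotProduct, hpairc i μ hμ1, smul_eq_mul]
      refine mul_le_of_le_one_right (hw0 i) ?_
      have := mul_nonneg (mul_nonneg (hn0 i).le hr0.le) (hμ0 i)
      linarith
  refine ⟨isLatticePolytope_simplex p, r, by exact_mod_cast hr0, simplex v,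
    ⟨isLatticePolytope_simplex v, ?_, by rw [hdual]; exact isLatticePolytope_simplex u⟩,
    1, -c, by simp, ?_⟩
  · refine zero_mem_interior_simplex hv (w := (r : ℝ)⁻¹ • fun i => (1 / n i : ℝ))
      (fun i => mul_pos (inv_pos.2 hr0) (hpos i)) ?_ (by rw [map_smul, hcv0, smul_zero])
    simp only [Pi.smul_apply, smul_eq_mul, ← Finset.mul_sum, hr, inv_mul_cancel₀ hr0.ne']
  · have haff : ∀ x : Fin d → ℝ, affineLatticeMap 1 (-c) x = x - latticeVec c := fun x => by
      have h1 : (1 : Matrix (Fin d) (Fin d) ℤ).map (fun a : ℤ => (a : ℝ)) = 1 := by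
        simp [Matrix.map_one]
      ext j
      simp [affineLatticeMap, h1, latticeVec, sub_eq_add_neg]
    ext y
    simp only [Set.mem_image, mem_simplex, mem_smul_simplex hr0.le, haff]
    constructor
    · rintro ⟨w, hw0, hw1, rfl⟩
      exact ⟨_, ⟨(r : ℝ) • w, fun i => mul_nonneg hr0.le (hw0 i), by
        simp [← Finset.mul_sum, hw1], rfl⟩, by rw [hcv, hw1, map_smul, one_smul]⟩
    · rintro ⟨_, ⟨w, hw0, hw1, rfl⟩, rfl⟩
      have hs : ∑ i, ((r : ℝ)⁻¹ • w) i = 1 := by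
        simp only [Pi.smul_apply, smul_eq_mul, ← Finset.mul_sum, hw1, inv_mul_cancel₀ hr0.ne']
      exact ⟨(r : ℝ)⁻¹ • w, fun i => mul_nonneg (inv_nonneg.2 hr0.le) (hw0 i), hs, by
        rw [hcv, hs, map_smul, smul_inv_smul₀ hr0.ne', one_smul]⟩

end Gorenstein

/-! ### Simplices correspond to forest data. -/

section Classification

/-- The simplex `P` is described by the data `D`. -/
def IsDescribedBy {v d : ℕ} (k : ℕ) (P : Set (Fin d → ℝ)) (D : ForestData v) : Prop :=
  ∃ (p : Fin (d + 1) → Fin d → ℤ) (ν : Fin (d + 1) → Option (Fin D.1)), AffIndep p ∧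
    P = simplex p ∧ (∀ i, ν i ≠ none) ∧ Balanced D.2.1.1 D.2.2 ν 1 k ∧
    forestLattice D.2.1.1 D.2.2 ν = simplexLattice p

variable {v k : ℕ}

theorem exists_isDescribedBy (hv : 2 ≤ v) (hk : 1 ≤ k) {d : ℕ} (P : StepSimplex v k d) :
    ∃ D : ForestData v, IsDescribedBy k P.1 D := by
  obtain ⟨P, ⟨p, hp, rfl⟩, -, hpyr, hh⟩ := P
  change ¬ IsLatticePyramid (simplex p) at hpyr
  have hk0 : (0 : ℝ) < k := by exact_mod_cast hk
  have hst := (hasHStar_step_iff hp v hk).1 hh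
  obtain ⟨s, f, q, ν, hf, hprod, hbal, hlat⟩ := exists_forest v
    (stdLattice_le_simplexLattice p) (fun _ => one_pos) hk0 (by omega) hst
  refine ⟨⟨s, ⟨f, hf, hprod⟩, q⟩, p, ν, hp, rfl, fun i hi => ?_, hbal, hlat⟩
  have hi' : ∀ x ∈ simplexLattice p, x i ∈ intReal := fun x hx =>
    forestLattice_mem_of_none (hlat ▸ hx) hi
  cases d with
  -- A point is not a pyramid, so dimension 0 needs its own argument: an integral coordinate leaves
  -- only 0 in the cube, whereas v ≥ 2 requires a vector of index 1.
  | zero =>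
    obtain ⟨x, hx, hb, hw⟩ := hst.exists_mem 1 (by omega)
    have h0 : x = 0 := by
      ext j
      rw [show j = i by omega]
      exact eq_zero_of_mem_intReal (hi' x hx) (by linarith [(hb i).1]) (hb i).2
    rw [h0, dotProduct_zero] at hw
    simp only [Nat.cast_one, mul_one] at hw
    exact hk0.ne hw
  | succ d => exact hpyr (isLatticePyramid_of_integral_coord hp hi')

theorem exists_stepSimplex (hv : 2 ≤ v) (hk : 1 ≤ k) (D : ForestData v) :
    ∃ (d : ℕ) (P : StepSimplex v k d), IsDescribedBy k P.1 D := by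
  obtain ⟨s, ⟨f, hf, hprod⟩, q⟩ := D
  have hs : 0 < s := OrderedFactorization.length_pos hv ⟨f, hf, hprod⟩
  have hk0 : (0 : ℝ) < k := by exact_mod_cast hk
  obtain ⟨d, hd⟩ : ∃ d, ∑ j, nodeCount f q k j = d + 1 := by
    refine Nat.exists_eq_succ_of_ne_zero (ne_of_gt ?_)
    exact lt_of_lt_of_le (Nat.zero_lt_of_lt (lt_nodeCount hf q hk ⟨0, hs⟩))
      (Finset.single_le_sum (f := nodeCount f q k) (fun _ _ => Nat.zero_le _)
        (Finset.mem_univ _))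
  have hlab := exists_balanced_label hf q hk
  rw [hd] at hlab
  obtain ⟨ν, hν, hbal⟩ := hlab
  have hst := forestLattice_stepped hf hk0 hbal
  rw [hprod] at hst
  have hstd := stdLattice_le_forestLattice f q ν
  obtain ⟨n, hn1, hn, hnx⟩ := exists_unit_fractions hf q ν
  -- Coordinate sums are integral because cube vectors have sum k m, and the product of the
  -- unit-fraction denominators is a common denominator.
  obtain ⟨p, hp, hpL⟩ := exists_simplexLattice_eq (N := ∏ i, n i) hstd (fun x hx => by
      obtain ⟨m, -, hm⟩ := hst.exists_index _ (fract_mem_of_mem hstd hx) (fract_mem_unitBox x)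
      rw [one_dotProduct] at hm
      have h1 : ∑ i, (x i - Int.fract (x i)) ∈ intReal :=
        intReal.sum_mem fun i _ => sub_fract_mem_intReal (x i)
      rw [Finset.sum_sub_distrib, hm] at h1
      exact mem_intReal_of_sub_mem h1
        (intReal_mul_mem (natCast_mem_intReal k) (natCast_mem_intReal m)))
    (Finset.prod_ne_zero_iff.2 fun i _ => by have := hn1 i; omega) (fun x hx i => by
      obtain ⟨c, hc⟩ := Finset.dvd_prod_of_mem n (Finset.mem_univ i)
      have := intReal_mul_mem (natCast_mem_intReal c) (hnx x hx i)
      rw [hc]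
      convert this using 1
      push_cast
      ring)
  refine ⟨d, ⟨simplex p, ⟨p, hp, rfl⟩, ?_, fun hpyr => ?_, ?_⟩, p, ν, hp, rfl, hν, hbal,
    hpL.symm⟩
  · rw [← hpL] at hn hnx
    exact isGorenstein_simplex hp hn1 hn hnx
  · obtain ⟨a, ha⟩ := exists_integral_coord hp hpyr
    rw [hpL] at ha
    exact hν a (label_eq_none_of_mem hf ha)
  · rw [hasHStar_step_iff hp v hk, hpL]
    exact hst

/-- Equivalence permutes coordinates, which relabels the forest without changing factors or parents;
balance for unit weights depends only on class sizes, so `forest_unique` applies. -/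
theorem forestData_unique (hk : 1 ≤ k) {d : ℕ} {P Q : Set (Fin d → ℝ)} {D E : ForestData v}
    (hP : IsDescribedBy k P D) (hQ : IsDescribedBy k Q E) (h : UnimodularlyEquivalent P Q) :
    D = E := by
  obtain ⟨s, ⟨f, hf, hfv⟩, a⟩ := D
  obtain ⟨s', ⟨f', hf', hfv'⟩, a'⟩ := E
  obtain ⟨p, ν, hp, rfl, -, hbal, hlat⟩ := hP
  obtain ⟨q, μ, hq, rfl, -, hbal', hlat'⟩ := hQ
  dsimp only at ν μ hbal hlat hbal' hlat'
  obtain ⟨σ, hσ⟩ := exists_perm_of_unimodularlyEquivalent hq h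
  have hcomp : (ν ∘ σ.symm) ∘ σ = ν := by
    ext1 i
    simp
  have hL : forestLattice f a (ν ∘ σ.symm) = forestLattice f' a' μ := by
    ext x
    rw [hlat', hσ, ← hlat, ← mem_forestLattice_comp σ f a (ν ∘ σ.symm) x, hcomp]
  have hB : Balanced f a (ν ∘ σ.symm) 1 k := by
    rw [balanced_one_iff hf a _ hk] at hbal ⊢
    intro j
    rw [← hbal j]
    exact Nat.card_congr (σ.symm.subtypeEquiv fun i => Iff.rfl)
  have key := forest_unique hf hf' (by exact_mod_cast hk : (0 : ℝ) < k) hB hbal' hL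
  obtain rfl : s = s' := congrArg Sigma.fst key
  have key := eq_of_heq (Sigma.mk.inj key).2
  simp only [Prod.mk.injEq] at key
  obtain ⟨rfl, rfl, -⟩ := key
  rfl

/-- Equal data prescribe equal class sizes, so some bijection of vertices matches the labels. In
particular the dimensions agree. -/
theorem unimodularlyEquivalent_of_isDescribedBy (hk : 1 ≤ k) {d d' : ℕ} {P : StepSimplex v k d}
    {Q : StepSimplex v k d'} {D : ForestData v} (hP : IsDescribedBy k P.1 D)
    (hQ : IsDescribedBy k Q.1 D) :
    (⟨d, Quotient.mk (stepSimplexSetoid v k d) P⟩ : StepSimplexClass v k) =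
      ⟨d', Quotient.mk (stepSimplexSetoid v k d') Q⟩ := by
  obtain ⟨p, ν, hp, hPp, hν, hbal, hlat⟩ := hP
  obtain ⟨q, μ, hq, hQq, hμ, hbal', hlat'⟩ := hQ
  rw [balanced_one_iff D.2.1.2.1 _ _ hk] at hbal hbal'
  obtain ⟨e, he⟩ := exists_relabel hν hμ fun j => (hbal j).trans (hbal' j).symm
  obtain rfl : d = d' := by
    have := Fintype.card_congr e
    simpa using this
  refine congrArg (Sigma.mk d) (Quotient.sound ?_)
  change UnimodularlyEquivalent P.1 Q.1
  rw [hPp, hQq]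
  refine unimodularlyEquivalent_of_perm hp hq e fun x => ?_
  have hμν : μ ∘ e = ν := funext he
  rw [← hlat', ← mem_forestLattice_comp e, hμν, hlat]

theorem exists_bijective_forestData (hv : 2 ≤ v) (hk : 1 ≤ k) :
    ∃ F : StepSimplexClass v k → ForestData v, Function.Bijective F := by
  choose G hG using fun (d : ℕ) (P : StepSimplex v k d) => exists_isDescribedBy hv hk P
  refine ⟨fun c => Quotient.lift (s := stepSimplexSetoid v k c.1) (G c.1)
    (fun P Q h => forestData_unique hk (hG _ P) (hG _ Q) h) c.2, ?_, fun D => ?_⟩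
  · rintro ⟨d, ⟨P⟩⟩ ⟨d', ⟨Q⟩⟩ h
    have h' : G d P = G d' Q := h
    exact unimodularlyEquivalent_of_isDescribedBy hk (hG d P) (h' ▸ hG d' Q)
  · obtain ⟨d, P, hP⟩ := exists_stepSimplex hv hk D
    exact ⟨⟨d, Quotient.mk _ P⟩, forestData_unique hk (hG d P) hP (.refl _)⟩

theorem numClasses_eq_card (hv : 2 ≤ v) (hk : 1 ≤ k) :
    numClasses v k = Nat.card (ForestData v) := by
  obtain ⟨F, hF⟩ := exists_bijective_forestData hv hk
  exact Nat.card_eq_of_bijective F hF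

end Classification

end

end GorensteinSimplices

open GorensteinSimplices

theorem theorem1p2 (v k : ℕ) (hv : 2 ≤ v) (hk : 1 ≤ k) :
    Finite (StepSimplexClass v k) ∧
    HasSum (fun s : ℕ+ => chainCount s v * (s : ℕ)!) (numClasses v k) ∧
    ∀ v' k' : ℕ, 2 ≤ v' → 1 ≤ k' →
      Nonempty (DivisorLattice v ≃o DivisorLattice v') → numClasses v k = numClasses v' k' := by
  refine ⟨?_, ?_, fun v' k' hv' hk' ⟨e⟩ => ?_⟩
  · obtain ⟨F, hF⟩ := exists_bijective_forestData hv hk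
    exact Finite.of_injective F hF.injective
  · rw [numClasses_eq_card hv hk]
    exact card_forestData hv
  · rw [numClasses_eq_card hv hk, numClasses_eq_card hv' hk']
    refine (card_forestData hv).unique ?_
    simpa only [chainCount_congr e] using card_forestData hv'
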